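/- Let $M$ be a closed (compact, without boundary) smooth four-dimensional manifold and let $g$ be a smooth Riemannian metric on $M$. Let $\nabla$, $R$, $\Delta=g^{pq}\nabla_q\nabla_p$, $dV_g$ be the Levi-Civita connection, the scalar curvature, the Laplace-Beltrami operator and the Riemannian volume measure of $g$, and let $\operatorname{Vol}_g(M)=\int_M dV_g$. With the convention $R_{ijkl}=g\big(\mathrm{R}(\partial_k,\partial_l)\partial_j,\partial_i\big)$, $\mathrm{R}(X,Y)Z=\nabla_X\nabla_YZ-\nabla_Y\nabla_XZ-\nabla_{[X,Y]}Z$, $R_{ik}=g^{jl}R_{ijkl}$, let $$W_{ijkl}=R_{ijkl}-\tfrac12\,(R_{ik}g_{jl}-R_{il}g_{jk}+R_{jl}g_{ik}-R_{jk}g_{il})+\tfrac{R}{6}\,(g_{ik}g_{jl}-g_{il}g_{jk})$$ be the Weyl tensor and $(\delta W)_{ijk}=g^{ts}\nabla_sW_{tijk}$ its divergence. All squared norms of tensors are full contractions with $g$, e.g. $|W|^2=W_{ijkl}W^{ijkl}$, and $W_{ijkl}W_{ijpq}W_{klpq}$ stands for $W_{ijkl}\,W^{ij}{}_{pq}\,W^{klpq}$.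 Put $$\mathfrak D(g)=\operatorname{Vol}_g(M)^{1/2}\int_M|\delta_gW_g|_g^2\,dV_g .$$ The metric $g$ is called critical in its conformal class for $\mathfrak D$ if for every smooth function $u(x,t)$ on $M\times\mathbb R$ with $u(\cdot,0)\equiv0$ the function $t\mapsto\mathfrak D\big(e^{2u(\cdot,t)}g\big)$ is differentiable at $t=0$ with derivative $0$. Then $g$ is critical in its conformal class for $\mathfrak D$ if and only if it is a weak harmonic Weyl metric, i.e. at every point of $M$ $$\tfrac12\Delta|W|^2=|\nabla W|^2+\tfrac12R\,|W|^2-3\,W_{ijkl}W_{ijpq}W_{klpq}-8\,|\delta W|^2+\frac{4}{\operatorname{Vol}_g(M)}\int_M|\delta W|^2\,dV_g .$$ -/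

import Mathlib

open Set Filter Topology MeasureTheory
open scoped Manifold ContDiff Bundle

noncomputable section

namespace WeakHarmonicWeyl

/-- The model space `ℝ⁴` (with its Euclidean norm and Lebesgue measure). -/
abbrev E4 : Type := EuclideanSpace ℝ (Fin 4)

/-! ### Riemannian geometry in coordinates on `ℝ⁴`

In this part a metric is given by its components `G y i j = g_{ij}(y)`, and a covariant tensor
field of rank `k` by its components `T y I = T_{I 0, …, I (k-1)}(y)`. -/

/-- The partial derivative `∂_i f (y)`. -/
def pderiv (i : Fin 4) (f : E4 → ℝ) (y : E4) : ℝ :=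
  fderiv ℝ f y (EuclideanSpace.single i 1)

/-- Components of a metric in coordinates. -/
abbrev CoordMetric : Type := E4 → Matrix (Fin 4) (Fin 4) ℝ

/-- Components of a covariant tensor field of rank `k` in coordinates. -/
abbrev CoordTensor (k : ℕ) : Type := E4 → (Fin k → Fin 4) → ℝ

/-- The components `g^{ij}` of the inverse metric. -/
def invMetric (G : CoordMetric) (y : E4) (i j : Fin 4) : ℝ := (G y)⁻¹ i j

/-- Christoffel symbols
`Γ^k_{ij} = ½ g^{kl} (∂_i g_{jl} + ∂_j g_{il} - ∂_l g_{ij})`. -/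
def christoffel (G : CoordMetric) (y : E4) (k i j : Fin 4) : ℝ :=
  (1 / 2) * ∑ l, invMetric G y k l *
    (pderiv i (fun z => G z j l) y + pderiv j (fun z => G z i l) y - pderiv l (fun z => G z i j) y)

/-- The `(1,3)` curvature tensor `R^m_{jkl}`, where `R(∂_k, ∂_l) ∂_j = R^m_{jkl} ∂_m` and
`R(X, Y) Z = ∇_X ∇_Y Z - ∇_Y ∇_X Z - ∇_{[X, Y]} Z`. -/
def curvature (G : CoordMetric) (y : E4) (m j k l : Fin 4) : ℝ :=
  pderiv k (fun z => christoffel G z m l j) y - pderiv l (fun z => christoffel G z m k j) y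
    + ∑ p, (christoffel G y m k p * christoffel G y p l j
      - christoffel G y m l p * christoffel G y p k j)

/-- The `(0,4)` curvature tensor `R_{ijkl} = g_{im} R^m_{jkl}`. -/
def riemann (G : CoordMetric) (y : E4) (i j k l : Fin 4) : ℝ :=
  ∑ m, G y i m * curvature G y m j k l

/-- The Ricci tensor `R_{ik} = g^{jl} R_{ijkl}`. -/
def ricci (G : CoordMetric) (y : E4) (i k : Fin 4) : ℝ :=
  ∑ j, ∑ l, invMetric G y j l * riemann G y i j k l

/-- The scalar curvature `R = g^{ik} R_{ik}`. -/
def scalarCurv (G : CoordMetric) (y : E4) : ℝ :=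
  ∑ i, ∑ k, invMetric G y i k * ricci G y i k

/-- The components `W_{ijkl}` of the Weyl tensor in dimension four. -/
def weyl (G : CoordMetric) (y : E4) (i j k l : Fin 4) : ℝ :=
  riemann G y i j k l
    - (1 / 2) * (ricci G y i k * G y j l - ricci G y i l * G y j k
        + ricci G y j l * G y i k - ricci G y j k * G y i l)
    + scalarCurv G y / 6 * (G y i k * G y j l - G y i l * G y j k)

/-- The Weyl tensor as a covariant tensor field of rank four. -/
def weylTensor (G : CoordMetric) : CoordTensor 4 :=
  fun y I => weyl G y (I 0) (I 1) (I 2) (I 3)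

/-- The covariant derivative of a covariant tensor field; the index of differentiation is
appended as the last one:
`T_{i_1 … i_k, l} = ∂_l T_{i_1 … i_k} - ∑_a Γ^m_{l i_a} T_{i_1 … m … i_k}`. -/
def covDeriv (G : CoordMetric) {k : ℕ} (T : CoordTensor k) : CoordTensor (k + 1) :=
  fun y J =>
    let I : Fin k → Fin 4 := fun a => J a.castSucc
    let l : Fin 4 := J (Fin.last k)
    pderiv l (fun z => T z I) y
      - ∑ a : Fin k, ∑ m, christoffel G y m l (I a) * T y (Function.update I a m)

/-- All indices raised: `T^{i_1 … i_k} = g^{i_1 j_1} ⋯ g^{i_k j_k} T_{j_1 … j_k}`. -/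
def raiseAll (G : CoordMetric) {k : ℕ} (T : CoordTensor k) : CoordTensor k :=
  fun y I => ∑ J : Fin k → Fin 4, (∏ a, invMetric G y (I a) (J a)) * T y J

/-- The squared norm `|T|² = T_{i_1 … i_k} T^{i_1 … i_k}`. -/
def normSq (G : CoordMetric) {k : ℕ} (T : CoordTensor k) (y : E4) : ℝ :=
  ∑ I : Fin k → Fin 4, T y I * raiseAll G T y I

/-- The divergence of the Weyl tensor, `(δW)_{ijk} = W_{tijk, t} = g^{ts} W_{tijk, s}`. -/
def divWeyl (G : CoordMetric) : CoordTensor 3 :=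
  fun y I => ∑ t, ∑ s, invMetric G y t s *
    covDeriv G (weylTensor G) y ![t, I 0, I 1, I 2, s]

/-- The cubic contraction
`W_{ijkl} W_{ijpq} W_{klpq} = W_{ijkl} (g^{ia} g^{jb} W_{abpq}) W^{klpq}`. -/
def weylCubic (G : CoordMetric) (y : E4) : ℝ :=
  ∑ i, ∑ j, ∑ k, ∑ l, ∑ p, ∑ q,
    weyl G y i j k l
      * (∑ a, ∑ b, invMetric G y i a * invMetric G y j b * weyl G y a b p q)
      * raiseAll G (weylTensor G) y ![k, l, p, q]

/-- The Laplacian of a function, `Δf = g^{ij} (∂_i ∂_j f - Γ^k_{ij} ∂_k f)`. -/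
def coordLaplacian (G : CoordMetric) (f : E4 → ℝ) (y : E4) : ℝ :=
  ∑ i, ∑ j, invMetric G y i j *
    (pderiv i (pderiv j f) y - ∑ k, christoffel G y k i j * pderiv k f y)

/-! ### Riemannian four-manifolds -/

section Manifold

variable (M : Type*) [TopologicalSpace M] [ChartedSpace E4 M] [IsManifold (𝓡 4) ∞ M]

/-- Smooth Riemannian metrics on the four-manifold `M`. -/
abbrev Metric4 : Type _ :=
  Bundle.ContMDiffRiemannianMetric (𝓡 4) ∞ E4 (fun x : M => TangentSpace (𝓡 4) x)

variable {M}

/-- The components `g_{ij} = g(∂_i, ∂_j)` of a Riemannian metric in a chart `e`, where `∂_i` is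
the image of the `i`-th standard basis vector under the differential of `e⁻¹`. -/
def coordMetric (g : Metric4 M) (e : OpenPartialHomeomorph M E4) : CoordMetric :=
  fun y => Matrix.of fun i j =>
    g.inner (e.symm y)
      (mfderiv (𝓡 4) (𝓡 4) e.symm y (EuclideanSpace.single i (1 : ℝ) : E4))
      (mfderiv (𝓡 4) (𝓡 4) e.symm y (EuclideanSpace.single j (1 : ℝ) : E4))

/-- A scalar invariant of a metric, given in coordinates by `s`, evaluated at the point `x` of the
manifold by means of the preferred chart at `x`. -/
def atPoint (s : CoordMetric → E4 → ℝ) (g : Metric4 M) (x : M) : ℝ :=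
  s (coordMetric g (chartAt E4 x)) (chartAt E4 x x)

/-- The scalar curvature `R`. -/
def scalarCurvature (g : Metric4 M) : M → ℝ := atPoint scalarCurv g

/-- `|W|²`. -/
def weylNormSq (g : Metric4 M) : M → ℝ := atPoint (fun G => normSq G (weylTensor G)) g

/-- `|∇W|²`. -/
def gradWeylNormSq (g : Metric4 M) : M → ℝ :=
  atPoint (fun G => normSq G (covDeriv G (weylTensor G))) g

/-- `|δW|²`. -/
def divWeylNormSq (g : Metric4 M) : M → ℝ := atPoint (fun G => normSq G (divWeyl G)) g

/-- `W_{ijkl} W_{ijpq} W_{klpq}`. -/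
def weylCube (g : Metric4 M) : M → ℝ := atPoint weylCubic g

/-- The Laplace-Beltrami operator on functions. -/
def laplacian (g : Metric4 M) (f : M → ℝ) (x : M) : ℝ :=
  coordLaplacian (coordMetric g (chartAt E4 x)) (fun y => f ((chartAt E4 x).symm y))
    (chartAt E4 x x)

set_option synthInstance.maxHeartbeats 400000 in
set_option maxHeartbeats 1000000 in
/-- The metric `e^{2f} g`. -/
def conformalMetric (g : Metric4 M) (f : M → ℝ) (hf : ContMDiff (𝓡 4) 𝓘(ℝ, ℝ) ∞ f) :
    Metric4 M where
  inner x := Real.exp (2 * f x) • g.inner x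
  symm x v w := by
    simp [g.symm x v w]
  pos x v hv := by
    simpa using mul_pos (Real.exp_pos (2 * f x)) (g.pos x v hv)
  isVonNBounded x := by
    have hc : 0 < Real.exp (2 * f x) := Real.exp_pos _
    have h := (g.isVonNBounded x).image
      (Real.exp (-f x) • ContinuousLinearMap.id ℝ (TangentSpace (𝓡 4) x))
    refine h.subset ?_
    intro v hv
    refine ⟨Real.exp (f x) • v, ?_, ?_⟩
    · have : Real.exp (2 * f x) = Real.exp (f x) * Real.exp (f x) := by
        rw [← Real.exp_add]; ring_nf
      simp only [mem_ofPred_eq, smul_apply, smul_eq_mul, this] at hv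
      simpa [mul_assoc] using hv
    · simp [smul_smul, ← Real.exp_add]
  contMDiff := by
    have h1 : ContMDiff (𝓡 4) 𝓘(ℝ, ℝ) ∞ (fun x => Real.exp (2 * f x)) := by
      have h2 : ContDiff ℝ ∞ (fun t : ℝ => Real.exp (2 * t)) := by fun_prop
      exact h2.contMDiff.comp hf
    exact h1.smul_section g.contMDiff

section Volume

variable [T2Space M] [CompactSpace M]

variable (M) in
/-- A smooth partition of unity subordinate to the atlas. -/
def atlasPartition : SmoothPartitionOfUnity M (𝓡 4) M univ :=
  Classical.choose (SmoothPartitionOfUnity.exists_isSubordinate_chartAt_source (𝓡 4) M)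

variable [MeasurableSpace M]

/-- The Riemannian volume measure `dV_g`: with a partition of unity `ρ` subordinate to the atlas,
`∫ f dV_g = ∑_i ∫ (ρ_i f)(e_i⁻¹ y) √det g_{ij}(y) dy`. -/
def volumeMeasure (g : Metric4 M) : Measure M :=
  Measure.sum fun x : M =>
    Measure.map (chartAt E4 x).symm
      ((volume.restrict (chartAt E4 x).target).withDensity fun y =>
        ENNReal.ofReal (atlasPartition M x ((chartAt E4 x).symm y) *
          Real.sqrt (coordMetric g (chartAt E4 x) y).det))

/-- The volume `Vol_g(M)`. -/
def vol (g : Metric4 M) : ℝ := (volumeMeasure g).real univ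

/-- The functional `𝔇(g) = Vol_g(M)^{1/2} ∫ |δ_g W_g|² dV_g`. -/
def functionalD (g : Metric4 M) : ℝ :=
  vol g ^ (1 / 2 : ℝ) * ∫ x, divWeylNormSq g x ∂(volumeMeasure g)

/-- `g` is critical in its conformal class for `𝔇`: for each smooth family of functions
`u(x, t)` with `u(x, 0) = 0`, the derivative of `t ↦ 𝔇(e^{2 u(·, t)} g)` at `t = 0` exists
and vanishes. -/
def IsConformallyCritical (g : Metric4 M) : Prop :=
  ∀ (u : M → ℝ → ℝ)
    (hu : ContMDiff ((𝓡 4).prod 𝓘(ℝ, ℝ)) 𝓘(ℝ, ℝ) ∞ (fun q : M × ℝ => u q.1 q.2)),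
    (∀ x, u x 0 = 0) →
    HasDerivAt
      (fun t : ℝ => functionalD (conformalMetric g (fun x => u x t)
        (hu.comp (contMDiff_id.prodMk contMDiff_const)))) 0 0

end Volume

end Manifold

end WeakHarmonicWeyl

end

open WeakHarmonicWeyl

noncomputable section

namespace WeakHarmonicWeyl

/-! ### Partial derivatives -/

section Calculus

variable {f g : E4 → ℝ} {U : Set E4} {y : E4} {i j : Fin 4}

/-! Under g ↦ e^{2u} g the Weyl tensor becomes e^{2u} W, and in dimension four δW becomes δW +
W(∇u), the coefficient being n - 3 = 1 (`IsMetricOn.divWeyl_conformal`). Three raised indices cost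
e^{-6u} and the volume gains e^{4u}, so 𝔇(e^{2u} g) is (∫ e^{4u})^{1/2} ∫ e^{-2u} |δW + W(∇u)|²,
with both integrals taken against the fixed measure of g.

Let φ = ∂_t u at t = 0, V = Vol, A = ∫ |δW|². The derivative at t = 0 is 2 V^{-1/2} A ∫ φ + V^{1/2}
∫ (-2 φ |δW|² + 2 ⟨δW, W(∇φ)⟩). The last term pairs ∇φ with the covector X_s = W_{sijk} (δW)^{ijk}.
Integration by parts (`integral_divPairing`) makes the derivative -2 V^{1/2} ∫ φ Z with Z = |δW|² +
div X - A/V (`hasDerivAt_functionalD`). Taking u = tZ shows that g is critical exactly when Z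
vanishes identically (`isConformallyCritical_iff`).

Two identities valid for every metric finish the proof: div X = |δW|² + ⟨W, ∇δW⟩, and the
Weitzenböck formula ½Δ|W|² = |∇W|² + ½R|W|² - 3WWW + 4⟨W, ∇δW⟩ (`IsMetricOn.weitzenboeck`). The
equation Z = 0 says ⟨W, ∇δW⟩ = A/V - 2|δW|², and substituting this gives the weak harmonic Weyl
equation. The Weitzenböck formula comes from pairing W with the derivative of the Bianchi identity
for W, commuting two covariant derivatives, and splitting the curvature into its Weyl and Schouten
parts (`weitzenboeck_algebra`). Dimension four enters again there, because the two cubic invariants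
of W are proportional.

The local identities are proved at one point. Every tensor is shown to be natural under changes of
coordinates, so the Christoffel symbols may be assumed to vanish at the point and, where useful, the
frame to be orthonormal. The same naturality makes the scalar invariants on the manifold independent
of the chart. A partition of unity then reduces the divergence theorem to the vanishing of the
integral of a partial derivative of a compactly supported function. -/

theorem _root_.ContDiffOn.diffAt (hf : ContDiffOn ℝ ∞ f U) (hU : IsOpen U) (hy : y ∈ U) :
    DifferentiableAt ℝ f y :=
  (hf.contDiffAt (hU.mem_nhds hy)).differentiableAt (by simp)

theorem pderiv_congr (h : f =ᶠ[𝓝 y] g) : pderiv i f y = pderiv i g y := by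
  simp only [pderiv, h.fderiv_eq]

theorem pderiv_congr_on (hU : IsOpen U) (hy : y ∈ U) (h : ∀ z ∈ U, f z = g z) :
    pderiv i f y = pderiv i g y :=
  pderiv_congr (Filter.eventuallyEq_of_mem (hU.mem_nhds hy) h)

@[simp] theorem pderiv_const (c : ℝ) : pderiv i (fun _ => c) y = 0 := by
  simp [pderiv]

theorem pderiv_add (hf : DifferentiableAt ℝ f y) (hg : DifferentiableAt ℝ g y) :
    pderiv i (fun z => f z + g z) y = pderiv i f y + pderiv i g y := by
  simp [pderiv, fderiv_fun_add hf hg]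

theorem pderiv_sub (hf : DifferentiableAt ℝ f y) (hg : DifferentiableAt ℝ g y) :
    pderiv i (fun z => f z - g z) y = pderiv i f y - pderiv i g y := by
  simp [pderiv, fderiv_fun_sub hf hg]

theorem pderiv_neg : pderiv i (fun z => - f z) y = - pderiv i f y := by
  simp [pderiv, fderiv_fun_neg]

theorem pderiv_mul (hf : DifferentiableAt ℝ f y) (hg : DifferentiableAt ℝ g y) :
    pderiv i (fun z => f z * g z) y = pderiv i f y * g y + f y * pderiv i g y := by
  simp [pderiv, fderiv_fun_mul hf hg]; ring

/-- Differentiability of `f` is not needed: for `c ≠ 0` the functions `f` and `c * f` are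
differentiable together, and otherwise both derivatives take the default value 0. -/
theorem pderiv_const_mul (c : ℝ) : pderiv i (fun z => c * f z) y = c * pderiv i f y := by
  by_cases hf : DifferentiableAt ℝ f y
  · simp [pderiv, fderiv_const_mul hf]
  · rcases eq_or_ne c 0 with rfl | hc
    · simp
    · have : ¬ DifferentiableAt ℝ (fun z => c * f z) y := fun h => hf <| by
        simpa [← mul_assoc, inv_mul_cancel₀ hc] using h.const_mul c⁻¹
      simp [pderiv, fderiv_zero_of_not_differentiableAt hf,
        fderiv_zero_of_not_differentiableAt this]

theorem pderiv_sum {ι : Type*} {s : Finset ι} {F : ι → E4 → ℝ}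
    (h : ∀ a ∈ s, DifferentiableAt ℝ (F a) y) :
    pderiv i (fun z => ∑ a ∈ s, F a z) y = ∑ a ∈ s, pderiv i (F a) y := by
  simp [pderiv, fderiv_fun_sum h]

theorem pderiv_prod {ι : Type*} [DecidableEq ι] {s : Finset ι} {F : ι → E4 → ℝ}
    (h : ∀ a ∈ s, DifferentiableAt ℝ (F a) y) :
    pderiv i (fun z => ∏ a ∈ s, F a z) y
      = ∑ a ∈ s, (∏ b ∈ s.erase a, F b y) * pderiv i (F a) y := by
  simp [pderiv, fderiv_finsetProd h]

theorem pderiv_exp (hf : DifferentiableAt ℝ f y) :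
    pderiv i (fun z => Real.exp (f z)) y = Real.exp (f y) * pderiv i f y := by
  simp [pderiv, fderiv_exp hf]

theorem fderiv_eq_sum_pderiv (v : E4) : fderiv ℝ f y v = ∑ c, v c * pderiv c f y := by
  have hv : v = ∑ c, v c • (EuclideanSpace.single c (1 : ℝ) : E4) := by
    ext k
    simp [Pi.single_apply]
  conv_lhs => rw [hv]
  simp [pderiv]

theorem contDiffOn_pderiv (hU : IsOpen U) (hf : ContDiffOn ℝ ∞ f U) :
    ContDiffOn ℝ ∞ (pderiv i f) U := by
  have h : ContDiffOn ℝ ∞ (fderiv ℝ f) U := hf.fderiv_of_isOpen hU (by simp)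
  exact h.clm_apply contDiffOn_const

theorem pderiv_comm (hU : IsOpen U) (hf : ContDiffOn ℝ ∞ f U) (hy : y ∈ U) :
    pderiv i (pderiv j f) y = pderiv j (pderiv i f) y := by
  have h : ContDiffAt ℝ ∞ f y := hf.contDiffAt (hU.mem_nhds hy)
  have hs : IsSymmSndFDerivAt ℝ f y := h.isSymmSndFDerivAt (by simpa using (WithTop.coe_le_coe.2 le_top : ((2 : ℕ∞) : WithTop ℕ∞) ≤ ((⊤ : ℕ∞) : WithTop ℕ∞)))
  have hd : DifferentiableAt ℝ (fderiv ℝ f) y :=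
    ((hf.fderiv_of_isOpen hU (m := ∞) (by simp)).contDiffAt
      (hU.mem_nhds hy)).differentiableAt (by simp)
  have key : ∀ a b : Fin 4, pderiv a (pderiv b f) y
      = fderiv ℝ (fderiv ℝ f) y (EuclideanSpace.single a 1) (EuclideanSpace.single b 1) := by
    intro a b
    show fderiv ℝ (fun z => fderiv ℝ f z (EuclideanSpace.single b 1)) y _ = _
    rw [fderiv_clm_apply hd (by fun_prop)]
    simp
  rw [key, key, hs.eq]

/-- The Jacobian matrix `∂_i ψ^a` of a map between coordinate spaces. -/
def jac (ψ : E4 → E4) (y : E4) : Matrix (Fin 4) (Fin 4) ℝ :=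
  Matrix.of fun a i => pderiv i (fun z => ψ z a) y

theorem jac_apply (ψ : E4 → E4) (y : E4) (a i : Fin 4) :
    jac ψ y a i = pderiv i (fun z => ψ z a) y := rfl

theorem jac_eq_fderiv {ψ : E4 → E4} (hψ : DifferentiableAt ℝ ψ y) (a i : Fin 4) :
    jac ψ y a i = fderiv ℝ ψ y (EuclideanSpace.single i 1) a := by
  have h := ((EuclideanSpace.proj (𝕜 := ℝ) a).hasFDerivAt.comp y hψ.hasFDerivAt).fderiv
  have h2 : (fun z => ψ z a) = (EuclideanSpace.proj (𝕜 := ℝ) a) ∘ ψ := rfl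
  rw [jac_apply, pderiv, h2, h]
  rfl

theorem pderiv_comp {ψ : E4 → E4} (hf : DifferentiableAt ℝ f (ψ y))
    (hψ : DifferentiableAt ℝ ψ y) :
    pderiv i (fun z => f (ψ z)) y = ∑ c, jac ψ y c i * pderiv c f (ψ y) := by
  have : fderiv ℝ (fun z => f (ψ z)) y = (fderiv ℝ f (ψ y)).comp (fderiv ℝ ψ y) :=
    fderiv_comp y hf hψ
  rw [pderiv, this, ContinuousLinearMap.comp_apply, fderiv_eq_sum_pderiv]
  simp only [jac_eq_fderiv hψ]

end Calculus

/-! ### Change of basis for covariant tensors at a point -/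

section Pull

variable {ι κ ν : Type*} [Fintype ι] [Fintype κ] [Fintype ν] [DecidableEq ι] [DecidableEq κ]
  [DecidableEq ν] {A : Matrix (Fin 4) (Fin 4) ℝ}

/-- `T'` is the pull-back of the covariant tensor `T` by the linear map with matrix `A`. -/
def IsPull (A : Matrix (Fin 4) (Fin 4) ℝ) (T' T : (ι → Fin 4) → ℝ) : Prop :=
  ∀ I, T' I = ∑ K, (∏ a, A (K a) (I a)) * T K

variable {T T' S S' : (ι → Fin 4) → ℝ}

theorem IsPull.add (h : IsPull A T' T) (h2 : IsPull A S' S) :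
    IsPull A (fun I => T' I + S' I) (fun I => T I + S I) := fun I => by
  simp [h I, h2 I, mul_add, Finset.sum_add_distrib]

theorem IsPull.sub (h : IsPull A T' T) (h2 : IsPull A S' S) :
    IsPull A (fun I => T' I - S' I) (fun I => T I - S I) := fun I => by
  simp [h I, h2 I, mul_sub, Finset.sum_sub_distrib]

theorem IsPull.const_mul (c : ℝ) (h : IsPull A T' T) :
    IsPull A (fun I => c * T' I) (fun I => c * T I) := fun I => by
  simp [h I, Finset.mul_sum, mul_left_comm]

theorem isPull_one (h : IsPull 1 T' T) : T' = T := by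
  funext I
  rw [h I, Finset.sum_eq_single I]
  · simp
  · intro K _ hK
    obtain ⟨a, ha⟩ := Function.ne_iff.1 hK
    rw [Finset.prod_eq_zero (Finset.mem_univ a) (by simp [ha]), zero_mul]
  · simp

theorem IsPull.comp_equiv (e : ι ≃ κ) (h : IsPull A T' T) :
    IsPull A (fun I : κ → Fin 4 => T' (I ∘ e)) (fun I => T (I ∘ e)) := fun I => by
  refine (h _).trans ?_
  refine Fintype.sum_equiv (e.arrowCongr (Equiv.refl _)) _ _ fun K => ?_
  have h1 : (e.arrowCongr (Equiv.refl (Fin 4))) K ∘ e = K := by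
    funext x; simp [Equiv.arrowCongr]
  beta_reduce
  rw [h1]
  congr 1
  refine Fintype.prod_equiv e _ _ fun a => ?_
  simp [Equiv.arrowCongr]

/-- The slots of the two factors may be interleaved, as in R_{ik} g_{jl}; `e` records which slots of
the product belong to which factor. -/
theorem IsPull.tensor {T' T : (ι → Fin 4) → ℝ} {S' S : (κ → Fin 4) → ℝ}
    (e : ι ⊕ κ ≃ ν) (h : IsPull A T' T) (h2 : IsPull A S' S) :
    IsPull A (fun I : ν → Fin 4 => T' (fun a => I (e (Sum.inl a))) * S' (fun b => I (e (Sum.inr b))))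
      (fun I => T (fun a => I (e (Sum.inl a))) * S (fun b => I (e (Sum.inr b)))) := fun I => by
  show T' _ * S' _ = _
  rw [h, h2, Finset.sum_mul_sum, ← Fintype.sum_prod_type']
  refine Fintype.sum_equiv
    ((Equiv.sumArrowEquivProdArrow ι κ (Fin 4)).symm.trans (e.arrowCongr (Equiv.refl _)))
    _ _ fun K => ?_
  rw [← Equiv.prod_comp e, Fintype.prod_sum_type]
  simp [Equiv.arrowCongr, Equiv.sumArrowEquivProdArrow]
  ring

/-- Tracing two slots commutes with pull-back because `hh` says that the inverse metrics correspond
under `A`. The equivalence `e` singles out the two contracted slots, and `F t s I` is the index with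
`t`, `s` in them and `I` in the free slots. -/
theorem IsPull.contract {T' T : (ν → Fin 4) → ℝ} (e : Fin 2 ⊕ ι ≃ ν)
    {h h' : Matrix (Fin 4) (Fin 4) ℝ} (hh : A * h' * A.transpose = h)
    (F : Fin 4 → Fin 4 → (ι → Fin 4) → (ν → Fin 4))
    (hF : ∀ t s I, F t s I ∘ e = Sum.elim ![t, s] I) (hT : IsPull A T' T) :
    IsPull A (fun I => ∑ t, ∑ s, h' t s * T' (F t s I))
      (fun I => ∑ t, ∑ s, h t s * T (F t s I)) := fun I => by
  have hF' : ∀ t s I x, F t s I (e x) = Sum.elim ![t, s] I x := fun t s I x =>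
    congrFun (hF t s I) x
  have hre : ∀ f : (ν → Fin 4) → ℝ, ∑ K, f K = ∑ a, ∑ b, ∑ K : ι → Fin 4, f (F a b K) := by
    intro f
    have h1 : ∀ L : (Fin 2 → Fin 4) × (ι → Fin 4), 
        ((Equiv.sumArrowEquivProdArrow (Fin 2) ι (Fin 4)).symm.trans
          (e.arrowCongr (Equiv.refl _))) L = F (L.1 0) (L.1 1) L.2 := by
      intro L
      funext x
      obtain ⟨x, rfl⟩ := e.surjective x
      rw [hF']
      rcases x with x | x
      · fin_cases x <;> simp [Equiv.arrowCongr, Equiv.sumArrowEquivProdArrow]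
      · simp [Equiv.arrowCongr, Equiv.sumArrowEquivProdArrow]
    rw [← Equiv.sum_comp ((Equiv.sumArrowEquivProdArrow (Fin 2) ι (Fin 4)).symm.trans
      (e.arrowCongr (Equiv.refl _)))]
    simp only [h1]
    rw [Fintype.sum_prod_type, ← Equiv.sum_comp (finTwoArrowEquiv (Fin 4)).symm,
      Fintype.sum_prod_type]
    simp [finTwoArrowEquiv]
  have hp : ∀ t s a b (K : ι → Fin 4), ∏ x, A (F a b K x) (F t s I x)
      = A a t * A b s * ∏ x, A (K x) (I x) := by
    intro t s a b K
    rw [← Equiv.prod_comp e, Fintype.prod_sum_type]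
    simp [hF']
  have hg : ∀ a b, h a b = ∑ t, ∑ s, A a t * A b s * h' t s := by
    intro a b
    rw [← hh]
    simp only [Matrix.mul_apply, Matrix.transpose_apply, Finset.sum_mul]
    rw [Finset.sum_comm]
    exact Finset.sum_congr rfl fun t _ => Finset.sum_congr rfl fun s _ => by ring
  calc ∑ t, ∑ s, h' t s * T' (F t s I)
      = ∑ t, ∑ s, ∑ a, ∑ b, ∑ K : ι → Fin 4,
          (A a t * A b s * h' t s) * ((∏ x, A (K x) (I x)) * T (F a b K)) := by
        refine Finset.sum_congr rfl fun t _ => Finset.sum_congr rfl fun s _ => ?_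
        rw [hT, hre, Finset.mul_sum]
        refine Finset.sum_congr rfl fun a _ => ?_
        rw [Finset.mul_sum]
        refine Finset.sum_congr rfl fun b _ => ?_
        rw [Finset.mul_sum]
        refine Finset.sum_congr rfl fun K _ => ?_
        rw [hp]; ring
    _ = ∑ a, ∑ b, ∑ K : ι → Fin 4, h a b * ((∏ x, A (K x) (I x)) * T (F a b K)) := by
        simp only [hg, Finset.sum_mul]
        rw [Finset.sum_congr rfl fun t _ => Finset.sum_comm]
        rw [Finset.sum_comm]
        refine Finset.sum_congr rfl fun a _ => ?_
        rw [Finset.sum_congr rfl fun t _ => Finset.sum_comm]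
        rw [Finset.sum_comm]
        refine Finset.sum_congr rfl fun b _ => ?_
        rw [Finset.sum_congr rfl fun t _ => Finset.sum_comm]
        rw [Finset.sum_comm]
    _ = ∑ K : ι → Fin 4, (∏ x, A (K x) (I x)) * ∑ t, ∑ s, h t s * T (F t s K) := by
        simp only [Finset.mul_sum]
        rw [Finset.sum_congr rfl fun t _ => Finset.sum_comm, Finset.sum_comm]
        exact Finset.sum_congr rfl fun t _ => Finset.sum_congr rfl fun s _ =>
          Finset.sum_congr rfl fun a _ => by ring

/-- The contraction `T_I S^I` of two covariant tensors, with inverse metric `h`. -/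
def pairing (h : Matrix (Fin 4) (Fin 4) ℝ) (T S : (ι → Fin 4) → ℝ) : ℝ :=
  ∑ I, T I * ∑ J, (∏ a, h (I a) (J a)) * S J

/-- The matrices `A` attached to each slot are absorbed by `A h' Aᵀ = h`. Norms and the cubic
invariant become coordinate independent through this. -/
theorem pairing_eq_of_isPull {h h' : Matrix (Fin 4) (Fin 4) ℝ} (hh : A * h' * A.transpose = h)
    (hT : IsPull A T' T) (hS : IsPull A S' S) : pairing h' T' S' = pairing h T S := by
  have hg : ∀ a b, h a b = ∑ t, ∑ s, A a t * h' t s * A b s := by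
    intro a b
    rw [← hh]
    simp only [Matrix.mul_apply, Matrix.transpose_apply, Finset.sum_mul]
    rw [Finset.sum_comm]
  have hprod : ∀ K L : ι → Fin 4, ∏ x, h (K x) (L x)
      = ∑ I : ι → Fin 4, ∑ J : ι → Fin 4,
        ((∏ x, A (K x) (I x)) * (∏ x, h' (I x) (J x)) * ∏ x, A (L x) (J x)) := by
    intro K L
    simp only [hg, Finset.prod_univ_sum, Fintype.piFinset_univ, ← Finset.prod_mul_distrib]
  have hswap : ∀ f : (ι → Fin 4) → (ι → Fin 4) → (ι → Fin 4) → (ι → Fin 4) → ℝ,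
      ∑ I, ∑ J, ∑ L, ∑ K, f I J L K = ∑ K, ∑ L, ∑ I, ∑ J, f I J L K := by
    intro f
    rw [Finset.sum_congr rfl fun I _ => Finset.sum_congr rfl fun J _ => Finset.sum_comm,
      Finset.sum_congr rfl fun I _ => Finset.sum_comm, Finset.sum_comm]
    refine Finset.sum_congr rfl fun K _ => ?_
    rw [Finset.sum_congr rfl fun I _ => Finset.sum_comm, Finset.sum_comm]
  simp only [pairing, hT _, hS _, hprod, Finset.sum_mul, Finset.mul_sum]
  rw [hswap]
  refine Finset.sum_congr rfl fun K _ => Finset.sum_congr rfl fun L _ =>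
    Finset.sum_congr rfl fun I _ => Finset.sum_congr rfl fun J _ => ?_
  ring

end Pull

/-! ### Smooth metrics on open subsets of the coordinate space -/

/-- `G` is a smooth Riemannian metric on the open set `U`. -/
structure IsMetricOn (G : CoordMetric) (U : Set E4) : Prop where
  isOpen : IsOpen U
  smooth : ∀ i j, ContDiffOn ℝ ∞ (fun y => G y i j) U
  posDef : ∀ y ∈ U, (G y).PosDef

/-- All components of the tensor field `T` are smooth on `U`. -/
def SmoothTensor {k : ℕ} (T : CoordTensor k) (U : Set E4) : Prop :=
  ∀ I, ContDiffOn ℝ ∞ (fun y => T y I) U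

theorem contDiffOn_det {B : E4 → Matrix (Fin 4) (Fin 4) ℝ} {U : Set E4}
    (h : ∀ i j, ContDiffOn ℝ ∞ (fun y => B y i j) U) :
    ContDiffOn ℝ ∞ (fun y => (B y).det) U := by
  simp only [Matrix.det_apply']
  exact ContDiffOn.sum fun σ _ => contDiffOn_const.mul (contDiffOn_prod fun i _ => h _ _)

namespace IsMetricOn

variable {G : CoordMetric} {U : Set E4} {y : E4}

theorem symm (hG : IsMetricOn G U) (hy : y ∈ U) (i j : Fin 4) : G y i j = G y j i := by
  simpa using (hG.posDef y hy).isHermitian.apply j i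

theorem det_pos (hG : IsMetricOn G U) (hy : y ∈ U) : 0 < (G y).det := (hG.posDef y hy).det_pos

theorem isUnit_det (hG : IsMetricOn G U) (hy : y ∈ U) : IsUnit (G y).det :=
  (hG.det_pos hy).ne'.isUnit

theorem inv_symm (hG : IsMetricOn G U) (hy : y ∈ U) (i j : Fin 4) :
    invMetric G y i j = invMetric G y j i := by
  have h := (hG.posDef y hy).isHermitian.inv
  simpa [invMetric] using h.apply j i

theorem sum_inv_mul (hG : IsMetricOn G U) (hy : y ∈ U) (i j : Fin 4) :
    ∑ l, invMetric G y i l * G y l j = if i = j then 1 else 0 := by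
  have := congrFun (congrFun (Matrix.nonsing_inv_mul _ (hG.isUnit_det hy)) i) j
  simpa [invMetric, Matrix.mul_apply, Matrix.one_apply] using this

theorem sum_mul_inv (hG : IsMetricOn G U) (hy : y ∈ U) (i j : Fin 4) :
    ∑ l, G y i l * invMetric G y l j = if i = j then 1 else 0 := by
  have := congrFun (congrFun (Matrix.mul_nonsing_inv _ (hG.isUnit_det hy)) i) j
  simpa [invMetric, Matrix.mul_apply, Matrix.one_apply] using this

theorem smooth_inv (hG : IsMetricOn G U) (i j : Fin 4) :
    ContDiffOn ℝ ∞ (fun y => invMetric G y i j) U := by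
  -- Cramer's rule: the inverse is rational in the entries, and the determinant has no zero on `U`.
  have h1 : ContDiffOn ℝ ∞ (fun y => (G y).det⁻¹ * (G y).adjugate i j) U := by
    refine ((contDiffOn_det hG.smooth).inv fun y hy => (hG.det_pos hy).ne').mul ?_
    simp only [Matrix.adjugate_apply]
    refine contDiffOn_det fun a b => ?_
    by_cases ha : a = j
    · subst ha; simpa using contDiffOn_const
    · simpa [Matrix.updateRow_ne ha] using hG.smooth a b
  refine h1.congr fun y hy => ?_
  simp [invMetric, Matrix.inv_def]

theorem smooth_christoffel (hG : IsMetricOn G U) (k i j : Fin 4) :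
    ContDiffOn ℝ ∞ (fun y => christoffel G y k i j) U := by
  unfold christoffel
  refine contDiffOn_const.mul (ContDiffOn.sum fun l _ => (hG.smooth_inv k l).mul ?_)
  exact ((contDiffOn_pderiv hG.isOpen (hG.smooth j l)).add
    (contDiffOn_pderiv hG.isOpen (hG.smooth i l))).sub
    (contDiffOn_pderiv hG.isOpen (hG.smooth i j))

theorem smooth_curvature (hG : IsMetricOn G U) (m j k l : Fin 4) :
    ContDiffOn ℝ ∞ (fun y => curvature G y m j k l) U := by
  unfold curvature
  have hc := hG.smooth_christoffel
  refine ((contDiffOn_pderiv hG.isOpen (hc _ _ _)).sub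
    (contDiffOn_pderiv hG.isOpen (hc _ _ _))).add (ContDiffOn.sum fun p _ => ?_)
  exact ((hc _ _ _).mul (hc _ _ _)).sub ((hc _ _ _).mul (hc _ _ _))

theorem smooth_riemann (hG : IsMetricOn G U) (i j k l : Fin 4) :
    ContDiffOn ℝ ∞ (fun y => riemann G y i j k l) U :=
  ContDiffOn.sum fun _ _ => (hG.smooth _ _).mul (hG.smooth_curvature _ _ _ _)

theorem smooth_ricci (hG : IsMetricOn G U) (i k : Fin 4) :
    ContDiffOn ℝ ∞ (fun y => ricci G y i k) U :=
  ContDiffOn.sum fun _ _ => ContDiffOn.sum fun _ _ =>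
    (hG.smooth_inv _ _).mul (hG.smooth_riemann _ _ _ _)

theorem smooth_scalarCurv (hG : IsMetricOn G U) :
    ContDiffOn ℝ ∞ (fun y => scalarCurv G y) U :=
  ContDiffOn.sum fun _ _ => ContDiffOn.sum fun _ _ =>
    (hG.smooth_inv _ _).mul (hG.smooth_ricci _ _)

theorem smooth_weyl (hG : IsMetricOn G U) (i j k l : Fin 4) :
    ContDiffOn ℝ ∞ (fun y => weyl G y i j k l) U := by
  unfold weyl
  have hr := hG.smooth_ricci
  have hg := hG.smooth
  refine ((hG.smooth_riemann _ _ _ _).sub (contDiffOn_const.mul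
    (((((hr _ _).mul (hg _ _)).sub ((hr _ _).mul (hg _ _))).add ((hr _ _).mul (hg _ _))).sub
      ((hr _ _).mul (hg _ _))))).add ((hG.smooth_scalarCurv.div_const 6).mul
    (((hg _ _).mul (hg _ _)).sub ((hg _ _).mul (hg _ _))))

theorem smooth_weylTensor (hG : IsMetricOn G U) : SmoothTensor (weylTensor G) U :=
  fun _ => hG.smooth_weyl _ _ _ _

theorem smooth_covDeriv (hG : IsMetricOn G U) {k : ℕ} {T : CoordTensor k}
    (hT : SmoothTensor T U) : SmoothTensor (covDeriv G T) U := fun I => by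
  unfold covDeriv
  exact (contDiffOn_pderiv hG.isOpen (hT _)).sub (ContDiffOn.sum fun a _ =>
    ContDiffOn.sum fun m _ => (hG.smooth_christoffel _ _ _).mul (hT _))

theorem smooth_divWeyl (hG : IsMetricOn G U) : SmoothTensor (divWeyl G) U := fun _ =>
  ContDiffOn.sum fun _ _ => ContDiffOn.sum fun _ _ =>
    (hG.smooth_inv _ _).mul (hG.smooth_covDeriv hG.smooth_weylTensor _)

theorem smooth_pairing (hG : IsMetricOn G U) {k : ℕ} {T S : CoordTensor k}
    (hT : SmoothTensor T U) (hS : SmoothTensor S U) :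
    ContDiffOn ℝ ∞ (fun y => pairing (G y)⁻¹ (T y) (S y)) U :=
  ContDiffOn.sum fun I _ => (hT I).mul (ContDiffOn.sum fun J _ =>
    (contDiffOn_prod fun a _ => hG.smooth_inv (I a) (J a)).mul (hS J))

theorem christoffel_symm (hG : IsMetricOn G U) (hy : y ∈ U) (k i j : Fin 4) :
    christoffel G y k i j = christoffel G y k j i := by
  unfold christoffel
  congr 1
  refine Finset.sum_congr rfl fun l _ => ?_
  rw [pderiv_congr_on hG.isOpen hy (fun z hz => hG.symm hz i j)]
  ring

/-- The Christoffel symbols of the first kind. -/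
theorem sum_mul_christoffel (hG : IsMetricOn G U) (hy : y ∈ U) (m i j : Fin 4) :
    ∑ k, G y m k * christoffel G y k i j =
      (1 / 2) * (pderiv i (fun z => G z j m) y + pderiv j (fun z => G z i m) y
        - pderiv m (fun z => G z i j) y) := by
  have h : ∑ k, G y m k * christoffel G y k i j = (1 / 2) * ∑ l, (∑ k, G y m k * invMetric G y k l) *
      (pderiv i (fun z => G z j l) y + pderiv j (fun z => G z i l) y
        - pderiv l (fun z => G z i j) y) := by
    simp only [christoffel, Finset.mul_sum, Finset.sum_mul]
    rw [Finset.sum_comm]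
    exact Finset.sum_congr rfl fun _ _ => Finset.sum_congr rfl fun _ _ => by ring
  rw [h]
  simp [hG.sum_mul_inv hy]

/-- The Levi-Civita connection is metric. -/
theorem pderiv_metric (hG : IsMetricOn G U) (hy : y ∈ U) (k i j : Fin 4) :
    pderiv k (fun z => G z i j) y =
      ∑ m, G y i m * christoffel G y m k j + ∑ m, G y j m * christoffel G y m k i := by
  rw [hG.sum_mul_christoffel hy, hG.sum_mul_christoffel hy,
    pderiv_congr_on hG.isOpen hy (fun z hz => hG.symm hz j i)]
  ring

end IsMetricOn

/-! ### Changes of coordinates -/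

/-- `G'` is the pull-back of the metric `G` by `ψ`. -/
structure IsCoordChange (ψ : E4 → E4) (G' : CoordMetric) (V : Set E4) (G : CoordMetric)
    (U : Set E4) : Prop where
  metric' : IsMetricOn G' V
  metric : IsMetricOn G U
  mapsTo : MapsTo ψ V U
  smooth : ContDiffOn ℝ ∞ ψ V
  eq : ∀ y ∈ V, G' y = (jac ψ y).transpose * G (ψ y) * jac ψ y

/-- `T'` is the pull-back of the tensor field `T` by `ψ`, on `V`. -/
def IsNatural (ψ : E4 → E4) (V : Set E4) {k : ℕ} (T' T : CoordTensor k) : Prop :=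
  ∀ y ∈ V, IsPull (jac ψ y) (T' y) (T (ψ y))

namespace IsCoordChange

variable {ψ : E4 → E4} {G' G : CoordMetric} {V U : Set E4} {y : E4}

theorem isUnit_jac (h : IsCoordChange ψ G' V G U) (hy : y ∈ V) : IsUnit (jac ψ y).det := by
  have h1 := h.metric'.det_pos hy
  rw [h.eq y hy, Matrix.det_mul] at h1
  exact (right_ne_zero_of_mul h1.ne').isUnit

/-- This is the relation `A h' Aᵀ = h` under which contractions commute with pull-back. -/
theorem inv_eq (h : IsCoordChange ψ G' V G U) (hy : y ∈ V) :
    jac ψ y * (G' y)⁻¹ * (jac ψ y).transpose = (G (ψ y))⁻¹ := by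
  have hJ := h.isUnit_jac hy
  have hJ' : IsUnit (jac ψ y).transpose.det := by rwa [Matrix.det_transpose]
  rw [h.eq y hy, Matrix.mul_inv_rev, Matrix.mul_inv_rev]
  rw [← Matrix.mul_assoc, ← Matrix.mul_assoc, Matrix.mul_nonsing_inv _ hJ, Matrix.one_mul,
    Matrix.mul_assoc, Matrix.nonsing_inv_mul _ hJ', Matrix.mul_one]

theorem diffAt (h : IsCoordChange ψ G' V G U) (hy : y ∈ V) : DifferentiableAt ℝ ψ y :=
  (h.smooth.contDiffAt (h.metric'.isOpen.mem_nhds hy)).differentiableAt (by simp)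

theorem smooth_coord (h : IsCoordChange ψ G' V G U) (a : Fin 4) :
    ContDiffOn ℝ ∞ (fun y => ψ y a) V :=
  (EuclideanSpace.proj (𝕜 := ℝ) a).contDiff.comp_contDiffOn h.smooth

theorem smooth_jac (h : IsCoordChange ψ G' V G U) (a i : Fin 4) :
    ContDiffOn ℝ ∞ (fun y => jac ψ y a i) V :=
  contDiffOn_pderiv h.metric'.isOpen (h.smooth_coord a)

theorem smooth_comp (h : IsCoordChange ψ G' V G U) {f : E4 → ℝ} (hf : ContDiffOn ℝ ∞ f U) :
    ContDiffOn ℝ ∞ (fun y => f (ψ y)) V :=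
  hf.comp h.smooth h.mapsTo

theorem pderiv_jac_comm (h : IsCoordChange ψ G' V G U) (hy : y ∈ V) (a i j : Fin 4) :
    pderiv i (fun z => jac ψ z a j) y = pderiv j (fun z => jac ψ z a i) y :=
  pderiv_comm h.metric'.isOpen (h.smooth_coord a) hy

theorem eq_apply (h : IsCoordChange ψ G' V G U) (hy : y ∈ V) (i j : Fin 4) :
    G' y i j = ∑ a, ∑ b, jac ψ y a i * G (ψ y) a b * jac ψ y b j := by
  rw [h.eq y hy]
  simp only [Matrix.mul_apply, Matrix.transpose_apply, Finset.sum_mul]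
  rw [Finset.sum_comm]

theorem pderiv_comp (h : IsCoordChange ψ G' V G U) (hy : y ∈ V) {f : E4 → ℝ}
    (hf : ContDiffOn ℝ ∞ f U) (i : Fin 4) :
    pderiv i (fun z => f (ψ z)) y = ∑ c, jac ψ y c i * pderiv c f (ψ y) :=
  WeakHarmonicWeyl.pderiv_comp (hf.diffAt h.metric.isOpen (h.mapsTo hy)) (h.diffAt hy)

theorem pderiv_metric' (h : IsCoordChange ψ G' V G U) (hy : y ∈ V) (k i j : Fin 4) :
    pderiv k (fun z => G' z i j) y =
      (∑ a, ∑ b, pderiv k (fun z => jac ψ z a i) y * G (ψ y) a b * jac ψ y b j)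
      + (∑ a, ∑ b, pderiv k (fun z => jac ψ z a j) y * G (ψ y) a b * jac ψ y b i)
      + ∑ a, ∑ b, ∑ c, jac ψ y a i * jac ψ y b j * jac ψ y c k
          * pderiv c (fun z => G z a b) (ψ y) := by
  have hV := h.metric'.isOpen
  rw [pderiv_congr_on hV hy (fun z hz => h.eq_apply hz i j)]
  have hJ := fun a i => (h.smooth_jac a i).diffAt hV hy
  have hg := fun a b => (h.smooth_comp (h.metric.smooth a b)).diffAt hV hy
  rw [pderiv_sum fun a _ => DifferentiableAt.fun_sum fun b _ => ((hJ a i).fun_mul (hg a b)).fun_mul (hJ b j)]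
  have h2 : ∑ a, ∑ b, pderiv k (fun z => jac ψ z a j) y * G (ψ y) a b * jac ψ y b i
      = ∑ a, ∑ b, jac ψ y a i * G (ψ y) a b * pderiv k (fun z => jac ψ z b j) y := by
    rw [Finset.sum_comm]
    refine Finset.sum_congr rfl fun a _ => Finset.sum_congr rfl fun b _ => ?_
    rw [h.metric.symm (h.mapsTo hy) b a]; ring
  rw [h2, ← Finset.sum_add_distrib, ← Finset.sum_add_distrib]
  refine Finset.sum_congr rfl fun a _ => ?_
  rw [pderiv_sum fun b _ => ((hJ a i).fun_mul (hg a b)).fun_mul (hJ b j), ← Finset.sum_add_distrib,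
    ← Finset.sum_add_distrib]
  refine Finset.sum_congr rfl fun b _ => ?_
  rw [pderiv_mul ((hJ a i).fun_mul (hg a b)) (hJ b j), pderiv_mul (hJ a i) (hg a b),
    h.pderiv_comp hy (h.metric.smooth a b)]
  have h3 : ∑ c, jac ψ y a i * jac ψ y b j * jac ψ y c k * pderiv c (fun z => G z a b) (ψ y)
      = jac ψ y a i * jac ψ y b j * ∑ c, jac ψ y c k * pderiv c (fun z => G z a b) (ψ y) := by
    rw [Finset.mul_sum]
    exact Finset.sum_congr rfl fun _ _ => by ring
  rw [h3]
  ring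

/-- The transformation law of the Christoffel symbols. -/
theorem christoffel_eq (h : IsCoordChange ψ G' V G U) (hy : y ∈ V) (a i j : Fin 4) :
    ∑ k, jac ψ y a k * christoffel G' y k i j =
      pderiv i (fun z => jac ψ z a j) y
        + ∑ b, ∑ c, jac ψ y b i * jac ψ y c j * christoffel G (ψ y) a b c := by
  set J := jac ψ y with hJ
  set g := G (ψ y) with hg
  have hy' := h.mapsTo hy
  let lhs : Fin 4 → ℝ := fun a => ∑ k, J a k * christoffel G' y k i j
  let rhs : Fin 4 → ℝ := fun a => pderiv i (fun z => jac ψ z a j) y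
        + ∑ b, ∑ c, J b i * J c j * christoffel G (ψ y) a b c
  -- Both sides are lowered with the invertible matrix Jᵀg, so that only Christoffel symbols of the
  -- first kind, explicit in ∂g, need to be compared.
  have key : (J.transpose * g).mulVec lhs = (J.transpose * g).mulVec rhs := by
    funext l
    have h1 : (J.transpose * g).mulVec lhs l = ∑ k, G' y l k * christoffel G' y k i j := by
      have : lhs = J.mulVec (fun k => christoffel G' y k i j) := rfl
      rw [this, Matrix.mulVec_mulVec, hg, hJ, ← h.eq y hy]
      rfl
    have h2 : (J.transpose * g).mulVec rhs l
        = (∑ b, ∑ a, pderiv i (fun z => jac ψ z b j) y * g b a * J a l)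
          + ∑ a, ∑ b, ∑ c, J a l * J b i * J c j * (∑ d, g a d * christoffel G (ψ y) d b c) := by
      have h3 : ∀ a, g.mulVec rhs a = (∑ b, g a b * pderiv i (fun z => jac ψ z b j) y)
          + ∑ b, ∑ c, J b i * J c j * (∑ d, g a d * christoffel G (ψ y) d b c) := by
        intro a
        simp only [Matrix.mulVec, dotProduct, rhs, mul_add, Finset.sum_add_distrib, Finset.mul_sum]
        congr 1
        rw [Finset.sum_comm]
        refine Finset.sum_congr rfl fun b _ => ?_
        rw [Finset.sum_comm]
        exact Finset.sum_congr rfl fun c _ => Finset.sum_congr rfl fun d _ => by ring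
      rw [← Matrix.mulVec_mulVec]
      show ∑ a, J a l * g.mulVec rhs a = _
      simp only [h3, mul_add, Finset.sum_add_distrib]
      congr 1
      · rw [Finset.sum_comm]
        refine Finset.sum_congr rfl fun a _ => ?_
        rw [Finset.mul_sum]
        refine Finset.sum_congr rfl fun b _ => ?_
        rw [hg, h.metric.symm hy' a b]; ring
      · simp only [Finset.mul_sum]
        exact Finset.sum_congr rfl fun a _ => Finset.sum_congr rfl fun b _ =>
          Finset.sum_congr rfl fun c _ => Finset.sum_congr rfl fun d _ => by ring
    rw [h1, h2, h.metric'.sum_mul_christoffel hy, h.pderiv_metric' hy, h.pderiv_metric' hy,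
      h.pderiv_metric' hy]
    simp only [hg, h.metric.sum_mul_christoffel hy']
    simp only [h.pderiv_jac_comm hy _ j i, h.pderiv_jac_comm hy _ l i, h.pderiv_jac_comm hy _ l j]
    have h4 : ∑ a, ∑ b, ∑ c, J a l * J b i * J c j * (1 / 2 *
          (pderiv b (fun z => G z c a) (ψ y) + pderiv c (fun z => G z b a) (ψ y)
            - pderiv a (fun z => G z b c) (ψ y)))
        = 1 / 2 * ((∑ a, ∑ b, ∑ c, J a j * J b l * J c i * pderiv c (fun z => G z a b) (ψ y))
          + (∑ a, ∑ b, ∑ c, J a i * J b l * J c j * pderiv c (fun z => G z a b) (ψ y))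
          - ∑ a, ∑ b, ∑ c, J a i * J b j * J c l * pderiv c (fun z => G z a b) (ψ y)) := by
      simp only [Fin.sum_univ_four]
      ring
    rw [h4]
    ring
  have hu : IsUnit (J.transpose * g) := by
    rw [Matrix.isUnit_iff_isUnit_det, Matrix.det_mul, Matrix.det_transpose]
    exact (h.isUnit_jac hy).mul (h.metric.isUnit_det hy')
  exact congrFun (Matrix.mulVec_injective_of_isUnit hu key) a

end IsCoordChange

/-! ### Sums over multi-indices. -/

section Sums

variable {R : Type*} [AddCommMonoid R]

theorem sum_fin_cons {k : ℕ} (f : (Fin (k + 1) → Fin 4) → R) :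
    ∑ K, f K = ∑ a, ∑ K : Fin k → Fin 4, f (Fin.cons a K) := by
  rw [← Equiv.sum_comp (Fin.consEquiv fun _ => Fin 4), Fintype.sum_prod_type]
  rfl

theorem sum_fin_snoc {k : ℕ} (f : (Fin (k + 1) → Fin 4) → R) :
    ∑ K, f K = ∑ K : Fin k → Fin 4, ∑ c, f (Fin.snoc (α := fun _ => Fin 4) K c) := by
  rw [← Equiv.sum_comp (Fin.snocEquiv fun _ => Fin 4), Fintype.sum_prod_type, Finset.sum_comm]
  rfl

theorem sum_fin_zero (f : (Fin 0 → Fin 4) → R) : ∑ K, f K = f ![] := by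
  rw [Fintype.sum_unique]
  congr 1

theorem sum_fin_one (f : (Fin 1 → Fin 4) → R) : ∑ K, f K = ∑ a, f ![a] := by
  simp only [sum_fin_cons, sum_fin_zero]; rfl

theorem sum_fin_two (f : (Fin 2 → Fin 4) → R) : ∑ K, f K = ∑ a, ∑ b, f ![a, b] := by
  rw [sum_fin_cons]; simp only [sum_fin_one]; rfl

theorem sum_fin_three (f : (Fin 3 → Fin 4) → R) :
    ∑ K, f K = ∑ a, ∑ b, ∑ c, f ![a, b, c] := by
  rw [sum_fin_cons]; simp only [sum_fin_two]; rfl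

theorem sum_fin_four (f : (Fin 4 → Fin 4) → R) :
    ∑ K, f K = ∑ a, ∑ b, ∑ c, ∑ d, f ![a, b, c, d] := by
  rw [sum_fin_cons]; simp only [sum_fin_three]; rfl

end Sums

/-! ### Naturality of the covariant derivative and of the curvature. -/

theorem covDeriv_one (G : CoordMetric) (T : CoordTensor 1) (y : E4) (j l : Fin 4) :
    covDeriv G T y ![j, l] = pderiv l (fun z => T z ![j]) y
      - ∑ m, christoffel G y m l j * T y ![m] := by
  have h1 : (fun a : Fin 1 => (![j, l] : Fin 2 → Fin 4) a.castSucc) = ![j] := by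
    funext a; fin_cases a; rfl
  have h2 : ∀ m : Fin 4, Function.update ![j] (0 : Fin 1) m = ![m] := by
    intro m; funext a; fin_cases a; rfl
  simp only [covDeriv, h1, Finset.univ_unique, Finset.sum_singleton, Fin.default_eq_zero, h2]
  rfl

theorem covDeriv_two (G : CoordMetric) (T : CoordTensor 2) (y : E4) (i j l : Fin 4) :
    covDeriv G T y ![i, j, l] = pderiv l (fun z => T z ![i, j]) y
      - (∑ m, christoffel G y m l i * T y ![m, j] + ∑ m, christoffel G y m l j * T y ![i, m]) := by
  have h1 : (fun a : Fin 2 => (![i, j, l] : Fin 3 → Fin 4) a.castSucc) = ![i, j] := by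
    funext a; fin_cases a <;> rfl
  have h2 : ∀ m : Fin 4, Function.update ![i, j] (0 : Fin 2) m = ![m, j] := by
    intro m; funext a; fin_cases a <;> rfl
  have h3 : ∀ m : Fin 4, Function.update ![i, j] (1 : Fin 2) m = ![i, m] := by
    intro m; funext a; fin_cases a <;> rfl
  simp only [covDeriv, h1, Fin.sum_univ_two, h2, h3]
  rfl

/-- The covariant derivative is compatible with changes of coordinates. -/
theorem IsCoordChange.natural_covDeriv {ψ : E4 → E4} {G' G : CoordMetric} {V U : Set E4}
    (h : IsCoordChange ψ G' V G U) {k : ℕ} {T' T : CoordTensor k} (hT : IsNatural ψ V T' T)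
    (hS : SmoothTensor T U) : IsNatural ψ V (covDeriv G' T') (covDeriv G T) := by
  intro y hy J
  have hV := h.metric'.isOpen
  set I : Fin k → Fin 4 := fun a => J a.castSucc with hI
  set l : Fin 4 := J (Fin.last k) with hl
  let Er : Fin k → (Fin k → Fin 4) → ℝ := fun a K =>
    ∏ b ∈ Finset.univ.erase a, jac ψ y (K b) (I b)
  have hEr : ∀ a K, ∏ b, jac ψ y (K b) (I b) = jac ψ y (K a) (I a) * Er a K := fun a K =>
    (Finset.mul_prod_erase _ _ (Finset.mem_univ a)).symm
  -- The derivative also falls on the Jacobian factors; the inhomogeneous term in the transformation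
  -- law of the Christoffel symbols, appearing in `hu`, cancels these contributions.
  have hd : pderiv l (fun z => T' z I) y = ∑ K : Fin k → Fin 4,
      ((∑ a, Er a K * pderiv l (fun z => jac ψ z (K a) (I a)) y) * T (ψ y) K
        + (∏ b, jac ψ y (K b) (I b)) * ∑ c, jac ψ y c l * pderiv c (fun z => T z K) (ψ y)) := by
    rw [pderiv_congr_on hV hy (fun z hz => hT z hz I)]
    have h1 : ∀ K : Fin k → Fin 4,
        DifferentiableAt ℝ (fun z => ∏ b, jac ψ z (K b) (I b)) y := fun K =>
      (contDiffOn_prod fun b _ => h.smooth_jac (K b) (I b)).diffAt hV hy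
    have h2 : ∀ K : Fin k → Fin 4, DifferentiableAt ℝ (fun z => T (ψ z) K) y := fun K =>
      (h.smooth_comp (hS K)).diffAt hV hy
    rw [pderiv_sum fun K _ => (h1 K).fun_mul (h2 K)]
    refine Finset.sum_congr rfl fun K _ => ?_
    rw [pderiv_mul (h1 K) (h2 K), h.pderiv_comp hy (hS K),
      pderiv_prod fun b _ => (h.smooth_jac (K b) (I b)).diffAt hV hy]
  have hu : ∀ a, ∑ m, christoffel G' y m l (I a) * T' y (Function.update I a m)
      = ∑ K : Fin k → Fin 4, Er a K * (pderiv l (fun z => jac ψ z (K a) (I a)) y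
        + ∑ b, ∑ c, jac ψ y b l * jac ψ y c (I a) * christoffel G (ψ y) (K a) b c) * T (ψ y) K := by
    intro a
    have h1 : ∀ m, T' y (Function.update I a m)
        = ∑ K : Fin k → Fin 4, Er a K * jac ψ y (K a) m * T (ψ y) K := by
      intro m
      rw [hT y hy]
      refine Finset.sum_congr rfl fun K _ => ?_
      congr 1
      rw [← Finset.mul_prod_erase _ _ (Finset.mem_univ a), mul_comm]
      congr 1
      · refine Finset.prod_congr rfl fun b hb => ?_
        rw [Function.update_of_ne (Finset.ne_of_mem_erase hb)]
      · rw [Function.update_self]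
    simp only [h1, Finset.mul_sum]
    rw [Finset.sum_comm]
    refine Finset.sum_congr rfl fun K _ => ?_
    rw [← h.christoffel_eq hy, Finset.mul_sum, Finset.sum_mul]
    exact Finset.sum_congr rfl fun m _ => by ring
  have hc : ∀ a c, ∑ K : Fin k → Fin 4, (∏ b, jac ψ y (K b) (I b)) *
        ∑ m, christoffel G (ψ y) m c (K a) * T (ψ y) (Function.update K a m)
      = ∑ K : Fin k → Fin 4, Er a K *
        (∑ d, jac ψ y d (I a) * christoffel G (ψ y) (K a) c d) * T (ψ y) K := by
    intro a c
    simp only [hEr a, Finset.mul_sum, Finset.sum_mul]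
    rw [← Fintype.sum_prod_type', ← Fintype.sum_prod_type']
    -- The involution that exchanges the summed index `m` with the entry of `K` in slot `a`.
    refine Finset.sum_bij' (fun p _ => (Function.update p.1 a p.2, p.1 a))
      (fun p _ => (Function.update p.1 a p.2, p.1 a)) (by simp) (by simp)
      (by rintro ⟨K, m⟩ _; simp) (by rintro ⟨K, m⟩ _; simp) ?_
    rintro ⟨K, m⟩ _
    have : Er a (Function.update K a m) = Er a K := Finset.prod_congr rfl fun b hb => by
      rw [Function.update_of_ne (Finset.ne_of_mem_erase hb)]
    simp only [this, Function.update_self]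
    ring
  have hlhs : covDeriv G' T' y J = (∑ K : Fin k → Fin 4,
        (∏ b, jac ψ y (K b) (I b)) * ∑ c, jac ψ y c l * pderiv c (fun z => T z K) (ψ y))
      - ∑ a, ∑ c, jac ψ y c l * ∑ K : Fin k → Fin 4, Er a K *
        (∑ d, jac ψ y d (I a) * christoffel G (ψ y) (K a) c d) * T (ψ y) K := by
    have h0 : covDeriv G' T' y J = pderiv l (fun z => T' z I) y
      - ∑ a : Fin k, ∑ m, christoffel G' y m l (I a) * T' y (Function.update I a m) := rfl
    rw [h0, hd, Finset.sum_add_distrib]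
    simp only [hu]
    have h3 : ∑ K : Fin k → Fin 4, (∑ a, Er a K * pderiv l (fun z => jac ψ z (K a) (I a)) y)
        * T (ψ y) K = ∑ a, ∑ K : Fin k → Fin 4,
          Er a K * pderiv l (fun z => jac ψ z (K a) (I a)) y * T (ψ y) K := by
      simp only [Finset.sum_mul]
      rw [Finset.sum_comm]
    have h4 : ∀ a, ∑ c, jac ψ y c l * ∑ K : Fin k → Fin 4, Er a K *
        (∑ d, jac ψ y d (I a) * christoffel G (ψ y) (K a) c d) * T (ψ y) K
        = ∑ K : Fin k → Fin 4, Er a K * (∑ b, ∑ c, jac ψ y b l * jac ψ y c (I a)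
          * christoffel G (ψ y) (K a) b c) * T (ψ y) K := by
      intro a
      simp only [Finset.mul_sum, Finset.sum_mul]
      rw [Finset.sum_comm]
      exact Finset.sum_congr rfl fun K _ => Finset.sum_congr rfl fun b _ =>
        Finset.sum_congr rfl fun c _ => by ring
    simp only [h4, mul_add, add_mul, Finset.sum_add_distrib, h3]
    ring
  rw [hlhs, sum_fin_snoc]
  have hr : ∀ (K : Fin k → Fin 4) (c : Fin 4),
      (∏ a, jac ψ y ((Fin.snoc (α := fun _ => Fin 4) K c : Fin (k + 1) → Fin 4) a) (J a)) *
        covDeriv G T (ψ y) (Fin.snoc (α := fun _ => Fin 4) K c)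
      = (∏ b, jac ψ y (K b) (I b)) * (jac ψ y c l * pderiv c (fun z => T z K) (ψ y))
        - ∑ a, jac ψ y c l * ((∏ b, jac ψ y (K b) (I b)) *
          ∑ m, christoffel G (ψ y) m c (K a) * T (ψ y) (Function.update K a m)) := by
    intro K c
    rw [Fin.prod_univ_castSucc]
    simp only [covDeriv, Fin.snoc_castSucc, Fin.snoc_last]
    rw [mul_sub, ← Finset.mul_sum, ← Finset.mul_sum]
    ring
  simp only [hr, Finset.sum_sub_distrib]
  congr 1
  · simp only [Finset.mul_sum]
  · simp only [← hc]
    simp only [Finset.mul_sum (ι := Fin k → Fin 4)]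
    symm
    rw [Finset.sum_congr rfl fun K _ => Finset.sum_comm, Finset.sum_comm]
    exact Finset.sum_congr rfl fun a _ => Finset.sum_comm

/-- The Ricci identity for covectors. -/
theorem IsMetricOn.ricci_identity {G : CoordMetric} {U : Set E4} (hG : IsMetricOn G U)
    {η : CoordTensor 1} (hη : SmoothTensor η U) {y : E4} (hy : y ∈ U) (j k l : Fin 4) :
    covDeriv G (covDeriv G η) y ![j, l, k] - covDeriv G (covDeriv G η) y ![j, k, l]
      = - ∑ m, curvature G y m j k l * η y ![m] := by
  have hU := hG.isOpen
  have hc := fun a b c => (hG.smooth_christoffel a b c).diffAt hU hy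
  have hw := fun a => (hη ![a]).diffAt hU hy
  have hpw := fun a i => (contDiffOn_pderiv (i := i) hU (hη ![a])).diffAt hU hy
  have hd : ∀ k l, pderiv k (fun z => covDeriv G η z ![j, l]) y
      = pderiv k (pderiv l (fun z => η z ![j])) y
        - ((∑ m, pderiv k (fun z => christoffel G z m l j) y * η y ![m])
          + ∑ m, christoffel G y m l j * pderiv k (fun z => η z ![m]) y) := by
    intro k l
    simp only [covDeriv_one]
    rw [pderiv_sub (hpw _ _) (DifferentiableAt.fun_sum fun m _ => (hc _ _ _).fun_mul (hw _)),
      pderiv_sum fun m _ => (hc _ _ _).fun_mul (hw _), ← Finset.sum_add_distrib]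
    congr 1
    exact Finset.sum_congr rfl fun m _ => pderiv_mul (hc _ _ _) (hw _)
  have hcurv : ∑ m, curvature G y m j k l * η y ![m] =
      (∑ m, pderiv k (fun z => christoffel G z m l j) y * η y ![m])
      - (∑ m, pderiv l (fun z => christoffel G z m k j) y * η y ![m])
      + ((∑ p, christoffel G y p l j * ∑ m, christoffel G y m k p * η y ![m])
        - ∑ p, christoffel G y p k j * ∑ m, christoffel G y m l p * η y ![m]) := by
    simp only [curvature, add_mul, sub_mul, Finset.sum_add_distrib, Finset.sum_sub_distrib,
      Finset.sum_mul, Finset.mul_sum]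
    congr 2
    · rw [Finset.sum_comm]
      exact Finset.sum_congr rfl fun _ _ => Finset.sum_congr rfl fun _ _ => by ring
    · rw [Finset.sum_comm]
      exact Finset.sum_congr rfl fun _ _ => Finset.sum_congr rfl fun _ _ => by ring
  rw [covDeriv_two, covDeriv_two, hd, hd, hcurv, pderiv_comm hU (hη ![j]) hy]
  simp only [covDeriv_one, mul_sub, Finset.sum_sub_distrib]
  simp only [hG.christoffel_symm hy _ k l]
  ring

/-- The curvature tensor as a covariant tensor field of rank four. -/
def riemannTensor (G : CoordMetric) : CoordTensor 4 :=
  fun y I => riemann G y (I 0) (I 1) (I 2) (I 3)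

namespace IsCoordChange

variable {ψ : E4 → E4} {G' G : CoordMetric} {V U : Set E4}

/-- Apply the Ricci identity to the coordinate covector dx^p and to its pull-back, whose components
are the `p`-th row of the Jacobian. Second covariant derivatives are natural, so their commutator
transports the curvature, and the transformation law of the Christoffel symbols need not be
differentiated. -/
theorem curvature_eq (h : IsCoordChange ψ G' V G U) {y : E4} (hy : y ∈ V) (p j k l : Fin 4) :
    ∑ m, jac ψ y p m * curvature G' y m j k l = ∑ b, ∑ c, ∑ d,
      jac ψ y b j * jac ψ y c k * jac ψ y d l * curvature G (ψ y) p b c d := by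
  let η : CoordTensor 1 := fun _ I => if I 0 = p then 1 else 0
  let η' : CoordTensor 1 := fun z I => ∑ K : Fin 1 → Fin 4, (∏ a, jac ψ z (K a) (I a)) * η (ψ z) K
  have hη : SmoothTensor η U := fun I => contDiffOn_const
  have hn : IsNatural ψ V η' η := fun z _ I => rfl
  have hη'v : ∀ z m, η' z ![m] = jac ψ z p m := by
    intro z m
    simp [η', η, sum_fin_one]
  have hη' : SmoothTensor η' V := fun I => by
    have : I = ![I 0] := by funext a; fin_cases a; rfl
    rw [this]; simp only [hη'v]; exact h.smooth_jac _ _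
  have h2 := h.natural_covDeriv (h.natural_covDeriv hn hη) (h.metric.smooth_covDeriv hη) y hy
  have h3 := h.metric'.ricci_identity hη' hy j k l
  have h7 : ∀ a b c, covDeriv G' (covDeriv G' η') y ![a, b, c] = ∑ d, ∑ e, ∑ f,
      jac ψ y d a * jac ψ y e b * jac ψ y f c * covDeriv G (covDeriv G η) (ψ y) ![d, e, f] :=
    fun a b c => (h2 _).trans ((sum_fin_three _).trans (Finset.sum_congr rfl fun d _ =>
      Finset.sum_congr rfl fun e _ => Finset.sum_congr rfl fun f _ =>
      congrArg (· * _) (Fin.prod_univ_three _)))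
  rw [h7, h7] at h3
  have hR := fun b c d => h.metric.ricci_identity hη (h.mapsTo hy) b c d
  simp only [hη'v] at h3
  have h4 : ∑ m, jac ψ y p m * curvature G' y m j k l
      = ∑ m, curvature G' y m j k l * jac ψ y p m :=
    Finset.sum_congr rfl fun _ _ => mul_comm _ _
  rw [h4, ← neg_inj, ← h3]
  rw [Finset.sum_congr rfl fun b _ => (Finset.sum_comm :
    ∑ c, ∑ d, _ = ∑ d, ∑ c, _), ← Finset.sum_sub_distrib, ← Finset.sum_neg_distrib]
  refine Finset.sum_congr rfl fun b _ => ?_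
  rw [← Finset.sum_sub_distrib, ← Finset.sum_neg_distrib]
  refine Finset.sum_congr rfl fun c _ => ?_
  rw [← Finset.sum_sub_distrib, ← Finset.sum_neg_distrib]
  refine Finset.sum_congr rfl fun d _ => ?_
  have h5 : ∑ m, curvature G (ψ y) m b c d * η (ψ y) ![m] = curvature G (ψ y) p b c d := by
    simp [η]
  have h6 := hR b c d
  rw [h5] at h6
  rw [mul_comm _ (curvature _ _ _ _ _ _), ← neg_mul, ← h6]
  ring

theorem natural_riemann (h : IsCoordChange ψ G' V G U) : IsNatural ψ V (riemannTensor G') (riemannTensor G) := by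
  intro y hy I
  simp only [riemannTensor, riemann, sum_fin_four, Fin.prod_univ_four]
  have h1 : ∑ m, G' y (I 0) m * curvature G' y m (I 1) (I 2) (I 3)
      = ∑ a, ∑ b, jac ψ y a (I 0) * G (ψ y) a b
        * ∑ m, jac ψ y b m * curvature G' y m (I 1) (I 2) (I 3) := by
    simp only [h.eq_apply hy, Finset.sum_mul, Finset.mul_sum]
    rw [Finset.sum_comm]
    refine Finset.sum_congr rfl fun a _ => ?_
    rw [Finset.sum_comm]
    exact Finset.sum_congr rfl fun b _ => Finset.sum_congr rfl fun m _ => by ring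
  rw [h1]
  refine Finset.sum_congr rfl fun a _ => ?_
  simp only [h.curvature_eq hy, Finset.mul_sum]
  rw [Finset.sum_comm]
  refine Finset.sum_congr rfl fun b _ => ?_
  rw [Finset.sum_comm]
  refine Finset.sum_congr rfl fun c _ => ?_
  rw [Finset.sum_comm]
  refine Finset.sum_congr rfl fun d _ => Finset.sum_congr rfl fun m _ => ?_
  simp
  ring

end IsCoordChange

/-! ### Naturality of the tensors and scalars built from the Weyl tensor. -/

theorem normSq_eq_pairing (G : CoordMetric) {k : ℕ} (T : CoordTensor k) (y : E4) :
    normSq G T y = pairing (G y)⁻¹ (T y) (T y) := rfl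

/-- The Ricci tensor as a covariant tensor field of rank two. -/
def ricciTensor (G : CoordMetric) : CoordTensor 2 := fun y I => ricci G y (I 0) (I 1)

/-- The metric as a covariant tensor field of rank two. -/
def metricTensor (G : CoordMetric) : CoordTensor 2 := fun y I => G y (I 0) (I 1)

/-- The scalar curvature as a covariant tensor field of rank zero. -/
def scalarTensor (G : CoordMetric) : CoordTensor 0 := fun y _ => scalarCurv G y

/-- A function as a covariant tensor field of rank zero. -/
def funTensor (f : E4 → ℝ) : CoordTensor 0 := fun y _ => f y

/-- The contraction `W_{tijk} f^t` of the Weyl tensor with the gradient of a function. -/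
def weylGrad (G : CoordMetric) (f : E4 → ℝ) : CoordTensor 3 := fun y I =>
  ∑ t, ∑ s, invMetric G y t s * (weyl G y t (I 0) (I 1) (I 2) * pderiv s f y)

/-- The covariant derivative `∇_t (δW)_{ijk}`, as a tensor with the order of indices `t, i, j, k`. -/
def gradDivWeyl (G : CoordMetric) : CoordTensor 4 := fun y I =>
  covDeriv G (divWeyl G) y ![I 1, I 2, I 3, I 0]

/-- The contraction `W_{ijkl} W^{ij}_{pq}`. -/
def weylSquare (G : CoordMetric) : CoordTensor 4 := fun y I =>
  ∑ j, ∑ b, invMetric G y j b * ∑ i, ∑ a, invMetric G y i a *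
    (weyl G y i j (I 0) (I 1) * weyl G y a b (I 2) (I 3))

theorem covDeriv_zero (G : CoordMetric) (T : CoordTensor 0) (y : E4) (I : Fin 1 → Fin 4) :
    covDeriv G T y I = pderiv (I 0) (fun z => T z ![]) y := by
  simp only [covDeriv, Finset.univ_eq_empty, Finset.sum_empty, sub_zero]
  have : (fun a : Fin 0 => I a.castSucc) = ![] := Subsingleton.elim _ _
  rw [this]
  rfl

/-- The trace of an iterated covariant derivative is the form to which naturality applies. -/
theorem coordLaplacian_eq (G : CoordMetric) (f : E4 → ℝ) (y : E4) :
    coordLaplacian G f y = ∑ i, ∑ j, invMetric G y i j *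
      covDeriv G (covDeriv G (funTensor f)) y ![j, i] := by
  refine Finset.sum_congr rfl fun i _ => Finset.sum_congr rfl fun j _ => ?_
  rw [covDeriv_one]
  simp only [covDeriv_zero]
  rfl

/-- As a pairing of two natural tensors the cubic contraction is visibly invariant. -/
theorem weylCubic_eq (G : CoordMetric) (y : E4) :
    weylCubic G y = pairing (G y)⁻¹ (weylSquare G y) (weylTensor G y) := by
  rw [pairing, sum_fin_four]
  have h1 : ∀ k l p q, weylSquare G y ![k, l, p, q] = ∑ i, ∑ j, weyl G y i j k l *
      (∑ a, ∑ b, invMetric G y i a * invMetric G y j b * weyl G y a b p q) := by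
    intro k l p q
    show ∑ j, ∑ b, invMetric G y j b * ∑ i, ∑ a, invMetric G y i a *
      (weyl G y i j k l * weyl G y a b p q) = _
    simp only [Finset.mul_sum]
    rw [Finset.sum_congr rfl fun j _ => Finset.sum_comm, Finset.sum_comm]
    refine Finset.sum_congr rfl fun i _ => Finset.sum_congr rfl fun j _ => ?_
    rw [Finset.sum_comm]
    exact Finset.sum_congr rfl fun a _ => Finset.sum_congr rfl fun b _ => by ring
  simp only [h1, Finset.sum_mul (ι := Fin 4)]
  unfold weylCubic
  have h2 : ∀ f : Fin 4 → Fin 4 → Fin 4 → Fin 4 → Fin 4 → Fin 4 → ℝ,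
      ∑ i, ∑ j, ∑ k, ∑ l, ∑ p, ∑ q, f i j k l p q
        = ∑ k, ∑ l, ∑ p, ∑ q, ∑ i, ∑ j, f i j k l p q := by
    intro f
    have h3 : ∀ g : Fin 4 → Fin 4 → Fin 4 → Fin 4 → Fin 4 → ℝ,
        ∑ i, ∑ k, ∑ l, ∑ p, ∑ q, g i k l p q = ∑ k, ∑ l, ∑ p, ∑ q, ∑ i, g i k l p q := by
      intro g
      rw [Finset.sum_comm]
      refine Finset.sum_congr rfl fun _ _ => ?_
      rw [Finset.sum_comm]
      refine Finset.sum_congr rfl fun _ _ => ?_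
      rw [Finset.sum_comm]
      refine Finset.sum_congr rfl fun _ _ => ?_
      rw [Finset.sum_comm]
    rw [Finset.sum_congr rfl fun i _ => h3 (f i)]
    exact h3 fun i k l p q => ∑ j, f i j k l p q
  rw [h2]
  rfl

namespace IsCoordChange

variable {ψ : E4 → E4} {G' G : CoordMetric} {V U : Set E4}

theorem natural_metric (h : IsCoordChange ψ G' V G U) :
    IsNatural ψ V (metricTensor G') (metricTensor G) := by
  intro y hy I
  rw [sum_fin_two]
  simp only [metricTensor, h.eq_apply hy, Fin.prod_univ_two]
  refine Finset.sum_congr rfl fun a _ => Finset.sum_congr rfl fun b _ => ?_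
  show _ = jac ψ y a (I 0) * jac ψ y b (I 1) * G (ψ y) a b
  ring

/-- In this and the following contractions the equivalence lists the two contracted slots first and
the free slots afterwards; here slots 1 and 3 of the curvature are traced. -/
theorem natural_ricci (h : IsCoordChange ψ G' V G U) :
    IsNatural ψ V (ricciTensor G') (ricciTensor G) := fun y hy =>
  IsPull.contract (ν := Fin 4) (ι := Fin 2)
    (Equiv.ofBijective (Sum.elim ![1, 3] ![0, 2]) (by decide)) (h.inv_eq hy)
    (fun j l I => ![I 0, j, I 1, l])
    (by intro t s I; ext x; rcases x with x | x <;> fin_cases x <;> rfl)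
    (h.natural_riemann y hy)

theorem natural_scalar (h : IsCoordChange ψ G' V G U) :
    IsNatural ψ V (scalarTensor G') (scalarTensor G) := fun y hy =>
  IsPull.contract (ν := Fin 2) (ι := Fin 0)
    (Equiv.ofBijective (Sum.elim ![0, 1] ![]) (by decide)) (h.inv_eq hy)
    (fun j l _ => ![j, l])
    (by intro t s I; ext x; rcases x with x | x <;> fin_cases x <;> rfl)
    (h.natural_ricci y hy)

theorem eq_of_natural_zero {T' T : CoordTensor 0} (hT : IsNatural ψ V T' T) {y : E4} (hy : y ∈ V)
    (I : Fin 0 → Fin 4) : T' y I = T (ψ y) I := by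
  rw [hT y hy, sum_fin_zero]
  have : I = ![] := Subsingleton.elim _ _
  subst this
  simp

theorem natural_tensor_two (σ : Fin 2 ⊕ Fin 2 ≃ Fin 4) {T' T S' S : CoordTensor 2}
    (hT : IsNatural ψ V T' T) (hS : IsNatural ψ V S' S) :
    IsNatural ψ V
      (fun y I => T' y (fun a => I (σ (Sum.inl a))) * S' y (fun b => I (σ (Sum.inr b))))
      (fun y I => T y (fun a => I (σ (Sum.inl a))) * S y (fun b => I (σ (Sum.inr b)))) :=
  fun y hy => (hT y hy).tensor σ (hS y hy)

theorem natural_weyl (h : IsCoordChange ψ G' V G U) :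
    IsNatural ψ V (weylTensor G') (weylTensor G) := by
  intro y hy
  have hr := h.natural_ricci
  have hg := h.natural_metric
  -- The four ways in which the slots are shared between the two factors in the Ricci part of the
  -- Weyl tensor: ik|jl, il|jk, jl|ik, jk|il.
  let e1 : Fin 2 ⊕ Fin 2 ≃ Fin 4 := Equiv.ofBijective (Sum.elim ![0, 2] ![1, 3]) (by decide)
  let e2 : Fin 2 ⊕ Fin 2 ≃ Fin 4 := Equiv.ofBijective (Sum.elim ![0, 3] ![1, 2]) (by decide)
  let e3 : Fin 2 ⊕ Fin 2 ≃ Fin 4 := Equiv.ofBijective (Sum.elim ![1, 3] ![0, 2]) (by decide)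
  let e4 : Fin 2 ⊕ Fin 2 ≃ Fin 4 := Equiv.ofBijective (Sum.elim ![1, 2] ![0, 3]) (by decide)
  have hs := eq_of_natural_zero h.natural_scalar hy ![]
  have key := ((h.natural_riemann y hy).sub
    (((((natural_tensor_two e1 hr hg y hy).sub (natural_tensor_two e2 hr hg y hy)).add
      (natural_tensor_two e3 hr hg y hy)).sub (natural_tensor_two e4 hr hg y hy)).const_mul
        (1 / 2))).add
    (((natural_tensor_two e1 hg hg y hy).sub (natural_tensor_two e2 hg hg y hy)).const_mul
      (scalarCurv G' y / 6))
  have hs' : scalarCurv G' y = scalarCurv G (ψ y) := hs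
  intro I
  refine (key I).trans (Finset.sum_congr rfl fun K _ => ?_)
  rw [hs']
  rfl

theorem natural_divWeyl (h : IsCoordChange ψ G' V G U) :
    IsNatural ψ V (divWeyl G') (divWeyl G) := fun y hy =>
  IsPull.contract (ν := Fin 5) (ι := Fin 3)
    (Equiv.ofBijective (Sum.elim ![0, 4] ![1, 2, 3]) (by decide)) (h.inv_eq hy)
    (fun t s I => ![t, I 0, I 1, I 2, s])
    (by intro t s I; ext x; rcases x with x | x <;> fin_cases x <;> rfl)
    (h.natural_covDeriv h.natural_weyl h.metric.smooth_weylTensor y hy)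

theorem natural_gradDivWeyl (h : IsCoordChange ψ G' V G U) :
    IsNatural ψ V (gradDivWeyl G') (gradDivWeyl G) := fun y hy => by
  let e : Fin 4 ≃ Fin 4 := Equiv.ofBijective ![1, 2, 3, 0] (by decide)
  have key := (h.natural_covDeriv h.natural_divWeyl h.metric.smooth_divWeyl y hy).comp_equiv e
  have h1 : ∀ I : Fin 4 → Fin 4, I ∘ e = ![I 1, I 2, I 3, I 0] := by
    intro I; ext x; fin_cases x <;> rfl
  intro I
  have h2 := key I
  beta_reduce at h2
  simp only [h1] at h2
  exact h2

theorem natural_fun {f : E4 → ℝ} : IsNatural ψ V (funTensor fun y => f (ψ y)) (funTensor f) :=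
  fun y _ I => by simp [funTensor]

theorem natural_grad (h : IsCoordChange ψ G' V G U) {f : E4 → ℝ} (hf : ContDiffOn ℝ ∞ f U) :
    IsNatural ψ V (covDeriv G' (funTensor fun y => f (ψ y))) (covDeriv G (funTensor f)) :=
  h.natural_covDeriv natural_fun fun _ => hf

theorem natural_weylGrad (h : IsCoordChange ψ G' V G U) {f : E4 → ℝ} (hf : ContDiffOn ℝ ∞ f U) :
    IsNatural ψ V (weylGrad G' fun y => f (ψ y)) (weylGrad G f) := fun y hy => by
  have h1 := (h.natural_weyl y hy).tensor (ν := Fin 5)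
    (Equiv.ofBijective (Sum.elim ![0, 1, 2, 3] ![4]) (by decide)) (h.natural_grad hf y hy)
  have key := IsPull.contract (ν := Fin 5) (ι := Fin 3)
    (Equiv.ofBijective (Sum.elim ![0, 4] ![1, 2, 3]) (by decide)) (h.inv_eq hy)
    (fun t s I => ![t, I 0, I 1, I 2, s])
    (by intro t s I; ext x; rcases x with x | x <;> fin_cases x <;> rfl) h1
  simp only [covDeriv_zero] at key
  exact key

theorem natural_weylSquare (h : IsCoordChange ψ G' V G U) :
    IsNatural ψ V (weylSquare G') (weylSquare G) := fun y hy => by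
  have h1 := (h.natural_weyl y hy).tensor (ν := Fin 8)
    (Equiv.ofBijective (Sum.elim ![0, 1, 2, 3] ![4, 5, 6, 7]) (by decide)) (h.natural_weyl y hy)
  have h2 := IsPull.contract (ν := Fin 8) (ι := Fin 6)
    (Equiv.ofBijective (Sum.elim ![0, 4] ![1, 2, 3, 5, 6, 7]) (by decide)) (h.inv_eq hy)
    (fun t s I => ![t, I 0, I 1, I 2, s, I 3, I 4, I 5])
    (by intro t s I; ext x; rcases x with x | x <;> fin_cases x <;> rfl) h1
  exact IsPull.contract (ν := Fin 6) (ι := Fin 4)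
    (Equiv.ofBijective (Sum.elim ![0, 3] ![1, 2, 4, 5]) (by decide)) (h.inv_eq hy)
    (fun t s I => ![t, I 0, I 1, s, I 2, I 3])
    (by intro t s I; ext x; rcases x with x | x <;> fin_cases x <;> rfl) h2

theorem pairing_eq (h : IsCoordChange ψ G' V G U) {k : ℕ} {T' T S' S : CoordTensor k}
    (hT : IsNatural ψ V T' T) (hS : IsNatural ψ V S' S) {y : E4} (hy : y ∈ V) :
    pairing (G' y)⁻¹ (T' y) (S' y) = pairing (G (ψ y))⁻¹ (T (ψ y)) (S (ψ y)) :=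
  pairing_eq_of_isPull (h.inv_eq hy) (hT y hy) (hS y hy)

theorem scalarCurv_eq (h : IsCoordChange ψ G' V G U) {y : E4} (hy : y ∈ V) :
    scalarCurv G' y = scalarCurv G (ψ y) :=
  eq_of_natural_zero h.natural_scalar hy ![]

theorem weylCubic_eq (h : IsCoordChange ψ G' V G U) {y : E4} (hy : y ∈ V) :
    weylCubic G' y = weylCubic G (ψ y) := by
  rw [WeakHarmonicWeyl.weylCubic_eq, WeakHarmonicWeyl.weylCubic_eq]
  exact h.pairing_eq h.natural_weylSquare h.natural_weyl hy

theorem normSq_eq (h : IsCoordChange ψ G' V G U) {k : ℕ} {T' T : CoordTensor k}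
    (hT : IsNatural ψ V T' T) {y : E4} (hy : y ∈ V) :
    normSq G' T' y = normSq G T (ψ y) := h.pairing_eq hT hT hy

theorem coordLaplacian_eq (h : IsCoordChange ψ G' V G U) {f : E4 → ℝ} (hf : ContDiffOn ℝ ∞ f U)
    {y : E4} (hy : y ∈ V) :
    coordLaplacian G' (fun z => f (ψ z)) y = coordLaplacian G f (ψ y) := by
  rw [WeakHarmonicWeyl.coordLaplacian_eq, WeakHarmonicWeyl.coordLaplacian_eq]
  have h1 := h.natural_covDeriv (h.natural_grad hf)
    (h.metric.smooth_covDeriv (T := funTensor f) fun _ => hf) y hy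
  have h2 := IsPull.contract (ν := Fin 2) (ι := Fin 0)
    (Equiv.ofBijective (Sum.elim ![1, 0] ![]) (by decide)) (h.inv_eq hy)
    (fun i j _ => ![j, i])
    (by intro t s I; ext x; rcases x with x | x <;> fin_cases x <;> rfl) h1 ![]
  rw [sum_fin_zero] at h2
  simpa [invMetric] using h2

end IsCoordChange

/-! ### Normal coordinates -/

theorem pderiv_coord (i a : Fin 4) (y : E4) :
    pderiv i (fun z : E4 => z a) y = if a = i then 1 else 0 := by
  have h : (fun z : E4 => z a) = (EuclideanSpace.proj (𝕜 := ℝ) a) := rfl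
  rw [pderiv, h, ContinuousLinearMap.fderiv]
  simp

theorem contDiff_coord (a : Fin 4) : ContDiff ℝ ∞ (fun z : E4 => z a) :=
  (EuclideanSpace.proj (𝕜 := ℝ) a).contDiff

theorem pderiv_linear (B : Fin 4 → ℝ) (k : Fin 4) (y : E4) :
    pderiv k (fun z => ∑ i, B i * z i) y = B k := by
  have h : ∀ i, DifferentiableAt ℝ (fun z : E4 => z i) y := fun i =>
    (contDiff_coord i).differentiable (by simp) y
  rw [pderiv_sum fun i _ => (h i).const_mul _]
  simp [pderiv_const_mul, pderiv_coord]

theorem pderiv_quadratic (C : Fin 4 → Fin 4 → ℝ) (hC : ∀ i j, C i j = C j i) (k : Fin 4) (y : E4) :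
    pderiv k (fun z => ∑ i, ∑ j, C i j * z i * z j) y = 2 * ∑ j, C k j * y j := by
  have h : ∀ i, DifferentiableAt ℝ (fun z : E4 => z i) y := fun i =>
    (contDiff_coord i).differentiable (by simp) y
  rw [pderiv_sum fun i _ => DifferentiableAt.fun_sum fun j _ => ((h i).const_mul _).fun_mul (h j)]
  have h1 : ∀ i, pderiv k (fun z => ∑ j, C i j * z i * z j) y
      = (∑ j, C i j * (if i = k then 1 else 0) * y j) + C i k * y i := by
    intro i
    rw [pderiv_sum fun j _ => ((h i).const_mul _).fun_mul (h j)]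
    have h2 : ∀ j, pderiv k (fun z : E4 => C i j * z i * z j) y
        = C i j * (if i = k then 1 else 0) * y j + C i j * y i * (if j = k then 1 else 0) := by
      intro j
      rw [pderiv_mul ((h i).const_mul _) (h j), pderiv_const_mul, pderiv_coord, pderiv_coord]
    simp [h2, Finset.sum_add_distrib]
  simp only [h1, Finset.sum_add_distrib]
  rw [Finset.sum_comm]
  have h3 : ∑ i, C i k * y i = ∑ j, C k j * y j :=
    Finset.sum_congr rfl fun j _ => by rw [hC]
  rw [h3]
  simp
  ring

/-- The quadratic map with value `p`, Jacobian `A` and Hessian `-C` at the origin. -/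
def quadMap (p : E4) (A : Matrix (Fin 4) (Fin 4) ℝ) (C : Fin 4 → Fin 4 → Fin 4 → ℝ) (y : E4) : E4 :=
  WithLp.toLp 2 fun a => p a + ∑ i, A a i * y i - (1 / 2) * ∑ i, ∑ j, C a i j * y i * y j

section QuadMap

variable {p : E4} {A : Matrix (Fin 4) (Fin 4) ℝ} {C : Fin 4 → Fin 4 → Fin 4 → ℝ}

theorem quadMap_zero : quadMap p A C 0 = p := by
  ext a
  simp [quadMap]

theorem contDiff_quadMap : ContDiff ℝ ∞ (quadMap p A C) := by
  rw [contDiff_euclidean]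
  intro a
  simp only [quadMap]
  have h := contDiff_coord
  exact (contDiff_const.add (ContDiff.sum fun i _ => contDiff_const.mul (h i))).sub
    (contDiff_const.mul (ContDiff.sum fun i _ => ContDiff.sum fun j _ =>
      (contDiff_const.mul (h i)).mul (h j)))

theorem jac_quadMap (hC : ∀ a i j, C a i j = C a j i) (a i : Fin 4) (y : E4) :
    jac (quadMap p A C) y a i = A a i - ∑ j, C a i j * y j := by
  have h : ∀ i, Differentiable ℝ (fun z : E4 => z i) := fun i =>
    (contDiff_coord i).differentiable (by simp)
  have h1 : DifferentiableAt ℝ (fun z : E4 => ∑ i, A a i * z i) y :=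
    DifferentiableAt.fun_sum fun i _ => (h i y).const_mul _
  have h2 : DifferentiableAt ℝ (fun z : E4 => ∑ i, ∑ j, C a i j * z i * z j) y :=
    DifferentiableAt.fun_sum fun i _ => DifferentiableAt.fun_sum fun j _ =>
      ((h i y).const_mul _).fun_mul (h j y)
  rw [jac_apply]
  simp only [quadMap]
  rw [pderiv_sub (h1.const_add (p a)) (h2.const_mul _),
    pderiv_add (differentiableAt_const _) h1, pderiv_const_mul, pderiv_linear,
    pderiv_quadratic _ (hC a), pderiv_const]
  ring

end QuadMap

namespace IsMetricOn

variable {G : CoordMetric} {U : Set E4}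

/-- Only points with invertible Jacobian are kept: this is an open condition, and it makes the
pulled-back matrix positive definite. -/
theorem isCoordChange_pullback (hG : IsMetricOn G U) {ψ : E4 → E4} (hψ : ContDiff ℝ ∞ ψ) :
    IsCoordChange ψ (fun y => (jac ψ y).transpose * G (ψ y) * jac ψ y)
      {y | ψ y ∈ U ∧ (jac ψ y).det ≠ 0} G U := by
  have hc : ∀ a, ContDiff ℝ ∞ (fun y => ψ y a) := fun a =>
    (EuclideanSpace.proj (𝕜 := ℝ) a).contDiff.comp hψ
  have hJ : ∀ a i, ContDiff ℝ ∞ (fun y => jac ψ y a i) := fun a i =>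
    contDiffOn_univ.1 (contDiffOn_pderiv isOpen_univ (contDiffOn_univ.2 (hc a)))
  have hdet : Continuous fun y => (jac ψ y).det :=
    (contDiffOn_univ.1 (contDiffOn_det fun i j => contDiffOn_univ.2 (hJ i j))).continuous
  have hopen : IsOpen {y | ψ y ∈ U ∧ (jac ψ y).det ≠ 0} :=
    (hG.isOpen.preimage hψ.continuous).inter (isOpen_ne.preimage hdet)
  refine ⟨⟨hopen, fun i j => ?_, fun y hy => ?_⟩, hG, fun y hy => hy.1, hψ.contDiffOn, fun y _ => rfl⟩
  · simp only [Matrix.mul_apply, Matrix.transpose_apply]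
    exact ContDiffOn.sum fun a _ => (ContDiffOn.sum fun b _ => (hJ _ _).contDiffOn.mul
      ((hG.smooth _ _).comp hψ.contDiffOn fun y hy => hy.1)).mul (hJ _ _).contDiffOn
  · have h := (hG.posDef _ hy.1).conjTranspose_mul_mul_same (B := jac ψ y)
      (Matrix.mulVec_injective_of_isUnit
        ((Matrix.isUnit_iff_isUnit_det _).2 (isUnit_iff_ne_zero.2 hy.2)))
    simpa using h

/-- A quadratic map suffices. By JΓ' = ∂J + Γ(J, J), Jacobian `A` and Hessian -Γ(A, A) at the origin
make the new Christoffel symbols vanish there. The choice of `A` is left free, in order to keep the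
given frame or to make it orthonormal. -/
theorem exists_normal (hG : IsMetricOn G U) {p : E4} (hp : p ∈ U) {A : Matrix (Fin 4) (Fin 4) ℝ}
    (hA : IsUnit A.det) : ∃ ψ G' V, IsCoordChange ψ G' V G U ∧ (0 : E4) ∈ V ∧ ψ 0 = p ∧
      jac ψ 0 = A ∧ ∀ k i j, christoffel G' 0 k i j = 0 := by
  let C : Fin 4 → Fin 4 → Fin 4 → ℝ := fun a i j =>
    ∑ b, ∑ c, A b i * A c j * christoffel G p a b c
  have hC : ∀ a i j, C a i j = C a j i := by
    intro a i j
    simp only [C]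
    rw [Finset.sum_comm]
    refine Finset.sum_congr rfl fun b _ => Finset.sum_congr rfl fun c _ => ?_
    rw [hG.christoffel_symm hp]
    ring
  have h := hG.isCoordChange_pullback (contDiff_quadMap (p := p) (A := A) (C := C))
  have hJ : jac (quadMap p A C) 0 = A := by
    ext a i
    rw [jac_quadMap hC]
    simp
  have h0 : (0 : E4) ∈ {y | quadMap p A C y ∈ U ∧ (jac (quadMap p A C) y).det ≠ 0} := by
    refine ⟨by rwa [quadMap_zero], ?_⟩
    rw [hJ]
    exact hA.ne_zero
  refine ⟨_, _, _, h, h0, quadMap_zero, hJ, fun k i j => ?_⟩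
  have h1 : A.mulVec (fun k => christoffel (fun y => (jac (quadMap p A C) y).transpose *
      G (quadMap p A C y) * jac (quadMap p A C) y) 0 k i j) = A.mulVec 0 := by
    funext a
    have h2 := h.christoffel_eq h0 a i j
    have h3 : pderiv i (fun z => jac (quadMap p A C) z a j) 0 = - C a j i := by
      simp only [jac_quadMap hC]
      rw [pderiv_sub (differentiableAt_const _) (DifferentiableAt.fun_sum fun k _ =>
        ((contDiff_coord k).differentiable (by simp) 0).const_mul _), pderiv_linear, pderiv_const]
      ring
    rw [h3, hJ, quadMap_zero, hC a j i] at h2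
    simpa [C, Matrix.mulVec, dotProduct] using h2
  exact congrFun (Matrix.mulVec_injective_of_isUnit ((Matrix.isUnit_iff_isUnit_det _).2 hA) h1) k

/-- Coordinates in which the Christoffel symbols vanish at a point, with the same frame there. -/
theorem exists_normal_one (hG : IsMetricOn G U) {p : E4} (hp : p ∈ U) :
    ∃ ψ G' V, IsCoordChange ψ G' V G U ∧ (0 : E4) ∈ V ∧ ψ 0 = p ∧
      jac ψ 0 = 1 ∧ ∀ k i j, christoffel G' 0 k i j = 0 :=
  hG.exists_normal hp (by simp)

open scoped Matrix.Norms.L2Operator MatrixOrder in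
/-- Normal coordinates that are orthonormal at the given point. -/
theorem exists_orthonormal (hG : IsMetricOn G U) {p : E4} (hp : p ∈ U) :
    ∃ ψ G' V, IsCoordChange ψ G' V G U ∧ (0 : E4) ∈ V ∧ ψ 0 = p ∧
      G' 0 = 1 ∧ ∀ k i j, christoffel G' 0 k i j = 0 := by
  obtain ⟨B, hB⟩ : ∃ B : Matrix (Fin 4) (Fin 4) ℝ, G p = B.conjTranspose * B :=
    CStarAlgebra.nonneg_iff_eq_star_mul_self.1 (hG.posDef p hp).posSemidef.nonneg
  have hB' : IsUnit B.det := by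
    have := hG.det_pos hp
    rw [hB, Matrix.det_mul] at this
    exact (right_ne_zero_of_mul this.ne').isUnit
  obtain ⟨ψ, G', V, h, h0, h1, h2, h3⟩ := hG.exists_normal hp (A := B⁻¹)
    (Matrix.isUnit_nonsing_inv_det _ hB')
  refine ⟨ψ, G', V, h, h0, h1, ?_, h3⟩
  have hBt : IsUnit B.transpose.det := by rwa [Matrix.det_transpose]
  rw [h.eq 0 h0, h1, h2, hB, Matrix.conjTranspose_eq_transpose_of_trivial,
    Matrix.transpose_nonsing_inv, ← Matrix.mul_assoc, Matrix.nonsing_inv_mul _ hBt, Matrix.one_mul,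
    Matrix.mul_nonsing_inv _ hB']

theorem pderiv_metric_eq_zero (hG : IsMetricOn G U) {y : E4} (hy : y ∈ U)
    (hc : ∀ k i j, christoffel G y k i j = 0) (k i j : Fin 4) :
    pderiv k (fun z => G z i j) y = 0 := by
  rw [hG.pderiv_metric hy]
  simp [hc]

theorem pderiv_inv_eq_zero (hG : IsMetricOn G U) {y : E4} (hy : y ∈ U)
    (hc : ∀ k i j, christoffel G y k i j = 0) (k i j : Fin 4) :
    pderiv k (fun z => invMetric G z i j) y = 0 := by
  have h1 : ∀ j, ∑ l, pderiv k (fun z => invMetric G z i l) y * G y l j = 0 := by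
    intro j
    have h2 : pderiv k (fun z => ∑ l, invMetric G z i l * G z l j) y = 0 := by
      rw [pderiv_congr_on hG.isOpen hy (fun z hz => hG.sum_inv_mul hz i j), pderiv_const]
    have hd1 := fun l => (hG.smooth_inv i l).diffAt hG.isOpen hy
    have hd2 := fun l => (hG.smooth l j).diffAt hG.isOpen hy
    rw [pderiv_sum fun l _ => (hd1 l).fun_mul (hd2 l)] at h2
    rw [← h2]
    refine Finset.sum_congr rfl fun l _ => ?_
    rw [pderiv_mul (hd1 l) (hd2 l), hG.pderiv_metric_eq_zero hy hc]
    simp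
  have h2 : ∑ j', (∑ l, pderiv k (fun z => invMetric G z i l) y * G y l j') * invMetric G y j' j
      = pderiv k (fun z => invMetric G z i j) y := by
    simp only [Finset.sum_mul]
    rw [Finset.sum_comm]
    simp only [mul_assoc, ← Finset.mul_sum, hG.sum_mul_inv hy]
    simp
  rw [← h2]
  simp [h1]

end IsMetricOn

/-- When the frame at the point is unchanged a natural tensor keeps its components; this carries
identities from normal coordinates back to the given ones. -/
theorem IsNatural.eq_of_jac_eq_one {ψ : E4 → E4} {V : Set E4} {k : ℕ} {T' T : CoordTensor k}
    (h : IsNatural ψ V T' T) {y : E4} (hy : y ∈ V) (hJ : jac ψ y = 1) : T' y = T (ψ y) := by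
  have h1 := h y hy
  rw [hJ] at h1
  exact isPull_one h1

theorem covDeriv_eq_pderiv {G : CoordMetric} {y : E4} (hc : ∀ k i j, christoffel G y k i j = 0)
    {k : ℕ} (T : CoordTensor k) (J : Fin (k + 1) → Fin 4) :
    covDeriv G T y J = pderiv (J (Fin.last k)) (fun z => T z fun a => J a.castSucc) y := by
  simp [covDeriv, hc]

/-! ### Symmetries of the curvature -/

/-- The algebraic symmetries of a curvature tensor. -/
structure IsCurvatureLike (R : Fin 4 → Fin 4 → Fin 4 → Fin 4 → ℝ) : Prop where
  anti : ∀ i j k l, R i j k l = - R j i k l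
  pair : ∀ i j k l, R i j k l = R k l i j
  cyclic : ∀ i j k l, R i j k l + R i k l j + R i l j k = 0

theorem IsCurvatureLike.anti' {R : Fin 4 → Fin 4 → Fin 4 → Fin 4 → ℝ} (h : IsCurvatureLike R)
    (i j k l : Fin 4) : R i j k l = - R i j l k := by
  rw [h.pair, h.anti, h.pair]

/-- The Kulkarni-Nomizu product of two symmetric bilinear forms. -/
def kulkarni (S g : Fin 4 → Fin 4 → ℝ) (i j k l : Fin 4) : ℝ :=
  S i k * g j l - S i l * g j k + S j l * g i k - S j k * g i l

theorem isCurvatureLike_kulkarni {S g : Fin 4 → Fin 4 → ℝ} (hS : ∀ i j, S i j = S j i)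
    (hg : ∀ i j, g i j = g j i) : IsCurvatureLike (kulkarni S g) where
  anti i j k l := by simp only [kulkarni]; ring
  pair i j k l := by
    simp only [kulkarni]; rw [hS k i, hS k j, hS l j, hS l i, hg k i, hg k j, hg l j, hg l i]; ring
  cyclic i j k l := by
    simp only [kulkarni]
    rw [hS l j, hS k l, hS k j, hg k j, hg k l, hg l j]; ring

theorem IsCurvatureLike.sub {R T : Fin 4 → Fin 4 → Fin 4 → Fin 4 → ℝ} (h : IsCurvatureLike R)
    (h2 : IsCurvatureLike T) : IsCurvatureLike fun i j k l => R i j k l - T i j k l where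
  anti i j k l := by rw [h.anti, h2.anti]; ring
  pair i j k l := by rw [h.pair, h2.pair]
  cyclic i j k l := by linear_combination h.cyclic i j k l - h2.cyclic i j k l

/-- The Schouten tensor. -/
def schouten (G : CoordMetric) (y : E4) (i j : Fin 4) : ℝ :=
  (1 / 2) * (ricci G y i j - scalarCurv G y / 6 * G y i j)

/-- The decomposition Riem = W + S ∧ g. From it W inherits the curvature symmetries, and along it
the Bianchi identity and the curvature term of the Weitzenböck formula split. -/
theorem weyl_eq (G : CoordMetric) (y : E4) (i j k l : Fin 4) :
    weyl G y i j k l = riemann G y i j k l - kulkarni (schouten G y) (G y) i j k l := by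
  simp only [weyl, kulkarni, schouten]
  ring

namespace IsMetricOn

variable {G : CoordMetric} {U : Set E4} {y : E4}

theorem _root_.WeakHarmonicWeyl.curvature_of_christoffel_eq_zero
    (hc : ∀ k i j, christoffel G y k i j = 0) (m j k l : Fin 4) :
    curvature G y m j k l = pderiv k (fun z => christoffel G z m l j) y
      - pderiv l (fun z => christoffel G z m k j) y := by
  simp [curvature, hc]

theorem pderiv_christoffel (hG : IsMetricOn G U) (hy : y ∈ U)
    (hc : ∀ k i j, christoffel G y k i j = 0) (k m l j : Fin 4) :
    pderiv k (fun z => christoffel G z m l j) y = (1 / 2) * ∑ n, invMetric G y m n *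
      (pderiv k (pderiv l fun z => G z j n) y + pderiv k (pderiv j fun z => G z l n) y
        - pderiv k (pderiv n fun z => G z l j) y) := by
  have hU := hG.isOpen
  have h1 := fun a b => (hG.smooth_inv a b).diffAt hU hy
  have h2 := fun a i j => (contDiffOn_pderiv (i := a) hU (hG.smooth i j)).diffAt hU hy
  have h3 := fun a b c d e f g i j => ((h2 a b c).fun_add (h2 d e f)).fun_sub (h2 g i j)
  simp only [christoffel]
  rw [pderiv_const_mul, pderiv_sum fun n _ => (h1 m n).fun_mul (h3 _ _ _ _ _ _ _ _ _)]
  congr 1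
  refine Finset.sum_congr rfl fun n _ => ?_
  rw [pderiv_mul (h1 m n) (h3 _ _ _ _ _ _ _ _ _), hG.pderiv_inv_eq_zero hy hc,
    pderiv_sub ((h2 _ _ _).fun_add (h2 _ _ _)) (h2 _ _ _), pderiv_add (h2 _ _ _) (h2 _ _ _)]
  ring

/-- Only second derivatives of the metric survive at such a point, so the symmetries of the
curvature reduce to the symmetry of g and the commutation of partial derivatives. -/
theorem riemann_of_christoffel_eq_zero (hG : IsMetricOn G U) (hy : y ∈ U)
    (hc : ∀ k i j, christoffel G y k i j = 0) (i j k l : Fin 4) :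
    riemann G y i j k l = (1 / 2) *
      (pderiv k (pderiv j fun z => G z l i) y - pderiv k (pderiv i fun z => G z l j) y
        - pderiv l (pderiv j fun z => G z k i) y + pderiv l (pderiv i fun z => G z k j) y) := by
  have key : ∀ f : Fin 4 → ℝ, ∑ m, G y i m * ∑ n, invMetric G y m n * f n = f i := by
    intro f
    simp only [Finset.mul_sum]
    rw [Finset.sum_comm]
    simp only [← mul_assoc, ← Finset.sum_mul, hG.sum_mul_inv hy]
    simp
  simp only [riemann, curvature_of_christoffel_eq_zero hc, hG.pderiv_christoffel hy hc,
    mul_sub (G y _ _), Finset.sum_sub_distrib, mul_left_comm (G y _ _), ← Finset.mul_sum, key]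
  rw [pderiv_comm hG.isOpen (hG.smooth j i) hy (i := k) (j := l)]
  ring

theorem isCurvatureLike_riemann (hG : IsMetricOn G U) (hy : y ∈ U) :
    IsCurvatureLike (riemann G y) := by
  obtain ⟨ψ, G', V, h, h0, rfl, hJ, hc⟩ := hG.exists_normal_one hy
  have hT := h.natural_riemann.eq_of_jac_eq_one h0 hJ
  have hR : riemann G' 0 = riemann G (ψ 0) := by
    funext i j k l
    exact congrFun hT ![i, j, k, l]
  rw [← hR]
  have hG' := h.metric'
  have hs : ∀ a b i j, pderiv a (pderiv b fun z => G' z i j) 0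
      = pderiv a (pderiv b fun z => G' z j i) 0 := fun a b i j =>
    pderiv_congr_on hG'.isOpen h0 fun z hz =>
      pderiv_congr_on hG'.isOpen hz fun w hw => hG'.symm hw i j
  have hp : ∀ a b i j, pderiv a (pderiv b fun z => G' z i j) 0
      = pderiv b (pderiv a fun z => G' z i j) 0 := fun a b i j =>
    pderiv_comm hG'.isOpen (hG'.smooth i j) h0
  refine ⟨fun i j k l => ?_, fun i j k l => ?_, fun i j k l => ?_⟩
  · simp only [hG'.riemann_of_christoffel_eq_zero h0 hc]
    ring
  · simp only [hG'.riemann_of_christoffel_eq_zero h0 hc]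
    rw [hs j l i k, hs j k i l, hs i l j k, hs i k j l, hp j l, hp i l, hp j k, hp i k]
    ring
  · simp only [hG'.riemann_of_christoffel_eq_zero h0 hc]
    linear_combination (1 / 2) * (hp k j l i + hp j l k i + hs l i k j + hp l k j i + hs j i l k
      + hs k i j l)

theorem ricci_symm (hG : IsMetricOn G U) (hy : y ∈ U) (i k : Fin 4) :
    ricci G y i k = ricci G y k i := by
  have hR := hG.isCurvatureLike_riemann hy
  simp only [ricci]
  rw [Finset.sum_comm]
  refine Finset.sum_congr rfl fun j _ => Finset.sum_congr rfl fun l _ => ?_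
  rw [hG.inv_symm hy l j, hR.pair i l k j]

theorem schouten_symm (hG : IsMetricOn G U) (hy : y ∈ U) (i k : Fin 4) :
    schouten G y i k = schouten G y k i := by
  simp only [schouten, hG.ricci_symm hy i k, hG.symm hy i k]

theorem smooth_schouten (hG : IsMetricOn G U) (i j : Fin 4) :
    ContDiffOn ℝ ∞ (fun y => schouten G y i j) U :=
  contDiffOn_const.mul ((hG.smooth_ricci i j).sub
    ((hG.smooth_scalarCurv.div_const 6).mul (hG.smooth i j)))

theorem isCurvatureLike_weyl (hG : IsMetricOn G U) (hy : y ∈ U) : IsCurvatureLike (weyl G y) := by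
  have h := (hG.isCurvatureLike_riemann hy).sub
    (isCurvatureLike_kulkarni (hG.schouten_symm hy) (hG.symm hy))
  have h1 : weyl G y = fun i j k l => riemann G y i j k l - kulkarni (schouten G y) (G y) i j k l := by
    funext i j k l
    exact weyl_eq G y i j k l
  rwa [h1]

theorem trace_metric (hG : IsMetricOn G U) (hy : y ∈ U) :
    ∑ i, ∑ k, invMetric G y i k * G y i k = 4 := by
  have h : ∀ i, ∑ k, invMetric G y i k * G y i k = 1 := fun i => by
    have := hG.sum_inv_mul hy i i
    simp only [hG.symm hy i]
    simpa using this
  simp [h]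

theorem trace_schouten (hG : IsMetricOn G U) (hy : y ∈ U) :
    ∑ i, ∑ k, invMetric G y i k * schouten G y i k = scalarCurv G y / 6 := by
  have h : ∑ i, ∑ k, invMetric G y i k * schouten G y i k = (1 / 2) *
      (scalarCurv G y - scalarCurv G y / 6 * ∑ i, ∑ k, invMetric G y i k * G y i k) := by
    conv_rhs => enter [2, 1]; rw [scalarCurv]
    simp only [Finset.mul_sum, ← Finset.sum_sub_distrib]
    refine Finset.sum_congr rfl fun i _ => Finset.sum_congr rfl fun k _ => ?_
    simp only [schouten]
    ring
  rw [h, hG.trace_metric hy]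
  ring

theorem ricci_eq_schouten (G : CoordMetric) (y : E4) (i k : Fin 4) :
    ricci G y i k = 2 * schouten G y i k + scalarCurv G y / 6 * G y i k := by
  simp only [schouten]
  ring

/-- The coefficient 2 is n - 2: one term contributes tr g = 4 copies of S, two others remove one
copy each, and the fourth gives the trace of S. -/
theorem trace_kulkarni (hG : IsMetricOn G U) (hy : y ∈ U) {S : Fin 4 → Fin 4 → ℝ}
    (hS : ∀ i j, S i j = S j i) (i k : Fin 4) :
    ∑ j, ∑ l, invMetric G y j l * kulkarni S (G y) i j k l
      = 2 * S i k + (∑ j, ∑ l, invMetric G y j l * S j l) * G y i k := by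
  have h1 : ∀ j, ∑ l, invMetric G y j l * kulkarni S (G y) i j k l
      = S i k * (∑ l, invMetric G y j l * G y j l)
        - (∑ l, invMetric G y j l * S l i) * G y j k
        + (∑ l, invMetric G y j l * S j l) * G y i k
        - S j k * (∑ l, invMetric G y j l * G y l i) := by
    intro j
    simp only [Finset.mul_sum, Finset.sum_mul, ← Finset.sum_sub_distrib, ← Finset.sum_add_distrib]
    refine Finset.sum_congr rfl fun l _ => ?_
    simp only [kulkarni]
    rw [hG.symm hy i l, hS i l]
    ring
  have h2 : ∑ j, (∑ l, invMetric G y j l * S l i) * G y j k = S i k := by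
    simp only [Finset.sum_mul]
    rw [Finset.sum_comm]
    have h3 : ∀ l, ∑ j, invMetric G y j l * S l i * G y j k
        = S l i * ∑ j, invMetric G y l j * G y j k := by
      intro l
      rw [Finset.mul_sum]
      refine Finset.sum_congr rfl fun j _ => ?_
      rw [hG.inv_symm hy j l]; ring
    simp [h3, hG.sum_inv_mul hy, hS k i]
  simp only [h1, Finset.sum_add_distrib, Finset.sum_sub_distrib, ← Finset.mul_sum, h2,
    hG.trace_metric hy, hG.sum_inv_mul hy]
  rw [← Finset.sum_mul]
  simp
  ring

theorem weyl_trace (hG : IsMetricOn G U) (hy : y ∈ U) (i k : Fin 4) :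
    ∑ j, ∑ l, invMetric G y j l * weyl G y i j k l = 0 := by
  have h : ∑ j, ∑ l, invMetric G y j l * weyl G y i j k l = ricci G y i k
      - ∑ j, ∑ l, invMetric G y j l * kulkarni (schouten G y) (G y) i j k l := by
    rw [ricci]
    simp only [weyl_eq, mul_sub, Finset.sum_sub_distrib]
  rw [h, hG.trace_kulkarni hy (hG.schouten_symm hy), hG.trace_schouten hy, ricci_eq_schouten]
  ring

/-! ### Differential identities for the curvature and the Weyl tensor. -/

/-- The second Bianchi identity. -/
theorem second_bianchi (hG : IsMetricOn G U) (hy : y ∈ U) (i j k l m : Fin 4) :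
    covDeriv G (riemannTensor G) y ![i, j, k, l, m] + covDeriv G (riemannTensor G) y ![i, j, l, m, k]
      + covDeriv G (riemannTensor G) y ![i, j, m, k, l] = 0 := by
  obtain ⟨ψ, G', V, h, h0, rfl, hJ, hc⟩ := hG.exists_normal_one hy
  have hsm : SmoothTensor (riemannTensor G) U := fun _ => hG.smooth_riemann _ _ _ _
  rw [← (h.natural_covDeriv h.natural_riemann hsm).eq_of_jac_eq_one h0 hJ]
  have hG' := h.metric'
  have hV := hG'.isOpen
  have hch := fun a b c => (hG'.smooth_christoffel a b c).diffAt hV h0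
  have hpc := fun d a b c => (contDiffOn_pderiv (i := d) hV (hG'.smooth_christoffel a b c)).diffAt hV h0
  -- Derivatives of the products ΓΓ retain an undifferentiated factor and vanish at the origin. What
  -- remains are second derivatives of Γ, which cancel in the cyclic sum.
  have h1 : ∀ n j k l m, pderiv m (fun z => curvature G' z n j k l) 0
      = pderiv m (pderiv k fun z => christoffel G' z n l j) 0
        - pderiv m (pderiv l fun z => christoffel G' z n k j) 0 := by
    intro n j k l m
    simp only [curvature]
    have hq : ∀ a b c d e f, DifferentiableAt ℝ
        (fun z => christoffel G' z a b c * christoffel G' z d e f) 0 := fun a b c d e f =>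
      (hch a b c).fun_mul (hch d e f)
    rw [pderiv_add ((hpc _ _ _ _).fun_sub (hpc _ _ _ _))
      (DifferentiableAt.fun_sum fun p _ => (hq _ _ _ _ _ _).fun_sub (hq _ _ _ _ _ _)),
      pderiv_sub (hpc _ _ _ _) (hpc _ _ _ _),
      pderiv_sum fun p _ => (hq _ _ _ _ _ _).fun_sub (hq _ _ _ _ _ _)]
    have h2 : ∀ p, pderiv m (fun z => christoffel G' z n k p * christoffel G' z p l j
        - christoffel G' z n l p * christoffel G' z p k j) 0 = 0 := by
      intro p
      rw [pderiv_sub (hq _ _ _ _ _ _) (hq _ _ _ _ _ _), pderiv_mul (hch _ _ _) (hch _ _ _),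
        pderiv_mul (hch _ _ _) (hch _ _ _)]
      simp [hc]
    simp only [h2, Finset.sum_const_zero, add_zero]
  have h3 : ∀ i j k l m, covDeriv G' (riemannTensor G') 0 ![i, j, k, l, m]
      = ∑ n, G' 0 i n * pderiv m (fun z => curvature G' z n j k l) 0 := by
    intro i j k l m
    rw [covDeriv_eq_pderiv hc]
    show pderiv m (fun z => ∑ n, G' z i n * curvature G' z n j k l) 0 = _
    have hd1 := fun n => (hG'.smooth i n).diffAt hV h0
    have hd2 := fun n => (hG'.smooth_curvature n j k l).diffAt hV h0
    rw [pderiv_sum fun n _ => (hd1 n).fun_mul (hd2 n)]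
    refine Finset.sum_congr rfl fun n _ => ?_
    rw [pderiv_mul (hd1 n) (hd2 n), hG'.pderiv_metric_eq_zero h0 hc]
    ring
  rw [h3, h3, h3, ← Finset.sum_add_distrib, ← Finset.sum_add_distrib]
  refine Finset.sum_eq_zero fun n _ => ?_
  have hp : ∀ a b c d, pderiv a (pderiv b fun z => christoffel G' z n c d) 0
      = pderiv b (pderiv a fun z => christoffel G' z n c d) 0 := fun a b c d =>
    pderiv_comm hV (hG'.smooth_christoffel n c d) h0
  rw [h1, h1, h1, hp m k, hp l m, hp k l]
  ring

/-- The components `∇_m W_{ijkl}`. -/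
def _root_.WeakHarmonicWeyl.gradWeyl (G : CoordMetric) (m : Fin 4) (y : E4) (i j k l : Fin 4) : ℝ :=
  covDeriv G (weylTensor G) y ![i, j, k, l, m]

/-- The Schouten tensor as a covariant tensor field of rank two. -/
def _root_.WeakHarmonicWeyl.schoutenTensor (G : CoordMetric) : CoordTensor 2 :=
  fun y I => schouten G y (I 0) (I 1)

/-- The Cotton tensor `∇_m S_{ik} - ∇_k S_{im}`. -/
def _root_.WeakHarmonicWeyl.cotton (G : CoordMetric) (y : E4) (i k m : Fin 4) : ℝ :=
  covDeriv G (schoutenTensor G) y ![i, k, m] - covDeriv G (schoutenTensor G) y ![i, m, k]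

theorem _root_.WeakHarmonicWeyl.IsCoordChange.natural_schouten {ψ : E4 → E4} {G' : CoordMetric}
    {V : Set E4} (h : IsCoordChange ψ G' V G U) :
    IsNatural ψ V (schoutenTensor G') (schoutenTensor G) := by
  intro y hy
  have key := ((h.natural_ricci y hy).sub
    ((h.natural_metric y hy).const_mul (scalarCurv G' y / 6))).const_mul (1 / 2)
  intro I
  refine (key I).trans (Finset.sum_congr rfl fun K _ => ?_)
  rw [h.scalarCurv_eq hy]
  rfl

theorem pderiv_weyl (hG : IsMetricOn G U) (hy : y ∈ U)
    (hc : ∀ k i j, christoffel G y k i j = 0) (i j k l m : Fin 4) :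
    pderiv m (fun z => weyl G z i j k l) y = pderiv m (fun z => riemann G z i j k l) y
      - kulkarni (fun a b => pderiv m (fun z => schouten G z a b) y) (G y) i j k l := by
  have hU := hG.isOpen
  have hr := (hG.smooth_riemann i j k l).diffAt hU hy
  have hs := fun a b => (hG.smooth_schouten a b).diffAt hU hy
  have hg := fun a b => (hG.smooth a b).diffAt hU hy
  have hsg := fun a b c d => (hs a b).fun_mul (hg c d)
  simp only [weyl_eq, kulkarni]
  rw [pderiv_sub hr ((((hsg _ _ _ _).fun_sub (hsg _ _ _ _)).fun_add (hsg _ _ _ _)).fun_sub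
      (hsg _ _ _ _)),
    pderiv_sub (((hsg _ _ _ _).fun_sub (hsg _ _ _ _)).fun_add (hsg _ _ _ _)) (hsg _ _ _ _),
    pderiv_add ((hsg _ _ _ _).fun_sub (hsg _ _ _ _)) (hsg _ _ _ _),
    pderiv_sub (hsg _ _ _ _) (hsg _ _ _ _)]
  simp only [pderiv_mul (hs _ _) (hg _ _), hG.pderiv_metric_eq_zero hy hc]
  ring

/-- The second Bianchi identity for the Weyl tensor. -/
theorem weyl_bianchi (hG : IsMetricOn G U) (hy : y ∈ U) (i j k l m : Fin 4) :
    gradWeyl G m y i j k l + gradWeyl G k y i j l m + gradWeyl G l y i j m k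
      = - (cotton G y i k m * G y j l + cotton G y i l k * G y j m + cotton G y i m l * G y j k
        - (cotton G y j k m * G y i l + cotton G y j l k * G y i m + cotton G y j m l * G y i k)) := by
  obtain ⟨ψ, G', V, h, h0, rfl, hJ, hc⟩ := hG.exists_normal_one hy
  have hG' := h.metric'
  have hW := (h.natural_covDeriv h.natural_weyl hG.smooth_weylTensor).eq_of_jac_eq_one h0 hJ
  have hS := (h.natural_covDeriv h.natural_schouten fun _ => hG.smooth_schouten _ _).eq_of_jac_eq_one
    h0 hJ
  have hg : ∀ i j, G' 0 i j = G (ψ 0) i j := fun i j =>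
    congrFun (h.natural_metric.eq_of_jac_eq_one h0 hJ) ![i, j]
  have h1 : ∀ i k m, cotton G (ψ 0) i k m = cotton G' 0 i k m := fun i k m => by
    simp only [cotton, hS]
  have h2 : ∀ m i j k l, gradWeyl G m (ψ 0) i j k l = gradWeyl G' m 0 i j k l := fun m i j k l => by
    simp only [gradWeyl, hW]
  have h3 : ∀ m i j k l, gradWeyl G' m 0 i j k l
      = covDeriv G' (riemannTensor G') 0 ![i, j, k, l, m]
        - kulkarni (fun a b => pderiv m (fun z => schouten G' z a b) 0) (G' 0) i j k l := by
    intro m i j k l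
    rw [gradWeyl, covDeriv_eq_pderiv hc, covDeriv_eq_pderiv hc]
    exact hG'.pderiv_weyl h0 hc i j k l m
  have h4 : ∀ i k m, cotton G' 0 i k m = pderiv m (fun z => schouten G' z i k) 0
      - pderiv k (fun z => schouten G' z i m) 0 := by
    intro i k m
    rw [cotton, covDeriv_eq_pderiv hc, covDeriv_eq_pderiv hc]
    rfl
  -- The Riemann part vanishes by the second Bianchi identity; the cyclic sum of ∇S ∧ g contains
  -- only antisymmetrised derivatives of S, that is, the Cotton tensor.
  simp only [h1, h2, ← hg, h3, h4, kulkarni]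
  linear_combination hG'.second_bianchi h0 i j k l m

/-- Where the Christoffel symbols vanish ∇W is the partial derivative of W, and linear identities
with constant coefficients survive differentiation. -/
theorem isCurvatureLike_gradWeyl (hG : IsMetricOn G U) (hy : y ∈ U) (m : Fin 4) :
    IsCurvatureLike (gradWeyl G m y) := by
  obtain ⟨ψ, G', V, h, h0, rfl, hJ, hc⟩ := hG.exists_normal_one hy
  have hG' := h.metric'
  have hW := (h.natural_covDeriv h.natural_weyl hG.smooth_weylTensor).eq_of_jac_eq_one h0 hJ
  have h2 : gradWeyl G m (ψ 0) = fun i j k l => pderiv m (fun z => weyl G' z i j k l) 0 := by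
    funext i j k l
    rw [gradWeyl, ← hW, covDeriv_eq_pderiv hc]
    rfl
  have hd := fun i j k l => (hG'.smooth_weyl i j k l).diffAt hG'.isOpen h0
  rw [h2]
  refine ⟨fun i j k l => ?_, fun i j k l => ?_, fun i j k l => ?_⟩
  · rw [pderiv_congr_on hG'.isOpen h0 fun z hz => (hG'.isCurvatureLike_weyl hz).anti i j k l,
      pderiv_neg]
  · exact pderiv_congr_on hG'.isOpen h0 fun z hz => (hG'.isCurvatureLike_weyl hz).pair i j k l
  · rw [← pderiv_add (hd _ _ _ _) (hd _ _ _ _),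
      ← pderiv_add ((hd _ _ _ _).fun_add (hd _ _ _ _)) (hd _ _ _ _),
      pderiv_congr_on hG'.isOpen h0 fun z hz => (hG'.isCurvatureLike_weyl hz).cyclic i j k l,
      pderiv_const]

theorem gradWeyl_trace (hG : IsMetricOn G U) (hy : y ∈ U) (m i k : Fin 4) :
    ∑ j, ∑ l, invMetric G y j l * gradWeyl G m y i j k l = 0 := by
  obtain ⟨ψ, G', V, h, h0, rfl, hJ, hc⟩ := hG.exists_normal_one hy
  have hG' := h.metric'
  have hW := (h.natural_covDeriv h.natural_weyl hG.smooth_weylTensor).eq_of_jac_eq_one h0 hJ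
  have hi : ∀ i j, invMetric G (ψ 0) i j = invMetric G' 0 i j := fun i j => by
    have hg : G' 0 = G (ψ 0) := by
      ext i j
      exact congrFun (h.natural_metric.eq_of_jac_eq_one h0 hJ) ![i, j]
    simp only [invMetric, hg]
  have h2 : ∀ i j k l, gradWeyl G m (ψ 0) i j k l = pderiv m (fun z => weyl G' z i j k l) 0 := by
    intro i j k l
    rw [gradWeyl, ← hW, covDeriv_eq_pderiv hc]
    rfl
  have hd := fun i j k l => (hG'.smooth_weyl i j k l).diffAt hG'.isOpen h0
  have hdi := fun i j => (hG'.smooth_inv i j).diffAt hG'.isOpen h0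
  have h3 : pderiv m (fun z => ∑ j, ∑ l, invMetric G' z j l * weyl G' z i j k l) 0 = 0 := by
    rw [pderiv_congr_on hG'.isOpen h0 fun z hz => hG'.weyl_trace hz i k, pderiv_const]
  rw [pderiv_sum fun j _ => DifferentiableAt.fun_sum fun l _ => (hdi _ _).fun_mul (hd _ _ _ _)] at h3
  rw [← h3]
  refine Finset.sum_congr rfl fun j _ => ?_
  rw [pderiv_sum fun l _ => (hdi _ _).fun_mul (hd _ _ _ _)]
  refine Finset.sum_congr rfl fun l _ => ?_
  rw [pderiv_mul (hdi _ _) (hd _ _ _ _), hG'.pderiv_inv_eq_zero h0 hc, hi, h2]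
  ring

end IsMetricOn

/-! ### Algebra of Weyl tensors in dimension four. -/

/-- An algebraic Weyl tensor in an orthonormal frame. -/
structure IsWeylLike (W : Fin 4 → Fin 4 → Fin 4 → Fin 4 → ℝ) : Prop extends IsCurvatureLike W where
  trace : ∀ i k, ∑ j, W i j k j = 0

/-- In dimension four, an algebraic Weyl tensor is determined by ten of its components. -/
theorem IsWeylLike.normal_form {W : Fin 4 → Fin 4 → Fin 4 → Fin 4 → ℝ} (h : IsWeylLike W) :
    (∀ i k l, W i i k l = 0) ∧ (∀ i j k, W i j k k = 0) ∧
    (∀ k l, W 1 0 k l = - W 0 1 k l ∧ W 2 0 k l = - W 0 2 k l ∧ W 3 0 k l = - W 0 3 k l ∧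
      W 2 1 k l = - W 1 2 k l ∧ W 3 1 k l = - W 1 3 k l ∧ W 3 2 k l = - W 2 3 k l) ∧
    (∀ i j, W i j 1 0 = - W i j 0 1 ∧ W i j 2 0 = - W i j 0 2 ∧ W i j 3 0 = - W i j 0 3 ∧
      W i j 2 1 = - W i j 1 2 ∧ W i j 3 1 = - W i j 1 3 ∧ W i j 3 2 = - W i j 2 3) ∧
    (W 0 2 0 1 = W 0 1 0 2 ∧ W 0 3 0 1 = W 0 1 0 3 ∧ W 0 3 0 2 = W 0 2 0 3 ∧
      W 0 3 0 3 = - W 0 1 0 1 - W 0 2 0 2 ∧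
      W 0 1 1 3 = - W 0 2 2 3 ∧ W 0 1 1 2 = W 0 3 2 3 ∧ W 0 3 1 3 = - W 0 2 1 2 ∧
      W 0 3 1 2 = - W 0 1 2 3 + W 0 2 1 3) ∧
    (W 2 3 2 3 = W 0 1 0 1 ∧ W 1 3 1 3 = W 0 2 0 2 ∧ W 1 2 1 2 = - W 0 1 0 1 - W 0 2 0 2 ∧
      W 1 3 2 3 = - W 0 1 0 2 ∧ W 1 2 2 3 = W 0 1 0 3 ∧ W 1 2 1 3 = - W 0 2 0 3 ∧
      W 2 3 1 3 = - W 0 1 0 2 ∧ W 2 3 1 2 = W 0 1 0 3 ∧ W 1 3 1 2 = - W 0 2 0 3) ∧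
    (W 2 3 0 1 = W 0 1 2 3 ∧ W 1 3 0 1 = - W 0 2 2 3 ∧ W 1 2 0 1 = W 0 3 2 3 ∧
      W 2 3 0 2 = W 0 2 2 3 ∧ W 1 3 0 2 = W 0 2 1 3 ∧ W 1 2 0 2 = W 0 2 1 2 ∧
      W 2 3 0 3 = W 0 3 2 3 ∧ W 1 3 0 3 = - W 0 2 1 2 ∧ W 1 2 0 3 = - W 0 1 2 3 + W 0 2 1 3) := by
  have ha := h.anti
  have hb := h.anti'
  have hp := h.pair
  have hz : ∀ i k l, W i i k l = 0 := fun i k l => by linarith [ha i i k l]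
  have hz' : ∀ i j k, W i j k k = 0 := fun i j k => by linarith [hb i j k k]
  have ht := h.trace
  simp only [Fin.sum_univ_four] at ht
  have t00 := ht 0 0
  have t11 := ht 1 1
  have t22 := ht 2 2
  have t33 := ht 3 3
  have t01 := ht 0 1
  have t02 := ht 0 2
  have t03 := ht 0 3
  have t12 := ht 1 2
  have t13 := ht 1 3
  have t23 := ht 2 3
  have n1 : ∀ k l, W 1 0 k l = - W 0 1 k l ∧ W 2 0 k l = - W 0 2 k l ∧ W 3 0 k l = - W 0 3 k l ∧
      W 2 1 k l = - W 1 2 k l ∧ W 3 1 k l = - W 1 3 k l ∧ W 3 2 k l = - W 2 3 k l :=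
    fun k l => ⟨ha _ _ _ _, ha _ _ _ _, ha _ _ _ _, ha _ _ _ _, ha _ _ _ _, ha _ _ _ _⟩
  have n2 : ∀ i j, W i j 1 0 = - W i j 0 1 ∧ W i j 2 0 = - W i j 0 2 ∧ W i j 3 0 = - W i j 0 3 ∧
      W i j 2 1 = - W i j 1 2 ∧ W i j 3 1 = - W i j 1 3 ∧ W i j 3 2 = - W i j 2 3 :=
    fun k l => ⟨hb _ _ _ _, hb _ _ _ _, hb _ _ _ _, hb _ _ _ _, hb _ _ _ _, hb _ _ _ _⟩
  simp only [hz, hz', n1, n2] at t00 t11 t22 t33 t01 t02 t03 t12 t13 t23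
  have c := h.cyclic 0 1 2 3
  have c2 := (n2 0 2).2.2.2.2.1
  have c3 := hp 0 1 0 2
  have c4 := hp 0 1 0 3
  have c5 := hp 0 2 0 3
  have c6 := hp 0 1 2 3
  have c7 := hp 0 1 1 3
  have c8 := hp 0 1 1 2
  have c9 := hp 0 2 2 3
  have c10 := hp 0 2 1 3
  have c11 := hp 0 2 1 2
  have c12 := hp 0 3 2 3
  have c13 := hp 0 3 1 3
  have c14 := hp 0 3 1 2
  have c15 := hp 2 3 1 3
  have c16 := hp 2 3 1 2
  have c17 := hp 1 3 1 2
  -- The remaining equalities are linear consequences of the ten trace conditions, one cyclic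
  -- identity and the pair symmetries.
  refine ⟨hz, hz', n1, n2, ?_, ?_, ?_⟩ <;> refine ⟨?_, ?_, ?_, ?_, ?_, ?_, ?_, ?_⟩
  all_goals try refine ⟨?_, ?_⟩
  all_goals linarith

/-- In dimension four, the two cubic invariants of a Weyl tensor are proportional. -/
theorem IsWeylLike.cubic {W : Fin 4 → Fin 4 → Fin 4 → Fin 4 → ℝ} (h : IsWeylLike W) :
    ∑ i, ∑ j, ∑ k, ∑ l, W i j k l * ∑ p, ∑ m, W p i m k * W p j l m
      = - (1 / 2) * ∑ i, ∑ j, ∑ k, ∑ l, W i j k l * ∑ p, ∑ q, W i j p q * W k l p q := by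
  obtain ⟨h1, h2, h3, h4, h5, h6, h7⟩ := h.normal_form
  simp only [Fin.sum_univ_four]
  simp only [h1, h2, h3, h4, h5, h6, h7, zero_mul, mul_zero, add_zero, zero_add]
  ring

/-- The Kronecker symbol. -/
def kron (i j : Fin 4) : ℝ := if i = j then 1 else 0

section WeylAlgebra

variable {W : Fin 4 → Fin 4 → Fin 4 → Fin 4 → ℝ} {S : Fin 4 → Fin 4 → ℝ}

/-- The factor W_{ijpm} sees only the part of W_{plmk} antisymmetric in p, m, which the cyclic
identity identifies with -½ W_{pmkl}. The verification is nevertheless by components. -/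
theorem IsWeylLike.cubic' (h : IsWeylLike W) :
    ∑ i, ∑ j, ∑ k, ∑ l, W i j k l * ∑ p, ∑ m, W p l m k * W i j p m
      = - (1 / 2) * ∑ i, ∑ j, ∑ k, ∑ l, W i j k l * ∑ p, ∑ q, W i j p q * W k l p q := by
  obtain ⟨h1, h2, h3, h4, h5, h6, h7⟩ := h.normal_form
  simp only [Fin.sum_univ_four]
  simp only [h1, h2, h3, h4, h5, h6, h7, zero_mul, mul_zero, add_zero, zero_add]
  ring

theorem symm_normal_form (hS : ∀ i j, S i j = S j i) :
    S 1 0 = S 0 1 ∧ S 2 0 = S 0 2 ∧ S 3 0 = S 0 3 ∧ S 2 1 = S 1 2 ∧ S 3 1 = S 1 3 ∧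
      S 3 2 = S 2 3 :=
  ⟨hS _ _, hS _ _, hS _ _, hS _ _, hS _ _, hS _ _⟩

/-- In dimension four a quadratic contraction of W with two free indices is a multiple of the
identity, so only the trace of S can appear here and in the next two lemmas. -/
theorem IsWeylLike.kulkarni_one (h : IsWeylLike W) (hS : ∀ i j, S i j = S j i) :
    ∑ i, ∑ j, ∑ k, ∑ l, W i j k l * ∑ p, ∑ m, kulkarni S kron p i m k * W p j l m
      = (1 / 4) * (∑ i, S i i) * ∑ p, ∑ i, ∑ j, ∑ k, W p i j k * W p i j k := by
  obtain ⟨h1, h2, h3, h4, h5, h6, h7⟩ := h.normal_form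
  have hs := symm_normal_form hS
  simp only [Fin.sum_univ_four]
  simp (decide := true) only [kulkarni, kron, if_true, if_false, h1, h2, h3, h4, h5, h6, h7, hs,
    zero_mul, mul_zero, add_zero, zero_add, sub_zero, zero_sub, mul_one, sub_self]
  ring

theorem IsWeylLike.kulkarni_three (h : IsWeylLike W) (hS : ∀ i j, S i j = S j i) :
    ∑ i, ∑ j, ∑ k, ∑ l, W i j k l * ∑ p, ∑ m, kulkarni S kron p l m k * W i j p m
      = - (1 / 2) * (∑ i, S i i) * ∑ p, ∑ i, ∑ j, ∑ k, W p i j k * W p i j k := by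
  obtain ⟨h1, h2, h3, h4, h5, h6, h7⟩ := h.normal_form
  have hs := symm_normal_form hS
  simp only [Fin.sum_univ_four]
  simp (decide := true) only [kulkarni, kron, if_true, if_false, h1, h2, h3, h4, h5, h6, h7, hs,
    zero_mul, mul_zero, add_zero, zero_add, sub_zero, zero_sub, mul_one, sub_self]
  ring

theorem IsWeylLike.kulkarni_four (h : IsWeylLike W) (hS : ∀ i j, S i j = S j i) :
    ∑ i, ∑ j, ∑ k, ∑ l, W i j k l * ∑ p, ∑ m, kulkarni S kron p m m k * W i j l p
      = (3 / 2) * (∑ i, S i i) * ∑ p, ∑ i, ∑ j, ∑ k, W p i j k * W p i j k := by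
  obtain ⟨h1, h2, h3, h4, h5, h6, h7⟩ := h.normal_form
  have hs := symm_normal_form hS
  simp only [Fin.sum_univ_four]
  simp (decide := true) only [kulkarni, kron, if_true, if_false, h1, h2, h3, h4, h5, h6, h7, hs,
    zero_mul, mul_zero, add_zero, zero_add, sub_zero, zero_sub, mul_one, sub_self]
  ring

/-- Antisymmetry of W in its first pair interchanges i and j, so the curvature terms of the first
two slots coincide. -/
theorem IsWeylLike.swap_pairs (h : IsWeylLike W) (T : Fin 4 → Fin 4 → Fin 4 → Fin 4 → ℝ) :
    ∑ i, ∑ j, ∑ k, ∑ l, W i j k l * ∑ p, ∑ m, T p j m k * W i p l m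
      = ∑ i, ∑ j, ∑ k, ∑ l, W i j k l * ∑ p, ∑ m, T p i m k * W p j l m := by
  rw [Finset.sum_comm]
  refine Finset.sum_congr rfl fun i _ => Finset.sum_congr rfl fun j _ =>
    Finset.sum_congr rfl fun k _ => Finset.sum_congr rfl fun l _ => ?_
  rw [h.anti j i, neg_mul, ← mul_neg, ← Finset.sum_neg_distrib]
  congr 1
  refine Finset.sum_congr rfl fun p _ => ?_
  rw [← Finset.sum_neg_distrib]
  refine Finset.sum_congr rfl fun m _ => ?_
  rw [h.anti j p]
  ring

theorem IsWeylLike.trace_inner (h : IsWeylLike W) (j l : Fin 4) : ∑ i, W i j i l = 0 := by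
  rw [← h.trace j l]
  exact Finset.sum_congr rfl fun i _ => by rw [h.anti, h.anti']; ring

theorem IsWeylLike.trace_outer (h : IsWeylLike W) (j k : Fin 4) : ∑ i, W i j k i = 0 := by
  have h1 := h.trace_inner j k
  rw [← neg_eq_zero, ← Finset.sum_neg_distrib] at h1
  rw [← h1]
  exact Finset.sum_congr rfl fun i _ => h.anti' _ _ _ _

/-- The curvature term in the Weitzenböck formula for the Weyl tensor. -/
theorem IsWeylLike.curvature_term (h : IsWeylLike W) (hS : ∀ i j, S i j = S j i)
    {R : Fin 4 → Fin 4 → Fin 4 → Fin 4 → ℝ}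
    (hR : ∀ i j k l, R i j k l = W i j k l + kulkarni S kron i j k l) :
    2 * ∑ i, ∑ j, ∑ k, ∑ l, W i j k l * ∑ m, ∑ p, (R p i m k * W p j l m + R p j m k * W i p l m
        + R p l m k * W i j p m + R p m m k * W i j l p)
      = 3 * (∑ i, S i i) * (∑ p, ∑ i, ∑ j, ∑ k, W p i j k * W p i j k)
        - 3 * ∑ i, ∑ j, ∑ k, ∑ l, W i j k l * ∑ p, ∑ q, W i j p q * W k l p q := by
  have h4 : ∀ p k, ∑ m, W p m m k = 0 := fun p k => by
    rw [← neg_eq_zero, ← Finset.sum_neg_distrib, ← h.trace p k]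
    exact Finset.sum_congr rfl fun m _ => (h.anti' _ _ _ _).symm
  have h5 : ∑ i, ∑ j, ∑ k, ∑ l, W i j k l * ∑ p, ∑ m, W p m m k * W i j l p = 0 := by
    simp only [← Finset.sum_mul, h4]
    simp
  have e : ∑ i, ∑ j, ∑ k, ∑ l, W i j k l * ∑ m, ∑ p, (R p i m k * W p j l m + R p j m k * W i p l m
        + R p l m k * W i j p m + R p m m k * W i j l p)
      = (∑ i, ∑ j, ∑ k, ∑ l, W i j k l * ∑ p, ∑ m, R p i m k * W p j l m)
      + (∑ i, ∑ j, ∑ k, ∑ l, W i j k l * ∑ p, ∑ m, R p j m k * W i p l m)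
      + (∑ i, ∑ j, ∑ k, ∑ l, W i j k l * ∑ p, ∑ m, R p l m k * W i j p m)
      + ∑ i, ∑ j, ∑ k, ∑ l, W i j k l * ∑ p, ∑ m, R p m m k * W i j l p := by
    simp only [← Finset.sum_add_distrib, ← mul_add]
    refine Finset.sum_congr rfl fun i _ => Finset.sum_congr rfl fun j _ =>
      Finset.sum_congr rfl fun k _ => Finset.sum_congr rfl fun l _ => ?_
    rw [Finset.sum_comm]
  rw [e, h.swap_pairs]
  simp only [hR, add_mul, Finset.sum_add_distrib, mul_add]
  -- The coefficients add up to 2(¼ + ¼ - ½ + 3/2) = 3 for the trace of S and to 2 · 3 · (-½) = -3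
  -- for the cubic term; the Weyl part of the fourth term is a trace and vanishes.
  rw [h.kulkarni_one hS, h.kulkarni_three hS, h.kulkarni_four hS, h.cubic, h.cubic', h5]
  ring

end WeylAlgebra

section Contractions

variable {W : Fin 4 → Fin 4 → Fin 4 → Fin 4 → ℝ} (f : Fin 4 → Fin 4 → ℝ)

/-- Terms of the Bianchi identity carrying a metric factor contract W to a trace. This lemma and the
next three discard them. -/
theorem IsWeylLike.sum_kron_jl (h : IsWeylLike W) :
    ∑ i, ∑ j, ∑ k, ∑ l, W i j k l * (f i k * kron j l) = 0 := by
  refine Finset.sum_eq_zero fun i _ => ?_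
  rw [Finset.sum_comm]
  refine Finset.sum_eq_zero fun k _ => ?_
  have h6 : ∀ j, ∑ l, W i j k l * (f i k * kron j l) = f i k * W i j k j := by
    intro j; simp [kron]; ring
  simp only [h6, ← Finset.mul_sum, h.trace, mul_zero]

theorem IsWeylLike.sum_kron_jk (h : IsWeylLike W) :
    ∑ i, ∑ j, ∑ k, ∑ l, W i j k l * (f i l * kron j k) = 0 := by
  rw [← neg_eq_zero, ← h.sum_kron_jl f]
  simp only [← Finset.sum_neg_distrib]
  refine Finset.sum_congr rfl fun i _ => Finset.sum_congr rfl fun j _ => ?_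
  rw [Finset.sum_comm]
  refine Finset.sum_congr rfl fun k _ => Finset.sum_congr rfl fun l _ => ?_
  rw [h.anti']; ring

theorem IsWeylLike.sum_kron_il (h : IsWeylLike W) :
    ∑ i, ∑ j, ∑ k, ∑ l, W i j k l * (f j k * kron i l) = 0 := by
  rw [Finset.sum_comm]
  refine Finset.sum_eq_zero fun j _ => ?_
  rw [Finset.sum_comm]
  refine Finset.sum_eq_zero fun k _ => ?_
  have h6 : ∀ i, ∑ l, W i j k l * (f j k * kron i l) = f j k * W i j k i := by
    intro i; simp [kron]; ring
  simp only [h6, ← Finset.mul_sum, h.trace_outer, mul_zero]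

theorem IsWeylLike.sum_kron_ik (h : IsWeylLike W) :
    ∑ i, ∑ j, ∑ k, ∑ l, W i j k l * (f j l * kron i k) = 0 := by
  rw [← neg_eq_zero, ← h.sum_kron_il f]
  simp only [← Finset.sum_neg_distrib]
  refine Finset.sum_congr rfl fun i _ => Finset.sum_congr rfl fun j _ => ?_
  rw [Finset.sum_comm]
  refine Finset.sum_congr rfl fun k _ => Finset.sum_congr rfl fun l _ => ?_
  rw [h.anti']; ring

/-- The divergence of the Weyl tensor in terms of the Cotton tensor. -/
theorem divergence_eq_cotton {D : Fin 4 → Fin 4 → Fin 4 → Fin 4 → Fin 4 → ℝ}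
    {C : Fin 4 → Fin 4 → Fin 4 → ℝ} (hD : ∀ m, IsWeylLike fun i j k l => D i j k l m)
    (hC : ∀ i k m, C i k m = - C i m k)
    (hB : ∀ i j k l m, D i j k l m + D i j l m k + D i j m k l
      = - (C i k m * kron j l + C i l k * kron j m + C i m l * kron j k
        - (C j k m * kron i l + C j l k * kron i m + C j m l * kron i k))) (j k l : Fin 4) :
    ∑ s, D s j k l s = - C j k l := by
  have tr1 : ∀ i k m, ∑ j, D i j k j m = 0 := fun i k m => (hD m).trace i k
  have tr2 : ∀ j l m, ∑ i, D i j i l m = 0 := fun j l m => (hD m).trace_inner j l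
  have tr3 : ∀ j k m, ∑ i, D i j k i m = 0 := fun j k m => (hD m).trace_outer j k
  -- The trace of `C` is the error left by one contraction of the Bianchi identity. Contracting once
  -- more annihilates the left side, `D` being trace-free, and yields -4c = 0.
  let c : Fin 4 → ℝ := fun k => ∑ i, C i k i
  have h1 : ∀ j k l, ∑ s, D s j k l s = - C j k l - c k * kron j l + c l * kron j k := by
    intro j k l
    have h2 := Finset.sum_congr (s₁ := Finset.univ) rfl fun i _ => hB i j k l i
    simp only [Finset.sum_add_distrib, tr3, tr2, Finset.sum_neg_distrib, Finset.sum_sub_distrib,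
      ← Finset.sum_mul] at h2
    have h3 : ∑ i, C i i l = - c l := by
      simp only [c, ← Finset.sum_neg_distrib]
      exact Finset.sum_congr rfl fun i _ => hC _ _ _
    have h4 : ∑ i, C i l k * kron j i = C j l k := by simp [kron]
    have h5 : ∑ i, C j k i * kron i l = C j k l := by simp [kron]
    have h6 : ∑ i, C j i l * kron i k = C j k l := by simp [kron]
    have h7 : ∑ i : Fin 4, C j l k * kron i i = 4 * C j l k := by simp [kron]
    have h8 : ∑ i, C i k i = c k := rfl
    rw [h3, h4, h5, h6, h7, h8] at h2
    linarith [hC j l k]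
  have h2 : ∀ k, c k = 0 := by
    intro k
    have h3 : ∑ j, ∑ s, D s j k j s = 0 := by
      rw [Finset.sum_comm]
      exact Finset.sum_eq_zero fun s _ => tr1 s k s
    simp only [h1, Finset.sum_add_distrib, Finset.sum_sub_distrib, Finset.sum_neg_distrib,
      ← Finset.mul_sum] at h3
    have h4 : ∑ i, kron i i = 4 := by simp [kron]
    have h5 : ∑ j, c j * kron j k = c k := by simp [kron]
    rw [h4, h5] at h3
    have h6 : ∑ i, C i k i = c k := rfl
    rw [h6] at h3
    linarith
  rw [h1, h2, h2]
  ring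

end Contractions

set_option maxHeartbeats 1000000 in
/-- The algebraic part of the Weitzenböck formula for the Weyl tensor at a point, in an orthonormal
frame: `D i j k l m n` stands for `∇_n ∇_m W_{ijkl}` and `C i k m n` for the covariant derivative of
the Cotton tensor. -/
theorem weitzenboeck_algebra {W R : Fin 4 → Fin 4 → Fin 4 → Fin 4 → ℝ} {S : Fin 4 → Fin 4 → ℝ}
    {D : Fin 4 → Fin 4 → Fin 4 → Fin 4 → Fin 4 → Fin 4 → ℝ} {C : Fin 4 → Fin 4 → Fin 4 → Fin 4 → ℝ}
    (hW : IsWeylLike W) (hS : ∀ i j, S i j = S j i)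
    (hR : ∀ i j k l, R i j k l = W i j k l + kulkarni S kron i j k l)
    (hD : ∀ m n, IsWeylLike fun i j k l => D i j k l m n)
    (hC : ∀ i k m n, C i k m n = - C i m k n)
    (hB : ∀ i j k l m n, D i j k l m n + D i j l m k n + D i j m k l n
      = - (C i k m n * kron j l + C i l k n * kron j m + C i m l n * kron j k
        - (C j k m n * kron i l + C j l k n * kron i m + C j m l n * kron i k)))
    (hcomm : ∀ i j k l m n, D i j k l m n - D i j k l n m
      = - ∑ p, (R p i n m * W p j k l + R p j n m * W i p k l + R p k n m * W i j p l
        + R p l n m * W i j k p)) :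
    ∑ i, ∑ j, ∑ k, ∑ l, W i j k l * ∑ m, D i j k l m m
      = 3 * (∑ i, S i i) * (∑ p, ∑ i, ∑ j, ∑ k, W p i j k * W p i j k)
        - 3 * (∑ i, ∑ j, ∑ k, ∑ l, W i j k l * ∑ p, ∑ q, W i j p q * W k l p q)
        + 4 * ∑ t, ∑ i, ∑ j, ∑ k, W t i j k * ∑ s, D s i j k s t := by
  -- `E` is ∇δW; below, `A` = ⟨W, ΔW⟩, `Q` = ⟨W, ∇δW⟩, and `X` pairs W with ∇_m∇_k W_{ijlm}. From A
  -- + 2X = 2Q and X = -Q - K, where K is the curvature term, one gets A = 4Q + 2K.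
  set E : Fin 4 → Fin 4 → Fin 4 → Fin 4 → ℝ := fun i j k n => ∑ s, D s i j k s n with hE
  have hEC : ∀ j k l n, E j k l n = - C j k l n := fun j k l n =>
    divergence_eq_cotton (D := fun i j k l m => D i j k l m n) (C := fun i k m => C i k m n)
      (fun m => hD m n) (fun i k m => hC i k m n) (fun i j k l m => hB i j k l m n) j k l
  set A := ∑ i, ∑ j, ∑ k, ∑ l, W i j k l * ∑ m, D i j k l m m with hA
  set X := ∑ i, ∑ j, ∑ k, ∑ l, W i j k l * ∑ m, D i j l m k m with hX
  set Q := ∑ t, ∑ i, ∑ j, ∑ k, W t i j k * E i j k t with hQ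
  -- Exchanging k and l in both antisymmetric factors identifies the third Bianchi term with the
  -- second.
  have hX' : ∑ i, ∑ j, ∑ k, ∑ l, W i j k l * ∑ m, D i j m k l m = X := by
    refine Finset.sum_congr rfl fun i _ => Finset.sum_congr rfl fun j _ => ?_
    rw [Finset.sum_comm]
    refine Finset.sum_congr rfl fun k _ => Finset.sum_congr rfl fun l _ => ?_
    rw [hW.anti', neg_mul, ← mul_neg, ← Finset.sum_neg_distrib]
    congr 1
    exact Finset.sum_congr rfl fun m _ => by rw [(hD k m).anti' i j m l, neg_neg]
  -- the Bianchi identity, contracted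
  have hBW : A + X + X = 2 * Q := by
    have h1 : A + X + ∑ i, ∑ j, ∑ k, ∑ l, W i j k l * ∑ m, D i j m k l m
        = ∑ i, ∑ j, ∑ k, ∑ l, W i j k l * ∑ m,
          (D i j k l m m + D i j l m k m + D i j m k l m) := by
      simp only [hA, hX, ← Finset.sum_add_distrib, ← mul_add]
    rw [hX'] at h1
    rw [h1]
    simp only [hB]
    have hr : ∀ i j k l, ∑ m, - (C i k m m * kron j l + C i l k m * kron j m + C i m l m * kron j k
        - (C j k m m * kron i l + C j l k m * kron i m + C j m l m * kron i k))
        = - (∑ m, C i k m m) * kron j l - C i l k j - (∑ m, C i m l m) * kron j k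
          + (∑ m, C j k m m) * kron i l + C j l k i + (∑ m, C j m l m) * kron i k := by
      intro i j k l
      have h4 : ∑ m, C i l k m * kron j m = C i l k j := by simp [kron]
      have h5 : ∑ m, C j l k m * kron i m = C j l k i := by simp [kron]
      rw [← h4, ← h5]
      simp only [neg_mul, Finset.sum_mul, ← Finset.sum_neg_distrib, ← Finset.sum_add_distrib,
        ← Finset.sum_sub_distrib]
      exact Finset.sum_congr rfl fun m _ => by ring
    simp only [hr, mul_add, mul_sub, Finset.sum_add_distrib, Finset.sum_sub_distrib]
    have q1 : ∑ i, ∑ j, ∑ k, ∑ l, W i j k l * C j l k i = Q := by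
      simp only [hQ, hEC]
      exact Finset.sum_congr rfl fun i _ => Finset.sum_congr rfl fun j _ =>
        Finset.sum_congr rfl fun k _ => Finset.sum_congr rfl fun l _ => by rw [hC j k l i, neg_neg]
    have q2 : ∑ i, ∑ j, ∑ k, ∑ l, W i j k l * C i l k j = - Q := by
      rw [← q1, Finset.sum_comm]
      simp only [← Finset.sum_neg_distrib]
      refine Finset.sum_congr rfl fun i _ => Finset.sum_congr rfl fun j _ =>
        Finset.sum_congr rfl fun k _ => Finset.sum_congr rfl fun l _ => ?_
      rw [hW.anti]; ring
    rw [hW.sum_kron_jl fun i k => - ∑ m, C i k m m, hW.sum_kron_jk fun i l => ∑ m, C i m l m,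
      hW.sum_kron_il fun j k => ∑ m, C j k m m, hW.sum_kron_ik fun j l => ∑ m, C j m l m, q1, q2]
    ring
  -- Commuting the derivatives brings the contracted one next to W, producing -∇_k (δW)_{lij} by
  -- pair symmetry, plus one curvature term for each of the four slots.
  have hXQ : X = - Q - ∑ i, ∑ j, ∑ k, ∑ l, W i j k l * ∑ m, ∑ p, (R p i m k * W p j l m
        + R p j m k * W i p l m + R p l m k * W i j p m + R p m m k * W i j l p) := by
    have h1 : ∀ i j k l, ∑ m, D i j l m k m = - E l i j k - ∑ m, ∑ p, (R p i m k * W p j l m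
        + R p j m k * W i p l m + R p l m k * W i j p m + R p m m k * W i j l p) := by
      intro i j k l
      simp only [hE, ← Finset.sum_neg_distrib, ← Finset.sum_sub_distrib]
      refine Finset.sum_congr rfl fun m _ => ?_
      have h2 := hcomm i j l m k m
      have h3 : D i j l m m k = - D m l i j m k := by
        rw [(hD m k).pair i j l m, (hD m k).anti l m i j]
      rw [h3] at h2
      linarith
    simp only [hX, h1, mul_sub, Finset.sum_sub_distrib]
    congr 1
    have h4 : ∀ i j k l, W i j k l * - E l i j k = - (W k l i j * E l i j k) := fun i j k l => by
      rw [hW.pair]; ring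
    simp only [h4, Finset.sum_neg_distrib, hQ]
    congr 1
    rw [Finset.sum_congr rfl fun i _ => Finset.sum_comm, Finset.sum_comm]
    refine Finset.sum_congr rfl fun k _ => ?_
    rw [Finset.sum_congr rfl fun i _ => Finset.sum_comm, Finset.sum_comm]
  have := hW.curvature_term hS hR
  linarith

/-! ### Contractions in an orthonormal frame. -/

section Frames

variable {ι : Type*} [Fintype ι]

theorem prod_kron (I J : ι → Fin 4) : ∏ a, kron (I a) (J a) = if I = J then 1 else 0 := by
  by_cases h : I = J
  · subst h; simp [kron]
  · obtain ⟨a, ha⟩ := Function.ne_iff.1 h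
    rw [if_neg h]
    exact Finset.prod_eq_zero (Finset.mem_univ a) (by simp [kron, ha])

theorem pairing_one [DecidableEq ι] {h : Matrix (Fin 4) (Fin 4) ℝ} (hh : ∀ i j, h i j = kron i j)
    (T S : (ι → Fin 4) → ℝ) : pairing h T S = ∑ I, T I * S I := by
  simp [pairing, hh, prod_kron]

theorem raiseAll_one {G : CoordMetric} {y : E4} (hi : ∀ i j, invMetric G y i j = kron i j) {k : ℕ}
    (T : CoordTensor k) (I : Fin k → Fin 4) : raiseAll G T y I = T y I := by
  simp [raiseAll, hi, prod_kron]

theorem sum_kron_mul (f : Fin 4 → ℝ) (i : Fin 4) : ∑ j, kron i j * f j = f i := by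
  simp [kron]

theorem weylCubic_one {G : CoordMetric} {y : E4} (hi : ∀ i j, invMetric G y i j = kron i j) :
    weylCubic G y = ∑ i, ∑ j, ∑ k, ∑ l, weyl G y i j k l *
      ∑ p, ∑ q, weyl G y i j p q * weyl G y k l p q := by
  have h : ∀ i j p q, ∑ a, ∑ b, invMetric G y i a * invMetric G y j b * weyl G y a b p q
      = weyl G y i j p q := by
    intro i j p q
    simp only [hi, mul_assoc, ← Finset.mul_sum, sum_kron_mul]
  simp only [weylCubic, h, raiseAll_one hi, Finset.mul_sum]
  exact Finset.sum_congr rfl fun i _ => Finset.sum_congr rfl fun j _ =>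
    Finset.sum_congr rfl fun k _ => Finset.sum_congr rfl fun l _ =>
    Finset.sum_congr rfl fun p _ => Finset.sum_congr rfl fun q _ => mul_assoc _ _ _

end Frames

section Vectors

variable (i j k l m n p : Fin 4)

theorem snoc_four : (Fin.snoc (α := fun _ => Fin 4) ![i, j, k, l] m : Fin 5 → Fin 4)
    = ![i, j, k, l, m] := by
  ext a; fin_cases a <;> rfl

theorem update_four : Function.update ![i, j, k, l] 0 p = ![p, j, k, l] ∧
    Function.update ![i, j, k, l] 1 p = ![i, p, k, l] ∧
    Function.update ![i, j, k, l] 2 p = ![i, j, p, l] ∧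
    Function.update ![i, j, k, l] 3 p = ![i, j, k, p] := by
  refine ⟨?_, ?_, ?_, ?_⟩ <;> · ext a; fin_cases a <;> rfl

end Vectors

theorem coordLaplacian_congr {G : CoordMetric} {f g : E4 → ℝ} {U : Set E4} (hU : IsOpen U) {y : E4}
    (hy : y ∈ U) (h : ∀ z ∈ U, f z = g z) : coordLaplacian G f y = coordLaplacian G g y := by
  have h1 : ∀ k, ∀ z ∈ U, pderiv k f z = pderiv k g z := fun k z hz => pderiv_congr_on hU hz h
  simp only [coordLaplacian, h1 _ y hy]
  refine Finset.sum_congr rfl fun i _ => Finset.sum_congr rfl fun j _ => ?_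
  rw [pderiv_congr_on hU hy (h1 j)]

/-! ### The Weitzenböck formula. -/

namespace IsCurvatureLike

theorem pderiv {F : E4 → Fin 4 → Fin 4 → Fin 4 → Fin 4 → ℝ} {U : Set E4} (hU : IsOpen U) {y : E4}
    (hy : y ∈ U) (hs : ∀ i j k l, ContDiffOn ℝ ∞ (fun z => F z i j k l) U)
    (h : ∀ z ∈ U, IsCurvatureLike (F z)) (m : Fin 4) :
    IsCurvatureLike fun i j k l => WeakHarmonicWeyl.pderiv m (fun z => F z i j k l) y := by
  have hd := fun i j k l => (hs i j k l).diffAt hU hy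
  refine ⟨fun i j k l => ?_, fun i j k l => ?_, fun i j k l => ?_⟩
  · rw [pderiv_congr_on hU hy fun z hz => (h z hz).anti i j k l, pderiv_neg]
  · exact pderiv_congr_on hU hy fun z hz => (h z hz).pair i j k l
  · rw [← pderiv_add (hd _ _ _ _) (hd _ _ _ _),
      ← pderiv_add ((hd _ _ _ _).fun_add (hd _ _ _ _)) (hd _ _ _ _),
      pderiv_congr_on hU hy fun z hz => (h z hz).cyclic i j k l, pderiv_const]

end IsCurvatureLike

namespace IsMetricOn

variable {G : CoordMetric} {U : Set E4} {y : E4}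

theorem smooth_normSq (hG : IsMetricOn G U) {k : ℕ} {T : CoordTensor k} (hT : SmoothTensor T U) :
    ContDiffOn ℝ ∞ (normSq G T) U := hG.smooth_pairing hT hT

/-- The inverse metric is stationary at such a point, so the derivative falls on the two tensors
only. -/
theorem pderiv_pairing_of_christoffel_eq_zero (hG : IsMetricOn G U) (hy : y ∈ U)
    (hc : ∀ k i j, christoffel G y k i j = 0) {k : ℕ} {T S : CoordTensor k}
    (hT : SmoothTensor T U) (hS : SmoothTensor S U) (m : Fin 4) :
    pderiv m (fun z => pairing (G z)⁻¹ (T z) (S z)) y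
      = pairing (G y)⁻¹ (fun I => pderiv m (fun z => T z I) y) (S y)
        + pairing (G y)⁻¹ (T y) (fun I => pderiv m (fun z => S z I) y) := by
  have hU := hG.isOpen
  have dT := fun I => (hT I).diffAt hU hy
  have dS := fun I => (hS I).diffAt hU hy
  have di : ∀ i j, DifferentiableAt ℝ (fun z => (G z)⁻¹ i j) y :=
    fun i j => (hG.smooth_inv i j).diffAt hU hy
  have dp : ∀ I J : Fin k → Fin 4, DifferentiableAt ℝ (fun z => ∏ a, (G z)⁻¹ (I a) (J a)) y :=
    fun I J => (contDiffOn_prod fun a _ => hG.smooth_inv (I a) (J a)).diffAt hU hy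
  have zp : ∀ I J : Fin k → Fin 4, pderiv m (fun z => ∏ a, (G z)⁻¹ (I a) (J a)) y = 0 := by
    intro I J
    rw [pderiv_prod fun a _ => di (I a) (J a)]
    refine Finset.sum_eq_zero fun a _ => ?_
    have := hG.pderiv_inv_eq_zero hy hc m (I a) (J a)
    simp only [invMetric] at this
    rw [this, mul_zero]
  have ds : ∀ I : Fin k → Fin 4, DifferentiableAt ℝ
      (fun z => ∑ J, (∏ a, (G z)⁻¹ (I a) (J a)) * S z J) y := fun I =>
    DifferentiableAt.fun_sum fun J _ => (dp I J).fun_mul (dS J)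
  simp only [pairing]
  rw [pderiv_sum fun I _ => (dT I).fun_mul (ds I), ← Finset.sum_add_distrib]
  refine Finset.sum_congr rfl fun I _ => ?_
  rw [pderiv_mul (dT I) (ds I), pderiv_sum fun J _ => (dp I J).fun_mul (dS J)]
  simp only [pderiv_mul (dp I _) (dS _), zp, zero_mul, zero_add]

/-- The Levi-Civita connection is compatible with the induced scalar product of tensors. -/
theorem pderiv_normSq (hG : IsMetricOn G U) (hy : y ∈ U) {k : ℕ} {T : CoordTensor k}
    (hT : SmoothTensor T U) (m : Fin 4) :
    pderiv m (normSq G T) y = 2 * pairing (G y)⁻¹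
      (fun I => covDeriv G T y (Fin.snoc (α := fun _ => Fin 4) I m)) (T y) := by
  obtain ⟨ψ, G', V, h, h0, rfl, hJ, hc⟩ := hG.exists_normal_one hy
  let T' : CoordTensor k := fun z I => ∑ K, (∏ a, jac ψ z (K a) (I a)) * T (ψ z) K
  have hn : IsNatural ψ V T' T := fun _ _ _ => rfl
  have hT' : SmoothTensor T' V := fun I => ContDiffOn.sum fun K _ =>
    (contDiffOn_prod fun a _ => h.smooth_jac _ _).mul (h.smooth_comp (hT K))
  have h1 : pderiv m (normSq G' T') 0 = pderiv m (normSq G T) (ψ 0) := by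
    rw [pderiv_congr_on h.metric'.isOpen h0 fun z hz => h.normSq_eq hn hz,
      h.pderiv_comp h0 (hG.smooth_normSq hT), hJ]
    simp [Matrix.one_apply]
  have h2 := (h.natural_covDeriv hn hT).eq_of_jac_eq_one h0 hJ
  have h3 := hn.eq_of_jac_eq_one h0 hJ
  have hg : G' 0 = G (ψ 0) := by
    ext i j
    exact congrFun (h.natural_metric.eq_of_jac_eq_one h0 hJ) ![i, j]
  rw [← h1, ← h2, ← h3, ← hg]
  refine (h.metric'.pderiv_pairing_of_christoffel_eq_zero h0 hc hT' hT' m).trans ?_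
  have h4 : ∀ A B : (Fin k → Fin 4) → ℝ, pairing (G' 0)⁻¹ A B = pairing (G' 0)⁻¹ B A := by
    intro A B
    simp only [pairing, Finset.mul_sum]
    rw [Finset.sum_comm]
    refine Finset.sum_congr rfl fun I _ => Finset.sum_congr rfl fun J _ => ?_
    have : ∏ a, (G' 0)⁻¹ (J a) (I a) = ∏ a, (G' 0)⁻¹ (I a) (J a) :=
      Finset.prod_congr rfl fun a _ => h.metric'.inv_symm h0 _ _
    rw [this]; ring
  rw [h4 (T' 0), ← two_mul]
  simp only [covDeriv_eq_pderiv hc, Fin.snoc_last, Fin.snoc_castSucc]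

/-- The Christoffel symbols vanish at the point but their first derivatives do not; these carry the
curvature into the commutator. -/
theorem covDeriv_covDeriv (hG : IsMetricOn G U) (hy : y ∈ U)
    (hc : ∀ k i j, christoffel G y k i j = 0) {k : ℕ} {T : CoordTensor k} (hT : SmoothTensor T U)
    (J : Fin (k + 2) → Fin 4) (I : Fin k → Fin 4) (m n : Fin 4)
    (hJ : J = Fin.snoc (α := fun _ => Fin 4) (Fin.snoc (α := fun _ => Fin 4) I m) n) :
    covDeriv G (covDeriv G T) y J = pderiv n (pderiv m fun z => T z I) y
      - ∑ a, ∑ p, pderiv n (fun z => christoffel G z p m (I a)) y * T y (Function.update I a p) := by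
  have hU := hG.isOpen
  have dc := fun a b c => (hG.smooth_christoffel a b c).diffAt hU hy
  have dT := fun I => (hT I).diffAt hU hy
  have dp := fun m => (contDiffOn_pderiv (i := m) hU (hT I)).diffAt hU hy
  subst hJ
  rw [covDeriv_eq_pderiv hc]
  simp only [Fin.snoc_last, Fin.snoc_castSucc, covDeriv]
  rw [pderiv_sub (dp m) (DifferentiableAt.fun_sum fun a _ => DifferentiableAt.fun_sum fun p _ =>
      (dc _ _ _).fun_mul (dT _)),
    pderiv_sum fun a _ => DifferentiableAt.fun_sum fun p _ => (dc _ _ _).fun_mul (dT _)]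
  congr 1
  refine Finset.sum_congr rfl fun a _ => ?_
  rw [pderiv_sum fun p _ => (dc _ _ _).fun_mul (dT _)]
  refine Finset.sum_congr rfl fun p _ => ?_
  rw [pderiv_mul (dc _ _ _) (dT _), hc, zero_mul, add_zero]

theorem isWeylLike_weyl (hG : IsMetricOn G U) (hy : y ∈ U)
    (hi : ∀ i j, invMetric G y i j = kron i j) : IsWeylLike (weyl G y) := by
  refine ⟨hG.isCurvatureLike_weyl hy, fun i k => ?_⟩
  have := hG.weyl_trace hy i k
  simpa only [hi, sum_kron_mul] using this

/-- The components `∇_n ∇_m W_{ijkl}`. -/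
def _root_.WeakHarmonicWeyl.hessWeyl (G : CoordMetric) (y : E4) (i j k l m n : Fin 4) : ℝ :=
  covDeriv G (covDeriv G (weylTensor G)) y ![i, j, k, l, m, n]

theorem _root_.WeakHarmonicWeyl.hessWeyl_eq (hc : ∀ k i j, christoffel G y k i j = 0)
    (i j k l m n : Fin 4) :
    hessWeyl G y i j k l m n = pderiv n (fun z => gradWeyl G m z i j k l) y := by
  rw [hessWeyl, covDeriv_eq_pderiv hc]
  rfl

theorem smooth_gradWeyl (hG : IsMetricOn G U) (m i j k l : Fin 4) :
    ContDiffOn ℝ ∞ (fun z => gradWeyl G m z i j k l) U :=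
  hG.smooth_covDeriv hG.smooth_weylTensor _

/-- The symmetries and the trace condition of ∇_m W hold on all of `U`, not just at `y`, and can
therefore be differentiated once more. -/
theorem isWeylLike_hessWeyl (hG : IsMetricOn G U) (hy : y ∈ U)
    (hc : ∀ k i j, christoffel G y k i j = 0) (hi : ∀ i j, invMetric G y i j = kron i j)
    (m n : Fin 4) : IsWeylLike fun i j k l => hessWeyl G y i j k l m n := by
  simp only [hessWeyl_eq hc]
  refine ⟨IsCurvatureLike.pderiv hG.isOpen hy (fun i j k l => hG.smooth_gradWeyl m i j k l)
    (fun z hz => hG.isCurvatureLike_gradWeyl hz m) n, fun i k => ?_⟩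
  have hd := fun i j k l => (hG.smooth_gradWeyl m i j k l).diffAt hG.isOpen hy
  have hdi := fun i j => (hG.smooth_inv i j).diffAt hG.isOpen hy
  have h3 : pderiv n (fun z => ∑ j, ∑ l, invMetric G z j l * gradWeyl G m z i j k l) y = 0 := by
    rw [pderiv_congr_on hG.isOpen hy fun z hz => hG.gradWeyl_trace hz m i k, pderiv_const]
  rw [pderiv_sum fun j _ => DifferentiableAt.fun_sum fun l _ => (hdi _ _).fun_mul (hd _ _ _ _)] at h3
  rw [← h3]
  refine Finset.sum_congr rfl fun j _ => ?_
  rw [pderiv_sum fun l _ => (hdi _ _).fun_mul (hd _ _ _ _)]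
  simp only [pderiv_mul (hdi _ _) (hd _ _ _ _), hG.pderiv_inv_eq_zero hy hc, hi, zero_mul, zero_add,
    sum_kron_mul]

/-- The second partial derivatives of W cancel, and the derivatives of the Christoffel symbols
combine into the curvature, once per slot. -/
theorem hessWeyl_comm (hG : IsMetricOn G U) (hy : y ∈ U)
    (hc : ∀ k i j, christoffel G y k i j = 0) (hg : ∀ i j, G y i j = kron i j)
    (i j k l m n : Fin 4) :
    hessWeyl G y i j k l m n - hessWeyl G y i j k l n m
      = - ∑ p, (riemann G y p i n m * weyl G y p j k l + riemann G y p j n m * weyl G y i p k l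
        + riemann G y p k n m * weyl G y i j p l + riemann G y p l n m * weyl G y i j k p) := by
  have hR : ∀ p i m n, riemann G y p i n m = pderiv n (fun z => christoffel G z p m i) y
      - pderiv m (fun z => christoffel G z p n i) y := by
    intro p i m n
    simp only [riemann, hg, sum_kron_mul, curvature_of_christoffel_eq_zero hc]
  have key : ∀ m n, hessWeyl G y i j k l m n = pderiv n (pderiv m fun z => weyl G z i j k l) y
      - ∑ p, (pderiv n (fun z => christoffel G z p m i) y * weyl G y p j k l
        + pderiv n (fun z => christoffel G z p m j) y * weyl G y i p k l
        + pderiv n (fun z => christoffel G z p m k) y * weyl G y i j p l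
        + pderiv n (fun z => christoffel G z p m l) y * weyl G y i j k p) := by
    intro m n
    rw [hessWeyl, hG.covDeriv_covDeriv hy hc hG.smooth_weylTensor _ ![i, j, k, l] m n
      (by ext a; fin_cases a <;> rfl)]
    simp only [Fin.sum_univ_four (fun a : Fin 4 => ∑ p, _), update_four, Finset.sum_add_distrib]
    rfl
  rw [key, key, pderiv_comm hG.isOpen (hG.smooth_weyl i j k l) hy (i := n) (j := m)]
  simp only [hR, sub_mul, Finset.sum_add_distrib, Finset.sum_sub_distrib]
  ring

theorem smooth_cotton (hG : IsMetricOn G U) (i k m : Fin 4) :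
    ContDiffOn ℝ ∞ (fun z => cotton G z i k m) U :=
  (hG.smooth_covDeriv (T := schoutenTensor G) (fun _ => hG.smooth_schouten _ _) _).sub
    (hG.smooth_covDeriv (T := schoutenTensor G) (fun _ => hG.smooth_schouten _ _) _)

theorem hessWeyl_bianchi (hG : IsMetricOn G U) (hy : y ∈ U)
    (hc : ∀ k i j, christoffel G y k i j = 0) (hg : ∀ i j, G y i j = kron i j)
    (i j k l m n : Fin 4) :
    hessWeyl G y i j k l m n + hessWeyl G y i j l m k n + hessWeyl G y i j m k l n
      = - (pderiv n (fun z => cotton G z i k m) y * kron j l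
          + pderiv n (fun z => cotton G z i l k) y * kron j m
          + pderiv n (fun z => cotton G z i m l) y * kron j k
        - (pderiv n (fun z => cotton G z j k m) y * kron i l
          + pderiv n (fun z => cotton G z j l k) y * kron i m
          + pderiv n (fun z => cotton G z j m l) y * kron i k)) := by
  have hU := hG.isOpen
  have dW := fun m i j k l => (hG.smooth_gradWeyl m i j k l).diffAt hU hy
  have dC := fun i k m => (hG.smooth_cotton i k m).diffAt hU hy
  have dG := fun i j => (hG.smooth i j).diffAt hU hy
  have dp := fun i k m a b => (dC i k m).fun_mul (dG a b)
  simp only [hessWeyl_eq hc]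
  rw [← pderiv_add (dW _ _ _ _ _) (dW _ _ _ _ _),
    ← pderiv_add ((dW _ _ _ _ _).fun_add (dW _ _ _ _ _)) (dW _ _ _ _ _),
    pderiv_congr_on hU hy fun z hz => hG.weyl_bianchi hz i j k l m, pderiv_neg,
    pderiv_sub (((dp _ _ _ _ _).fun_add (dp _ _ _ _ _)).fun_add (dp _ _ _ _ _))
      (((dp _ _ _ _ _).fun_add (dp _ _ _ _ _)).fun_add (dp _ _ _ _ _)),
    pderiv_add ((dp _ _ _ _ _).fun_add (dp _ _ _ _ _)) (dp _ _ _ _ _),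
    pderiv_add (dp _ _ _ _ _) (dp _ _ _ _ _),
    pderiv_add ((dp _ _ _ _ _).fun_add (dp _ _ _ _ _)) (dp _ _ _ _ _),
    pderiv_add (dp _ _ _ _ _) (dp _ _ _ _ _)]
  simp only [pderiv_mul (dC _ _ _) (dG _ _), hG.pderiv_metric_eq_zero hy hc, hg, mul_zero, add_zero]

theorem gradDivWeyl_eq (hG : IsMetricOn G U) (hy : y ∈ U)
    (hc : ∀ k i j, christoffel G y k i j = 0) (hi : ∀ i j, invMetric G y i j = kron i j)
    (t i j k : Fin 4) : gradDivWeyl G y ![t, i, j, k] = ∑ s, hessWeyl G y s i j k s t := by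
  have hU := hG.isOpen
  have dW := fun m i j k l => (hG.smooth_gradWeyl m i j k l).diffAt hU hy
  have dI := fun i j => (hG.smooth_inv i j).diffAt hU hy
  have h : gradDivWeyl G y ![t, i, j, k]
      = pderiv t (fun z => ∑ a, ∑ s, invMetric G z a s * gradWeyl G s z a i j k) y := by
    rw [gradDivWeyl, covDeriv_eq_pderiv hc]
    rfl
  rw [h, pderiv_sum fun a _ => DifferentiableAt.fun_sum fun s _ =>
    (dI _ _).fun_mul (dW _ _ _ _ _)]
  refine Finset.sum_congr rfl fun a _ => ?_
  rw [pderiv_sum fun s _ => (dI _ _).fun_mul (dW _ _ _ _ _)]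
  simp only [pderiv_mul (dI _ _) (dW _ _ _ _ _), hG.pderiv_inv_eq_zero hy hc, hi, zero_mul, zero_add,
    sum_kron_mul, hessWeyl_eq hc]

/-- In this frame ½Δ|W|² = |∇W|² + ⟨W, ΔW⟩ (`hlap`), and `weitzenboeck_algebra` evaluates the last
term. Since tr S = R/6, the summand 3 (tr S)|W|² is ½R|W|². -/
theorem weitzenboeck_orthonormal (hG : IsMetricOn G U) (hy : y ∈ U)
    (hc : ∀ k i j, christoffel G y k i j = 0) (h1 : G y = 1) :
    (1 / 2) * coordLaplacian G (normSq G (weylTensor G)) y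
      = normSq G (covDeriv G (weylTensor G)) y
        + (1 / 2) * scalarCurv G y * normSq G (weylTensor G) y - 3 * weylCubic G y
        + 4 * pairing (G y)⁻¹ (weylTensor G y) (gradDivWeyl G y) := by
  have hU := hG.isOpen
  have hg : ∀ i j, G y i j = kron i j := fun i j => by rw [h1]; simp [kron, Matrix.one_apply]
  have hi : ∀ i j, invMetric G y i j = kron i j := fun i j => by
    simp [invMetric, h1, kron, Matrix.one_apply]
  have hi' : ∀ i j, (G y)⁻¹ i j = kron i j := hi
  have hg' : (fun i j => G y i j) = kron := by funext i j; exact hg i j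
  have key := weitzenboeck_algebra (W := weyl G y) (R := riemann G y) (S := schouten G y)
    (D := hessWeyl G y) (C := fun i k m n => pderiv n (fun z => cotton G z i k m) y)
    (hG.isWeylLike_weyl hy hi) (hG.schouten_symm hy)
    (fun i j k l => by
      rw [weyl_eq, show kulkarni (schouten G y) (G y) i j k l = kulkarni (schouten G y) kron i j k l
        from congrFun (congrFun (congrFun (congrFun (congrArg (kulkarni (schouten G y)) hg') i) j) k) l]
      ring)
    (hG.isWeylLike_hessWeyl hy hc hi)
    (fun i k m n => by
      rw [← pderiv_neg]
      congr 1
      funext z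
      simp only [cotton]
      ring)
    (hG.hessWeyl_bianchi hy hc hg) (hG.hessWeyl_comm hy hc hg)
  have htr : ∑ i, schouten G y i i = scalarCurv G y / 6 := by
    have := hG.trace_schouten hy
    simpa only [hi, sum_kron_mul] using this
  have hN : normSq G (weylTensor G) y
      = ∑ p, ∑ i, ∑ j, ∑ k, weyl G y p i j k * weyl G y p i j k := by
    rw [normSq_eq_pairing, pairing_one hi', sum_fin_four]
    rfl
  have hQ : pairing (G y)⁻¹ (weylTensor G y) (gradDivWeyl G y)
      = ∑ t, ∑ i, ∑ j, ∑ k, weyl G y t i j k * ∑ s, hessWeyl G y s i j k s t := by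
    rw [pairing_one hi', sum_fin_four]
    simp only [hG.gradDivWeyl_eq hy hc hi]
    rfl
  have hlap : (1 / 2) * coordLaplacian G (normSq G (weylTensor G)) y
      = (∑ i, ∑ j, ∑ k, ∑ l, weyl G y i j k l * ∑ m, hessWeyl G y i j k l m m)
        + normSq G (covDeriv G (weylTensor G)) y := by
    have hs := hG.smooth_weylTensor
    have hD := hG.smooth_covDeriv hs
    have h2 : ∀ m, pderiv m (pderiv m (normSq G (weylTensor G))) y
        = 2 * ∑ I : Fin 4 → Fin 4, (pderiv m (fun z => covDeriv G (weylTensor G) z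
            (Fin.snoc (α := fun _ => Fin 4) I m)) y * weylTensor G y I
          + covDeriv G (weylTensor G) y (Fin.snoc (α := fun _ => Fin 4) I m)
            * covDeriv G (weylTensor G) y (Fin.snoc (α := fun _ => Fin 4) I m)) := by
      intro m
      rw [pderiv_congr_on hU hy fun z hz => hG.pderiv_normSq hz hs m, pderiv_const_mul,
        hG.pderiv_pairing_of_christoffel_eq_zero hy hc (T := fun z I => covDeriv G (weylTensor G) z
          (Fin.snoc (α := fun _ => Fin 4) I m)) (fun I => hD _) hs,
        pairing_one hi', pairing_one hi', ← Finset.sum_add_distrib]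
      congr 1
      refine Finset.sum_congr rfl fun I _ => ?_
      congr 2
      rw [covDeriv_eq_pderiv hc]
      simp only [Fin.snoc_last, Fin.snoc_castSucc]
    have h3 : coordLaplacian G (normSq G (weylTensor G)) y
        = ∑ m, pderiv m (pderiv m (normSq G (weylTensor G))) y := by
      simp only [coordLaplacian, hi, hc, zero_mul, Finset.sum_const_zero, sub_zero, sum_kron_mul]
    have h4 : ∀ (i j k l m : Fin 4), pderiv m (fun z => covDeriv G (weylTensor G) z
        (Fin.snoc (α := fun _ => Fin 4) ![i, j, k, l] m)) y = hessWeyl G y i j k l m m := by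
      intro i j k l m
      rw [hessWeyl_eq hc, snoc_four]
      rfl
    rw [h3, normSq_eq_pairing, pairing_one hi', sum_fin_snoc]
    simp only [h2, ← Finset.mul_sum, Finset.sum_add_distrib]
    rw [← mul_assoc, mul_add, Finset.sum_comm (s := (Finset.univ : Finset (Fin 4))),
      Finset.sum_comm (s := (Finset.univ : Finset (Fin 4))), sum_fin_four]
    have h5 : ∀ i j k l, weyl G y i j k l * ∑ m, hessWeyl G y i j k l m m
        = ∑ m, hessWeyl G y i j k l m m * weylTensor G y ![i, j, k, l] := by
      intro i j k l
      rw [mul_comm, Finset.sum_mul]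
      rfl
    simp only [h4, h5]
    norm_num
  rw [hlap, key, htr, hN, weylCubic_one hi, hQ]
  ring

/-- The Weitzenböck formula for the Weyl tensor in dimension four. -/
theorem weitzenboeck (hG : IsMetricOn G U) (hy : y ∈ U) :
    (1 / 2) * coordLaplacian G (normSq G (weylTensor G)) y
      = normSq G (covDeriv G (weylTensor G)) y
        + (1 / 2) * scalarCurv G y * normSq G (weylTensor G) y - 3 * weylCubic G y
        + 4 * pairing (G y)⁻¹ (weylTensor G y) (gradDivWeyl G y) := by
  obtain ⟨ψ, G', V, h, h0, rfl, hJ, hc⟩ := hG.exists_orthonormal hy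
  have hs := hG.smooth_weylTensor
  have key := h.metric'.weitzenboeck_orthonormal h0 hc hJ
  rw [h.normSq_eq (h.natural_covDeriv h.natural_weyl hs) h0, h.normSq_eq h.natural_weyl h0,
    h.scalarCurv_eq h0, h.weylCubic_eq h0, h.pairing_eq h.natural_weyl h.natural_gradDivWeyl h0,
    coordLaplacian_congr h.metric'.isOpen h0 fun z hz => h.normSq_eq h.natural_weyl hz,
    h.coordLaplacian_eq (hG.smooth_normSq hs) h0] at key
  exact key

end IsMetricOn

/-! ### Conformal change of the metric, in coordinates -/

/-- The metric `e^{2u} G`. -/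
def conformal (G : CoordMetric) (u : E4 → ℝ) : CoordMetric := fun y => Real.exp (2 * u y) • G y

theorem conformal_apply (G : CoordMetric) (u : E4 → ℝ) (y : E4) (i j : Fin 4) :
    conformal G u y i j = Real.exp (2 * u y) * G y i j := rfl

/-- The difference `δ^k_i u_j + δ^k_j u_i - g_{ij} u^k` of the Christoffel symbols of two conformal
metrics. -/
def conformalDiff (G : CoordMetric) (u : E4 → ℝ) (y : E4) (k i j : Fin 4) : ℝ :=
  kron k i * pderiv j u y + kron k j * pderiv i u y
    - G y i j * ∑ l, invMetric G y k l * pderiv l u y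

namespace IsMetricOn

variable {G : CoordMetric} {U : Set E4} {y : E4} {u : E4 → ℝ}

theorem invMetric_conformal (hG : IsMetricOn G U) (hy : y ∈ U) (i j : Fin 4) :
    invMetric (conformal G u) y i j = (Real.exp (2 * u y))⁻¹ * invMetric G y i j := by
  have h := Matrix.inv_smul' (A := G y) (Units.mk0 _ (Real.exp_pos (2 * u y)).ne')
    (hG.isUnit_det hy)
  have h2 : (WeakHarmonicWeyl.conformal G u y)⁻¹ = (Real.exp (2 * u y))⁻¹ • (G y)⁻¹ := h
  rw [invMetric, h2]
  rfl

theorem conformal (hG : IsMetricOn G U) (hu : ContDiffOn ℝ ∞ u U) :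
    IsMetricOn (conformal G u) U where
  isOpen := hG.isOpen
  smooth i j := ((contDiffOn_const.mul hu).exp).mul (hG.smooth i j)
  posDef y hy := (hG.posDef y hy).smul (Real.exp_pos _)

theorem pderiv_conformal (hG : IsMetricOn G U) (hu : ContDiffOn ℝ ∞ u U) (hy : y ∈ U)
    (k i j : Fin 4) : pderiv k (fun z => WeakHarmonicWeyl.conformal G u z i j) y
      = Real.exp (2 * u y) * (2 * pderiv k u y * G y i j + pderiv k (fun z => G z i j) y) := by
  have du := hu.diffAt hG.isOpen hy
  simp only [conformal_apply]
  rw [pderiv_mul (du.const_mul 2).exp ((hG.smooth i j).diffAt hG.isOpen hy),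
    pderiv_exp (du.const_mul 2), pderiv_const_mul]
  ring

theorem christoffel_conformal (hG : IsMetricOn G U) (hu : ContDiffOn ℝ ∞ u U) (hy : y ∈ U)
    (k i j : Fin 4) : christoffel (WeakHarmonicWeyl.conformal G u) y k i j
      = christoffel G y k i j + conformalDiff G u y k i j := by
  have he : Real.exp (2 * u y) ≠ 0 := (Real.exp_pos _).ne'
  have h1 : ∀ i, ∑ l, invMetric G y k l * G y i l = kron k i := fun i => by
    have := hG.sum_inv_mul hy k i
    simp only [hG.symm hy _ i] at this
    rw [this]; rfl
  have h2 : christoffel G y k i j + conformalDiff G u y k i j = (1 / 2) * ∑ l, invMetric G y k l *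
      ((pderiv i (fun z => G z j l) y + pderiv j (fun z => G z i l) y - pderiv l (fun z => G z i j) y)
        + 2 * (pderiv i u y * G y j l + pderiv j u y * G y i l - pderiv l u y * G y i j)) := by
    simp only [christoffel, conformalDiff, ← h1, Finset.mul_sum, Finset.sum_mul,
      ← Finset.sum_add_distrib, ← Finset.sum_sub_distrib]
    exact Finset.sum_congr rfl fun l _ => by ring
  rw [h2, christoffel]
  congr 1
  refine Finset.sum_congr rfl fun l _ => ?_
  simp only [hG.invMetric_conformal hy, hG.pderiv_conformal hu hy]
  field_simp
  ring

/-- The tensor `∇²u - du ⊗ du + ½ |du|² g`. -/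
def _root_.WeakHarmonicWeyl.conformalHess (G : CoordMetric) (u : E4 → ℝ) (y : E4) (i j : Fin 4) : ℝ :=
  pderiv i (pderiv j u) y - pderiv i u y * pderiv j u y
    + (1 / 2) * (∑ k, ∑ l, invMetric G y k l * pderiv k u y * pderiv l u y) * G y i j

theorem conformalHess_symm (hG : IsMetricOn G U) (hu : ContDiffOn ℝ ∞ u U) (hy : y ∈ U)
    (i j : Fin 4) : conformalHess G u y i j = conformalHess G u y j i := by
  simp only [conformalHess]
  rw [pderiv_comm hG.isOpen hu hy, hG.symm hy i j]
  ring

/-- The curvature of ∇ + C is the old one plus the antisymmetrised ∇C and C∘C. The first supplies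
the Hessian of u, the second du ⊗ du and |du|²g. Since `conformalHess` uses plain second
derivatives, it is the invariant expression only where the Christoffel symbols vanish. -/
theorem riemann_conformal (hG : IsMetricOn G U) (hu : ContDiffOn ℝ ∞ u U) (hy : y ∈ U)
    (hc : ∀ k i j, christoffel G y k i j = 0) (i j k l : Fin 4) :
    riemann (WeakHarmonicWeyl.conformal G u) y i j k l = Real.exp (2 * u y) *
      (riemann G y i j k l - kulkarni (conformalHess G u y) (G y) i j k l) := by
  have hU := hG.isOpen
  have dΓ := fun a b c => (hG.smooth_christoffel a b c).diffAt hU hy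
  have du := fun i => (contDiffOn_pderiv (i := i) hU hu).diffAt hU hy
  have di := fun i j => (hG.smooth_inv i j).diffAt hU hy
  have dg := fun i j => (hG.smooth i j).diffAt hU hy
  have ds : ∀ m, DifferentiableAt ℝ (fun z => ∑ p, invMetric G z m p * pderiv p u z) y := fun m =>
    DifferentiableAt.fun_sum fun p _ => (di _ _).fun_mul (du _)
  have dC : ∀ m i j, DifferentiableAt ℝ (fun z => conformalDiff G u z m i j) y := fun m i j =>
    (((du j).const_mul _).fun_add ((du i).const_mul _)).fun_sub ((dg i j).fun_mul (ds m))
  have hd : ∀ k m l j, pderiv k (fun z => christoffel (WeakHarmonicWeyl.conformal G u) z m l j) y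
      = pderiv k (fun z => christoffel G z m l j) y + (kron m l * pderiv k (pderiv j u) y
        + kron m j * pderiv k (pderiv l u) y
        - G y l j * ∑ p, invMetric G y m p * pderiv k (pderiv p u) y) := by
    intro k m l j
    rw [pderiv_congr_on hU hy fun z hz => hG.christoffel_conformal hu hz m l j,
      pderiv_add (dΓ _ _ _) (dC _ _ _)]
    congr 1
    simp only [conformalDiff]
    rw [pderiv_sub (((du _).const_mul _).fun_add ((du _).const_mul _)) ((dg _ _).fun_mul (ds m)),
      pderiv_add ((du _).const_mul _) ((du _).const_mul _), pderiv_const_mul, pderiv_const_mul,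
      pderiv_mul (dg _ _) (ds m), hG.pderiv_metric_eq_zero hy hc,
      pderiv_sum fun p _ => (di _ _).fun_mul (du _)]
    simp only [pderiv_mul (di _ _) (du _), hG.pderiv_inv_eq_zero hy hc, zero_mul, zero_add]
  have hΓ : ∀ m i j, christoffel (WeakHarmonicWeyl.conformal G u) y m i j
      = conformalDiff G u y m i j := fun m i j => by
    rw [hG.christoffel_conformal hu hy, hc, zero_add]
  set v : Fin 4 → ℝ := fun m => ∑ p, invMetric G y m p * pderiv p u y with hv
  set w : Fin 4 → ℝ := fun i => pderiv i u y with hw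
  set H : Fin 4 → Fin 4 → ℝ := fun i j => pderiv i (pderiv j u) y with hH
  have lower : ∀ f : Fin 4 → ℝ, ∀ i, ∑ m, G y i m * ∑ p, invMetric G y m p * f p = f i := by
    intro f i
    simp only [Finset.mul_sum]
    rw [Finset.sum_comm]
    simp only [← mul_assoc, ← Finset.sum_mul, hG.sum_mul_inv hy]
    simp
  have lowk : ∀ i l, ∑ m, G y i m * kron m l = G y i l := fun i l => by simp [kron]
  have hquad : ∀ m k l j, ∑ p, conformalDiff G u y m k p * conformalDiff G u y p l j
      = kron m k * (2 * w l * w j - G y l j * ∑ p, w p * v p)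
        + (kron m l * w j + kron m j * w l - G y l j * v m) * w k
        - (G y k l * w j + G y k j * w l - G y l j * w k) * v m := by
    intro m k l j
    have e1 : ∀ p, conformalDiff G u y m k p * conformalDiff G u y p l j
        = kron m k * (w p * (kron p l * w j + kron p j * w l) - G y l j * (w p * v p))
          + kron m p * (w k * (kron p l * w j + kron p j * w l - G y l j * v p))
          - v m * (G y k p * kron p l * w j + G y k p * kron p j * w l - G y l j * (G y k p * v p)) := by
      intro p
      simp only [conformalDiff, hv, hw]
      ring
    have e2 : ∑ p, G y k p * v p = w k := lower _ _
    have e3 : ∀ l, ∑ p, w p * kron p l = w l := fun l => by simp [kron]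
    have e4 : ∑ p, w p * (kron p l * w j + kron p j * w l) = 2 * w l * w j := by
      have : ∀ p, w p * (kron p l * w j + kron p j * w l)
          = (w p * kron p l) * w j + (w p * kron p j) * w l := fun p => by ring
      simp only [this, Finset.sum_add_distrib, ← Finset.sum_mul, e3]
      ring
    have e5 : ∑ p, (G y k p * kron p l * w j + G y k p * kron p j * w l - G y l j * (G y k p * v p))
        = G y k l * w j + G y k j * w l - G y l j * w k := by
      simp only [Finset.sum_add_distrib, Finset.sum_sub_distrib, ← Finset.sum_mul, ← Finset.mul_sum,
        lowk, e2]
    rw [Finset.sum_congr rfl fun p _ => e1 p]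
    rw [Finset.sum_sub_distrib, Finset.sum_add_distrib, sum_kron_mul, ← Finset.mul_sum,
      ← Finset.mul_sum, e5, Finset.sum_sub_distrib, e4, ← Finset.mul_sum]
    ring
  have hnorm : ∑ k, ∑ l, invMetric G y k l * pderiv k u y * pderiv l u y = ∑ p, w p * v p := by
    refine Finset.sum_congr rfl fun p _ => ?_
    simp only [hv, hw, Finset.mul_sum]
    exact Finset.sum_congr rfl fun l _ => by ring
  have hcurv : ∀ m, curvature (WeakHarmonicWeyl.conformal G u) y m j k l = curvature G y m j k l
      + (kron m l * (H k j - w k * w j + (1 / 2) * (∑ p, w p * v p) * G y k j)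
        - kron m k * (H l j - w l * w j + (1 / 2) * (∑ p, w p * v p) * G y l j)
        - G y l j * (∑ p, invMetric G y m p * (H k p - w k * w p)) 
        + G y k j * (∑ p, invMetric G y m p * (H l p - w l * w p))
        + (1 / 2) * (∑ p, w p * v p) * (kron m l * G y k j - kron m k * G y l j)) := by
    intro m
    have e1 : ∀ k, ∑ p, invMetric G y m p * (H k p - w k * w p)
        = ∑ p, invMetric G y m p * H k p - w k * v m := by
      intro k
      simp only [hv, mul_sub, Finset.sum_sub_distrib, Finset.mul_sum]
      congr 1
      exact Finset.sum_congr rfl fun p _ => by simp only [hw]; ring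
    rw [curvature_of_christoffel_eq_zero hc, curvature]
    simp only [hd, hΓ, Finset.sum_sub_distrib, hquad, e1]
    simp only [hH, pderiv_comm hU hu hy (i := k) (j := l), hG.symm hy k l]
    ring
  have e5 : ∀ k, ∑ m, G y i m * ∑ p, invMetric G y m p * (H k p - w k * w p)
      = H k i - w k * w i := fun k => lower _ _
  have e6 : riemann (WeakHarmonicWeyl.conformal G u) y i j k l = Real.exp (2 * u y) *
      ∑ m, G y i m * curvature (WeakHarmonicWeyl.conformal G u) y m j k l := by
    simp only [riemann, conformal_apply, Finset.mul_sum, mul_assoc]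
  rw [e6]
  congr 1
  have e7 : ∀ m, G y i m * curvature (WeakHarmonicWeyl.conformal G u) y m j k l
      = G y i m * curvature G y m j k l
        + (G y i m * kron m l) * (H k j - w k * w j + (∑ p, w p * v p) * G y k j)
        - (G y i m * kron m k) * (H l j - w l * w j + (∑ p, w p * v p) * G y l j)
        - G y l j * (G y i m * ∑ p, invMetric G y m p * (H k p - w k * w p))
        + G y k j * (G y i m * ∑ p, invMetric G y m p * (H l p - w l * w p)) := by
    intro m
    rw [hcurv]
    ring
  rw [Finset.sum_congr rfl fun m _ => e7 m, Finset.sum_add_distrib, Finset.sum_sub_distrib,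
    Finset.sum_sub_distrib, Finset.sum_add_distrib, ← Finset.sum_mul, ← Finset.sum_mul, lowk, lowk,
    ← Finset.mul_sum, ← Finset.mul_sum, e5, e5]
  have hs : ∀ i j, H i j = H j i := fun i j => pderiv_comm hU hu hy
  have hB : ∀ i j, conformalHess G u y i j
      = H i j - w i * w j + (1 / 2) * (∑ p, w p * v p) * G y i j := fun i j => by
    rw [conformalHess, hnorm]
  simp only [kulkarni, hB, riemann]
  rw [hs k i, hs l i, hs k j, hs l j, hG.symm hy k j, hG.symm hy l j]
  ring

/-- With B = `conformalHess`, the Schouten tensor changes to S - B. Hence S ∧ g absorbs the term B ∧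
g in the curvature, and only the factor e^{2u} remains. -/
theorem weyl_conformal_of_christoffel_eq_zero (hG : IsMetricOn G U) (hu : ContDiffOn ℝ ∞ u U)
    (hy : y ∈ U) (hc : ∀ k i j, christoffel G y k i j = 0) (i j k l : Fin 4) :
    weyl (WeakHarmonicWeyl.conformal G u) y i j k l = Real.exp (2 * u y) * weyl G y i j k l := by
  have he : Real.exp (2 * u y) ≠ 0 := (Real.exp_pos _).ne'
  have hB := hG.conformalHess_symm hu hy
  set t : ℝ := ∑ j, ∑ l, invMetric G y j l * conformalHess G u y j l with ht
  have h1 : ∀ i k, ricci (WeakHarmonicWeyl.conformal G u) y i k = ricci G y i k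
      - (2 * conformalHess G u y i k + t * G y i k) := by
    intro i k
    rw [ht, ← hG.trace_kulkarni hy hB, ricci, ricci]
    simp only [hG.invMetric_conformal hy, hG.riemann_conformal hu hy hc, ← Finset.sum_sub_distrib]
    refine Finset.sum_congr rfl fun j _ => Finset.sum_congr rfl fun l _ => ?_
    field_simp
  have h2 : scalarCurv (WeakHarmonicWeyl.conformal G u) y
      = (Real.exp (2 * u y))⁻¹ * (scalarCurv G y - 6 * t) := by
    have : ∀ i k, invMetric (WeakHarmonicWeyl.conformal G u) y i k
        * ricci (WeakHarmonicWeyl.conformal G u) y i k = (Real.exp (2 * u y))⁻¹ *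
          (invMetric G y i k * ricci G y i k - 2 * (invMetric G y i k * conformalHess G u y i k)
            - t * (invMetric G y i k * G y i k)) := fun i k => by
      rw [h1, hG.invMetric_conformal hy]; ring
    simp only [scalarCurv, this, ← Finset.mul_sum, Finset.sum_sub_distrib, hG.trace_metric hy, ← ht]
    ring
  rw [weyl, weyl, hG.riemann_conformal hu hy hc, h2]
  simp only [h1, conformal_apply, kulkarni]
  field_simp
  ring

theorem _root_.WeakHarmonicWeyl.IsCoordChange.conformal {ψ : E4 → E4} {G' : CoordMetric} {V : Set E4}
    (h : IsCoordChange ψ G' V G U) (hu : ContDiffOn ℝ ∞ u U) :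
    IsCoordChange ψ (WeakHarmonicWeyl.conformal G' fun z => u (ψ z)) V
      (WeakHarmonicWeyl.conformal G u) U where
  metric' := h.metric'.conformal (hu.comp h.smooth h.mapsTo)
  metric := h.metric.conformal hu
  mapsTo := h.mapsTo
  smooth := h.smooth
  eq y hy := by
    simp only [WeakHarmonicWeyl.conformal]
    rw [h.eq y hy]
    simp

theorem weyl_conformal (hG : IsMetricOn G U) (hu : ContDiffOn ℝ ∞ u U) (hy : y ∈ U)
    (i j k l : Fin 4) :
    weyl (WeakHarmonicWeyl.conformal G u) y i j k l = Real.exp (2 * u y) * weyl G y i j k l := by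
  obtain ⟨ψ, G', V, h, h0, rfl, hJ, hc⟩ := hG.exists_normal_one hy
  have h1 := (h.conformal hu).natural_weyl.eq_of_jac_eq_one h0 hJ
  have h2 := h.natural_weyl.eq_of_jac_eq_one h0 hJ
  have h3 := h.metric'.weyl_conformal_of_christoffel_eq_zero (hu.comp h.smooth h.mapsTo) h0 hc i j k l
  have h4 := congrFun h1 ![i, j, k, l]
  have h5 := congrFun h2 ![i, j, k, l]
  exact h4.symm.trans (h3.trans (congrArg _ h5))

end IsMetricOn

/-! ### The divergence of the Weyl tensor under a conformal change. -/

namespace IsMetricOn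

variable {G : CoordMetric} {U : Set E4} {y : E4} {u : E4 → ℝ}

theorem sum_conformalDiff (G : CoordMetric) (u : E4 → ℝ) (y : E4) (X : Fin 4 → ℝ) (s a : Fin 4) :
    ∑ m, conformalDiff G u y m s a * X m = X s * pderiv a u y + X a * pderiv s u y
      - G y s a * ∑ m, ∑ l, invMetric G y m l * (X m * pderiv l u y) := by
  have h : ∀ m, conformalDiff G u y m s a * X m = X m * kron m s * pderiv a u y
      + X m * kron m a * pderiv s u y
      - G y s a * ∑ l, invMetric G y m l * (X m * pderiv l u y) := fun m => by
    have : ∑ l, invMetric G y m l * (X m * pderiv l u y)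
        = X m * ∑ l, invMetric G y m l * pderiv l u y := by
      rw [Finset.mul_sum]; exact Finset.sum_congr rfl fun l _ => by ring
    rw [conformalDiff, this]; ring
  have e3 : ∀ l, ∑ p, X p * kron p l = X l := fun l => by simp [kron]
  rw [Finset.sum_congr rfl fun m _ => h m, Finset.sum_sub_distrib, Finset.sum_add_distrib,
    ← Finset.sum_mul, ← Finset.sum_mul, e3, e3, ← Finset.mul_sum]

theorem trace_lower (hG : IsMetricOn G U) (hy : y ∈ U) (a : Fin 4) (X : Fin 4 → ℝ) :
    ∑ t, ∑ s, invMetric G y t s * (G y s a * X t) = X a := by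
  have : ∀ t, ∑ s, invMetric G y t s * (G y s a * X t) = (if t = a then 1 else 0) * X t := by
    intro t
    rw [← hG.sum_inv_mul hy t a, Finset.sum_mul]
    exact Finset.sum_congr rfl fun s _ => by ring
  simp [this]

theorem trace_swap (hG : IsMetricOn G U) (hy : y ∈ U) (F : Fin 4 → Fin 4 → ℝ) :
    ∑ t, ∑ s, invMetric G y t s * F s t = ∑ t, ∑ s, invMetric G y t s * F t s := by
  rw [Finset.sum_comm]
  exact Finset.sum_congr rfl fun t _ => Finset.sum_congr rfl fun s _ => by rw [hG.inv_symm hy]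

/-- Count the multiples of V = W(∇u): 2 from differentiating e^{2u}, then 4 - 2, -2, -1 and -1 from
the four slots, and 1 from the cyclic identity (`hV34`). The total is n - 3 = 1. All other terms are
traces of W. -/
theorem divWeyl_conformal_of_christoffel_eq_zero (hG : IsMetricOn G U) (hu : ContDiffOn ℝ ∞ u U)
    (hy : y ∈ U) (hc : ∀ k i j, christoffel G y k i j = 0) (I : Fin 3 → Fin 4) :
    divWeyl (WeakHarmonicWeyl.conformal G u) y I = divWeyl G y I + weylGrad G u y I := by
  have he : Real.exp (2 * u y) ≠ 0 := (Real.exp_pos _).ne'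
  have hU := hG.isOpen
  have du := hu.diffAt hU hy
  have hW := hG.isCurvatureLike_weyl hy
  obtain ⟨i, hi⟩ : ∃ i, I 0 = i := ⟨_, rfl⟩
  obtain ⟨j, hj⟩ : ∃ j, I 1 = j := ⟨_, rfl⟩
  obtain ⟨k, hk⟩ : ∃ k, I 2 = k := ⟨_, rfl⟩
  set V : Fin 4 → Fin 4 → Fin 4 → ℝ := fun i j k =>
    ∑ t, ∑ s, invMetric G y t s * (weyl G y t i j k * pderiv s u y) with hV
  have hdW : ∀ t i j k s, pderiv s (fun z => weyl (WeakHarmonicWeyl.conformal G u) z t i j k) y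
      = Real.exp (2 * u y) * (2 * pderiv s u y * weyl G y t i j k
        + pderiv s (fun z => weyl G z t i j k) y) := by
    intro t i j k s
    rw [pderiv_congr_on hU hy fun z hz => hG.weyl_conformal hu hz t i j k,
      pderiv_mul (du.const_mul 2).exp ((hG.smooth_weyl t i j k).diffAt hU hy),
      pderiv_exp (du.const_mul 2), pderiv_const_mul]
    ring
  have hV2 : ∀ j k a, ∑ m, ∑ l, invMetric G y m l * (weyl G y a m j k * pderiv l u y)
      = -V a j k := by
    intro j k a
    simp only [hV, ← Finset.sum_neg_distrib]
    refine Finset.sum_congr rfl fun m _ => Finset.sum_congr rfl fun l _ => ?_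
    rw [hW.anti a m]; ring
  have hV34 : ∑ m, ∑ l, invMetric G y m l * (weyl G y j i m k * pderiv l u y)
      + ∑ m, ∑ l, invMetric G y m l * (weyl G y k i j m * pderiv l u y) = V i j k := by
    simp only [hV, ← Finset.sum_add_distrib]
    refine Finset.sum_congr rfl fun m _ => Finset.sum_congr rfl fun l _ => ?_
    rw [hW.pair j i m k, hW.pair k i j m, hW.anti j m, hW.anti' m k j i]
    have := hW.cyclic m i j k
    linear_combination (-invMetric G y m l * pderiv l u y) * this
  have t2 : ∑ t, ∑ s, invMetric G y t s * weyl G y t s j k = 0 := by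
    have h1 := hG.trace_swap hy fun t s => weyl G y t s j k
    have h2 : ∀ t s, invMetric G y t s * weyl G y s t j k = -(invMetric G y t s * weyl G y t s j k) :=
      fun t s => by rw [hW.anti s t]; ring
    simp only [h2, Finset.sum_neg_distrib] at h1
    linarith
  have t3 : ∑ t, ∑ s, invMetric G y t s * weyl G y t i s k = 0 := by
    rw [← hG.weyl_trace hy i k]
    refine Finset.sum_congr rfl fun t _ => Finset.sum_congr rfl fun s _ => ?_
    rw [hW.anti t i, hW.anti' i t s k, neg_neg]
  have t4 : ∑ t, ∑ s, invMetric G y t s * weyl G y t i j s = 0 := by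
    rw [← neg_eq_zero, ← hG.weyl_trace hy i j]
    simp only [← Finset.sum_neg_distrib]
    refine Finset.sum_congr rfl fun t _ => Finset.sum_congr rfl fun s _ => ?_
    rw [hW.anti t i]; ring
  have hdiv : divWeyl G y I = ∑ t, ∑ s, invMetric G y t s * pderiv s (fun z => weyl G z t i j k) y := by
    simp only [divWeyl, covDeriv_eq_pderiv hc, weylTensor]
    simp [hi, hj, hk]
  have hgrad : weylGrad G u y I = V i j k := by
    simp only [weylGrad, hV, hi, hj, hk]
  have hterm : ∀ t s, invMetric (WeakHarmonicWeyl.conformal G u) y t s *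
      covDeriv (WeakHarmonicWeyl.conformal G u) (weylTensor (WeakHarmonicWeyl.conformal G u)) y
        ![t, I 0, I 1, I 2, s]
      = invMetric G y t s * pderiv s (fun z => weyl G z t i j k) y
        + 2 * (invMetric G y t s * (weyl G y t i j k * pderiv s u y))
        - (invMetric G y t s * (weyl G y s i j k * pderiv t u y)
          + invMetric G y t s * (weyl G y t i j k * pderiv s u y)
          - invMetric G y t s * (G y s t * V i j k))
        - (invMetric G y t s * weyl G y t s j k * pderiv i u y
          + invMetric G y t s * (weyl G y t i j k * pderiv s u y)
          + invMetric G y t s * (G y s i * V t j k))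
        - (invMetric G y t s * weyl G y t i s k * pderiv j u y
          + invMetric G y t s * (weyl G y t i j k * pderiv s u y)
          - invMetric G y t s * (G y s j *
            ∑ m, ∑ l, invMetric G y m l * (weyl G y t i m k * pderiv l u y)))
        - (invMetric G y t s * weyl G y t i j s * pderiv k u y
          + invMetric G y t s * (weyl G y t i j k * pderiv s u y)
          - invMetric G y t s * (G y s k *
            ∑ m, ∑ l, invMetric G y m l * (weyl G y t i j m * pderiv l u y))) := by
    intro t s
    have e1 : covDeriv (WeakHarmonicWeyl.conformal G u)
        (weylTensor (WeakHarmonicWeyl.conformal G u)) y ![t, I 0, I 1, I 2, s]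
        = pderiv s (fun z => weyl (WeakHarmonicWeyl.conformal G u) z t i j k) y
          - (∑ m, conformalDiff G u y m s t * (Real.exp (2 * u y) * weyl G y m i j k)
            + ∑ m, conformalDiff G u y m s i * (Real.exp (2 * u y) * weyl G y t m j k)
            + ∑ m, conformalDiff G u y m s j * (Real.exp (2 * u y) * weyl G y t i m k)
            + ∑ m, conformalDiff G u y m s k * (Real.exp (2 * u y) * weyl G y t i j m)) := by
      simp only [← hG.weyl_conformal hu hy]
      simp only [covDeriv, hG.christoffel_conformal hu hy, hc, zero_add, Fin.sum_univ_four]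
      subst hi hj hk
      rfl
    have e2 : ∀ (X : Fin 4 → ℝ) (a : Fin 4),
        ∑ m, conformalDiff G u y m s a * (Real.exp (2 * u y) * X m)
          = Real.exp (2 * u y) * (X s * pderiv a u y + X a * pderiv s u y
            - G y s a * ∑ m, ∑ l, invMetric G y m l * (X m * pderiv l u y)) := by
      intro X a
      rw [← sum_conformalDiff, Finset.mul_sum]
      exact Finset.sum_congr rfl fun m _ => by ring
    rw [e1, hdW, hG.invMetric_conformal hy, e2 (fun m => weyl G y m i j k),
      e2 (fun m => weyl G y t m j k), e2 (fun m => weyl G y t i m k), e2 (fun m => weyl G y t i j m),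
      hV2 j k t]
    simp only [hV]
    field_simp
    ring
  have hs := hG.trace_swap hy fun t s => weyl G y t i j k * pderiv s u y
  have t1 : ∑ t, ∑ s, invMetric G y t s * (G y s t * V i j k) = 4 * V i j k := by
    rw [← hG.trace_metric hy, Finset.sum_mul]
    refine Finset.sum_congr rfl fun t _ => ?_
    rw [Finset.sum_mul]
    exact Finset.sum_congr rfl fun s _ => by rw [hG.symm hy s t]; ring
  rw [hdiv, hgrad, divWeyl]
  simp only [hterm, Finset.sum_add_distrib, Finset.sum_sub_distrib, ← Finset.mul_sum,
    ← Finset.sum_mul, t2, t3, t4]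
  rw [hs, t1, hG.trace_lower hy i fun t => V t j k,
    hG.trace_lower hy j fun t => ∑ m, ∑ l, invMetric G y m l * (weyl G y t i m k * pderiv l u y),
    hG.trace_lower hy k fun t => ∑ m, ∑ l, invMetric G y m l * (weyl G y t i j m * pderiv l u y)]
  change _ + 2 * V i j k - (V i j k + V i j k - _) - (_ + V i j k + _) - (_ + V i j k - _)
    - (_ + V i j k - _) = _
  linarith

theorem divWeyl_conformal (hG : IsMetricOn G U) (hu : ContDiffOn ℝ ∞ u U) (hy : y ∈ U)
    (I : Fin 3 → Fin 4) :
    divWeyl (WeakHarmonicWeyl.conformal G u) y I = divWeyl G y I + weylGrad G u y I := by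
  obtain ⟨ψ, G', V, h, h0, rfl, hJ, hc⟩ := hG.exists_normal_one hy
  rw [← (h.conformal hu).natural_divWeyl.eq_of_jac_eq_one h0 hJ, ← h.natural_divWeyl.eq_of_jac_eq_one h0 hJ,
    ← (h.natural_weylGrad hu).eq_of_jac_eq_one h0 hJ]
  exact h.metric'.divWeyl_conformal_of_christoffel_eq_zero (hu.comp h.smooth h.mapsTo) h0 hc I

end IsMetricOn

/-! ### The pairing of tensors as a bilinear form -/

section Pairing

variable (h : Matrix (Fin 4) (Fin 4) ℝ) {k : ℕ} (T T' S : (Fin k → Fin 4) → ℝ)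

theorem pairing_add_left : pairing h (fun I => T I + T' I) S = pairing h T S + pairing h T' S := by
  simp only [pairing, add_mul, Finset.sum_add_distrib]

theorem pairing_symm (hh : ∀ i j, h i j = h j i) : pairing h T S = pairing h S T := by
  simp only [pairing, Finset.mul_sum]
  rw [Finset.sum_comm]
  refine Finset.sum_congr rfl fun I _ => Finset.sum_congr rfl fun J _ => ?_
  simp only [hh (J _) (I _)]
  ring

theorem pairing_sum_left {α : Type*} (s : Finset α) (c : α → ℝ) (F : α → (Fin k → Fin 4) → ℝ) :
    pairing h (fun I => ∑ a ∈ s, c a * F a I) S = ∑ a ∈ s, c a * pairing h (F a) S := by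
  obtain ⟨X, hX⟩ : ∃ X : (Fin k → Fin 4) → ℝ, ∀ T, pairing h T S = ∑ I, T I * X I := ⟨_, fun _ => rfl⟩
  simp only [hX, Finset.sum_mul, Finset.mul_sum, mul_assoc]
  exact Finset.sum_comm

theorem pairing_smul (c : ℝ) : pairing (c • h) T S = c ^ k * pairing h T S := by
  simp only [pairing, Matrix.smul_apply, smul_eq_mul, Finset.prod_mul_distrib, Finset.prod_const,
    Finset.card_univ, Fintype.card_fin, Finset.mul_sum]
  refine Finset.sum_congr rfl fun I _ => Finset.sum_congr rfl fun J _ => ?_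
  ring

theorem pairing_add_self (hh : ∀ i j, h i j = h j i) :
    pairing h (fun I => T I + S I) (fun I => T I + S I)
      = pairing h T T + 2 * pairing h T S + pairing h S S := by
  rw [pairing_add_left, pairing_symm h T _ hh, pairing_symm h S _ hh, pairing_add_left,
    pairing_add_left, pairing_symm h S T hh]
  ring

end Pairing

/-- Each of the three inverse metrics contributes e^{-2u}; the bracket is |δW + W(∇u)|² expanded. -/
theorem IsMetricOn.normSq_divWeyl_conformal {G : CoordMetric} {U : Set E4} {y : E4} {u : E4 → ℝ}
    (hG : IsMetricOn G U) (hu : ContDiffOn ℝ ∞ u U) (hy : y ∈ U) :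
    normSq (WeakHarmonicWeyl.conformal G u) (divWeyl (WeakHarmonicWeyl.conformal G u)) y = Real.exp (-6 * u y) *
      (normSq G (divWeyl G) y + 2 * pairing (G y)⁻¹ (divWeyl G y) (weylGrad G u y)
        + normSq G (weylGrad G u) y) := by
  have h1 : (WeakHarmonicWeyl.conformal G u y)⁻¹ = (Real.exp (2 * u y))⁻¹ • (G y)⁻¹ := by
    ext i j
    exact hG.invMetric_conformal hy i j
  have h2 : Real.exp (-6 * u y) = (Real.exp (2 * u y))⁻¹ ^ 3 := by
    rw [← Real.exp_neg, ← Real.exp_nat_mul]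
    congr 1
    push_cast
    ring
  have h3 : divWeyl (WeakHarmonicWeyl.conformal G u) y = fun I => divWeyl G y I + weylGrad G u y I :=
    funext fun I => hG.divWeyl_conformal hu hy I
  rw [WeakHarmonicWeyl.normSq_eq_pairing, h1, pairing_smul, h3,
    pairing_add_self (G y)⁻¹ _ _ fun i j => hG.inv_symm hy i j, h2]
  rfl

/-- The contraction of a tensor of rank four with a tensor of rank three, in the last three
indices. -/
theorem isPull_pairing {A h h' : Matrix (Fin 4) (Fin 4) ℝ} (hh : A * h' * A.transpose = h)
    {T' T : (Fin 4 → Fin 4) → ℝ} {S' S : (Fin 3 → Fin 4) → ℝ} (hT : IsPull A T' T)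
    (hS : IsPull A S' S) :
    IsPull A (fun J : Fin 1 → Fin 4 => pairing h' (fun I => T' ![J 0, I 0, I 1, I 2]) S')
      (fun J => pairing h (fun I => T ![J 0, I 0, I 1, I 2]) S) := by
  intro J
  have hT1 : IsPull A (fun I : Fin 3 → Fin 4 => T' ![J 0, I 0, I 1, I 2])
      (fun I => ∑ a, A a (J 0) * T ![a, I 0, I 1, I 2]) := by
    intro I
    refine (hT _).trans ?_
    rw [sum_fin_cons, Finset.sum_comm]
    refine Finset.sum_congr rfl fun K _ => ?_
    rw [Finset.mul_sum]
    refine Finset.sum_congr rfl fun a _ => ?_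
    have : (Fin.cons a K : Fin 4 → Fin 4) = ![a, K 0, K 1, K 2] := by
      ext x; fin_cases x <;> rfl
    rw [this, Fin.prod_univ_four, Fin.prod_univ_three]
    simp
    ring
  refine (pairing_eq_of_isPull hh hT1 hS).trans ?_
  rw [pairing_sum_left, sum_fin_one]
  simp

/-! ### The divergence of a covector field -/

/-- Jacobi's formula. -/
theorem pderiv_det {A : E4 → Matrix (Fin 4) (Fin 4) ℝ} {y : E4}
    (hA : ∀ i j, DifferentiableAt ℝ (fun z => A z i j) y) (k : Fin 4) :
    pderiv k (fun z => (A z).det) y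
      = ∑ i, ∑ j, (A y).adjugate i j * pderiv k (fun z => A z j i) y := by
  have h1 : ∀ i, ∑ j, (A y).adjugate i j * pderiv k (fun z => A z j i) y
      = ((A y).updateCol i fun j => pderiv k (fun z => A z j i) y).det := by
    intro i
    rw [← Matrix.cramer_apply, Matrix.cramer_eq_adjugate_mulVec]
    rfl
  simp only [h1, Matrix.det_apply']
  rw [pderiv_sum fun σ _ => (HasFDerivAt.finsetProd fun i _ =>
    (hA (σ i) i).hasFDerivAt).differentiableAt.const_mul _,
    Finset.sum_comm]
  refine Finset.sum_congr rfl fun σ _ => ?_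
  rw [pderiv_const_mul, pderiv_prod fun i _ => hA _ _, Finset.mul_sum]
  refine Finset.sum_congr rfl fun i _ => ?_
  congr 1
  rw [← Finset.mul_prod_erase Finset.univ _ (Finset.mem_univ i), Matrix.updateCol_self, mul_comm]
  congr 1
  refine Finset.prod_congr rfl fun j hj => ?_
  rw [Matrix.updateCol_ne (Finset.ne_of_mem_erase hj)]

/-- The divergence `g^{ts} ∇_s T_t` of a covector field. -/
def coordDiv (G : CoordMetric) (T : CoordTensor 1) (y : E4) : ℝ :=
  ∑ t, ∑ s, invMetric G y t s * covDeriv G T y ![t, s]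

theorem IsCoordChange.coordDiv_eq {ψ : E4 → E4} {G' G : CoordMetric} {V U : Set E4}
    (h : IsCoordChange ψ G' V G U) {T' T : CoordTensor 1} (hT : IsNatural ψ V T' T)
    (hs : SmoothTensor T U) {y : E4} (hy : y ∈ V) : coordDiv G' T' y = coordDiv G T (ψ y) := by
  have h2 := IsPull.contract (ν := Fin 2) (ι := Fin 0)
    (Equiv.ofBijective (Sum.elim ![0, 1] ![]) (by decide)) (h.inv_eq hy)
    (fun i j _ => ![i, j])
    (by intro t s I; ext x; rcases x with x | x <;> fin_cases x <;> rfl)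
    (h.natural_covDeriv hT hs y hy) ![]
  rw [sum_fin_zero] at h2
  beta_reduce at h2
  rw [Fin.prod_univ_zero, one_mul] at h2
  exact h2

namespace IsMetricOn

variable {G : CoordMetric} {U : Set E4} {y : E4}

/-- Differentiate g⁻¹g = 1, insert metric compatibility of the connection, and multiply by g⁻¹. -/
theorem pderiv_inv (hG : IsMetricOn G U) (hy : y ∈ U) (k i j : Fin 4) :
    pderiv k (fun z => invMetric G z i j) y = -(∑ m, christoffel G y i k m * invMetric G y m j)
      - ∑ m, christoffel G y j k m * invMetric G y i m := by
  have hU := hG.isOpen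
  have h1 : ∀ j, ∑ l, pderiv k (fun z => invMetric G z i l) y * G y l j
      = -christoffel G y i k j - ∑ m, G y j m * ∑ l, christoffel G y m k l * invMetric G y i l := by
    intro j
    have h2 : pderiv k (fun z => ∑ l, invMetric G z i l * G z l j) y = 0 := by
      rw [pderiv_congr_on hU hy (fun z hz => hG.sum_inv_mul hz i j), pderiv_const]
    have hd1 := fun l => (hG.smooth_inv i l).diffAt hU hy
    have hd2 := fun l => (hG.smooth l j).diffAt hU hy
    rw [pderiv_sum fun l _ => (hd1 l).fun_mul (hd2 l)] at h2
    simp only [pderiv_mul (hd1 _) (hd2 _), Finset.sum_add_distrib] at h2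
    have h3 : ∑ l, invMetric G y i l * pderiv k (fun z => G z l j) y
        = christoffel G y i k j + ∑ m, G y j m * ∑ l, christoffel G y m k l * invMetric G y i l := by
      simp only [hG.pderiv_metric hy, mul_add, Finset.sum_add_distrib, Finset.mul_sum]
      congr 1
      · rw [Finset.sum_comm]
        simp only [← mul_assoc, ← Finset.sum_mul, hG.sum_inv_mul hy]
        simp
      · rw [Finset.sum_comm]
        exact Finset.sum_congr rfl fun m _ => Finset.sum_congr rfl fun l _ => by ring
    rw [h3] at h2
    linarith
  have h2 : ∑ j', (∑ l, pderiv k (fun z => invMetric G z i l) y * G y l j') * invMetric G y j' j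
      = pderiv k (fun z => invMetric G z i j) y := by
    simp only [Finset.sum_mul]
    rw [Finset.sum_comm]
    simp only [mul_assoc, ← Finset.mul_sum, hG.sum_mul_inv hy]
    simp
  have h3 : ∀ F : Fin 4 → ℝ, ∑ j', (∑ m, G y j' m * F m) * invMetric G y j' j = F j := by
    intro F
    simp only [Finset.sum_mul]
    rw [Finset.sum_comm]
    have : ∀ m, ∑ j', G y j' m * F m * invMetric G y j' j
        = F m * ∑ j', G y m j' * invMetric G y j' j := fun m => by
      rw [Finset.mul_sum]
      exact Finset.sum_congr rfl fun j' _ => by rw [hG.symm hy j' m]; ring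
    simp [this, hG.sum_mul_inv hy]
  rw [← h2]
  simp only [h1, sub_mul, neg_mul, Finset.sum_sub_distrib, Finset.sum_neg_distrib, h3]

/-- By Jacobi's formula ∂_k log √det g is half the trace of g⁻¹∂_k g, and metric compatibility makes
this Γ^m_{km}. -/
theorem pderiv_sqrt_det (hG : IsMetricOn G U) (hy : y ∈ U) (k : Fin 4) :
    pderiv k (fun z => Real.sqrt (G z).det) y
      = Real.sqrt (G y).det * ∑ m, christoffel G y m k m := by
  have hU := hG.isOpen
  have hp := hG.det_pos hy
  have hd := fun i j => (hG.smooth i j).diffAt hU hy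
  have h1 : pderiv k (fun z => (G z).det) y = (G y).det * (2 * ∑ m, christoffel G y m k m) := by
    rw [pderiv_det hd]
    have h2 : ∀ i j, (G y).adjugate i j = (G y).det * invMetric G y i j := by
      intro i j
      rw [invMetric, Matrix.inv_def, Matrix.smul_apply, Ring.inverse_eq_inv', smul_eq_mul,
        mul_inv_cancel_left₀ hp.ne']
    simp only [h2, mul_assoc, ← Finset.mul_sum]
    congr 1
    simp only [hG.pderiv_metric hy, mul_add, Finset.sum_add_distrib]
    have h3 : ∑ i, ∑ j, invMetric G y i j * ∑ m, G y j m * christoffel G y m k i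
        = ∑ m, christoffel G y m k m := by
      refine Finset.sum_congr rfl fun i _ => ?_
      simp only [Finset.mul_sum]
      rw [Finset.sum_comm]
      simp only [← mul_assoc, ← Finset.sum_mul, hG.sum_inv_mul hy]
      simp
    have h4 : ∑ i, ∑ j, invMetric G y i j * ∑ m, G y i m * christoffel G y m k j
        = ∑ m, christoffel G y m k m := by
      rw [← h3, Finset.sum_comm]
      simp only [hG.inv_symm hy]
    rw [h3, h4]
    ring
  have hdd : DifferentiableAt ℝ (fun z => (G z).det) y := (contDiffOn_det hG.smooth).diffAt hU hy
  have h2 : pderiv k (fun z => Real.sqrt (G z).det) y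
      = 1 / (2 * Real.sqrt (G y).det) * pderiv k (fun z => (G z).det) y := by
    rw [pderiv, fderiv_sqrt hdd hp.ne']
    rfl
  have hs : Real.sqrt (G y).det ≠ 0 := (Real.sqrt_pos.2 hp).ne'
  rw [h2, h1]
  field_simp
  rw [Real.sq_sqrt hp.le]

theorem smooth_sqrt_det (hG : IsMetricOn G U) : ContDiffOn ℝ ∞ (fun z => Real.sqrt (G z).det) U :=
  (contDiffOn_det hG.smooth).sqrt fun _ hy => (hG.det_pos hy).ne'

/-- The divergence of a covector field in terms of the density `√det g`. -/
theorem sum_pderiv_eq_coordDiv (hG : IsMetricOn G U) (hy : y ∈ U) {T : CoordTensor 1}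
    (hT : SmoothTensor T U) :
    ∑ t, pderiv t (fun z => Real.sqrt (G z).det * ∑ s, invMetric G z t s * T z ![s]) y
      = Real.sqrt (G y).det * coordDiv G T y := by
  have hU := hG.isOpen
  have di := fun i j => (hG.smooth_inv i j).diffAt hU hy
  have dT := fun s => (hT ![s]).diffAt hU hy
  have ds : ∀ t, DifferentiableAt ℝ (fun z => ∑ s, invMetric G z t s * T z ![s]) y := fun t =>
    DifferentiableAt.fun_sum fun s _ => (di t s).fun_mul (dT s)
  have h1 : ∀ t, pderiv t (fun z => Real.sqrt (G z).det * ∑ s, invMetric G z t s * T z ![s]) y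
      = Real.sqrt (G y).det * ((∑ m, christoffel G y m t m) * (∑ s, invMetric G y t s * T y ![s])
        - (∑ s, ∑ m, christoffel G y t t m * (invMetric G y m s * T y ![s]))
        - (∑ s, ∑ m, christoffel G y s t m * (invMetric G y t m * T y ![s]))
        + ∑ s, invMetric G y t s * pderiv t (fun z => T z ![s]) y) := by
    intro t
    rw [pderiv_mul (hG.smooth_sqrt_det.diffAt hU hy) (ds t), hG.pderiv_sqrt_det hy,
      pderiv_sum fun s _ => (di t s).fun_mul (dT s)]
    simp only [pderiv_mul (di _ _) (dT _), hG.pderiv_inv hy, sub_mul, neg_mul,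
      Finset.sum_add_distrib, Finset.sum_sub_distrib, Finset.sum_neg_distrib, Finset.sum_mul, mul_assoc]
    ring
  simp only [h1, ← Finset.mul_sum]
  congr 1
  simp only [Finset.sum_add_distrib, Finset.sum_sub_distrib, coordDiv, covDeriv_one, mul_sub]
  -- The contracted symbol coming from √det g cancels the one coming from the derivative of g⁻¹.
  have h2 : ∑ t, (∑ m, christoffel G y m t m) * (∑ s, invMetric G y t s * T y ![s])
      = ∑ t, ∑ s, ∑ m, christoffel G y t t m * (invMetric G y m s * T y ![s]) := by
    have : ∀ t, ∑ s, ∑ m, christoffel G y t t m * (invMetric G y m s * T y ![s])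
        = ∑ m, christoffel G y t t m * ∑ s, invMetric G y m s * T y ![s] := fun t => by
      rw [Finset.sum_comm]; simp only [Finset.mul_sum]
    simp only [this, Finset.sum_mul]
    rw [Finset.sum_comm]
    exact Finset.sum_congr rfl fun t _ => Finset.sum_congr rfl fun m _ => by
      rw [hG.christoffel_symm hy t m t]
  have h3 : ∑ t, ∑ s, ∑ m, christoffel G y s t m * (invMetric G y t m * T y ![s])
      = ∑ t, ∑ s, invMetric G y t s * ∑ m, christoffel G y m s t * T y ![m] := by
    refine Finset.sum_congr rfl fun t _ => ?_
    rw [Finset.sum_comm]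
    refine Finset.sum_congr rfl fun m _ => ?_
    rw [Finset.mul_sum]
    refine Finset.sum_congr rfl fun s _ => ?_
    rw [hG.christoffel_symm hy s t m]; ring
  have h4 := hG.trace_swap hy fun t s => pderiv s (fun z => T z ![t]) y
  rw [h2, h3, h4]
  ring

end IsMetricOn

/-! ### The covector field obtained by contracting W with δW. -/

/-- The covector field `W_{sijk} (δW)^{ijk}`. -/
def divCovector (G : CoordMetric) : CoordTensor 1 := fun y J =>
  pairing (G y)⁻¹ (fun I : Fin 3 → Fin 4 => weylTensor G y ![J 0, I 0, I 1, I 2]) (divWeyl G y)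

theorem IsCoordChange.natural_divCovector {ψ : E4 → E4} {G' G : CoordMetric} {V U : Set E4}
    (h : IsCoordChange ψ G' V G U) : IsNatural ψ V (divCovector G') (divCovector G) := fun y hy =>
  isPull_pairing (h.inv_eq hy) (h.natural_weyl y hy) (h.natural_divWeyl y hy)

namespace IsMetricOn

variable {G : CoordMetric} {U : Set E4} {y : E4}

theorem smooth_divCovector (hG : IsMetricOn G U) : SmoothTensor (divCovector G) U := fun J =>
  hG.smooth_pairing (T := fun y I => weylTensor G y ![J 0, I 0, I 1, I 2])
    (fun I => hG.smooth_weylTensor ![J 0, I 0, I 1, I 2]) hG.smooth_divWeyl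

/-- ⟨δW, W(∇f)⟩ depends on f only through the value of df on a fixed vector field, which is what
permits integration by parts. -/
theorem pairing_weylGrad (hG : IsMetricOn G U) (hy : y ∈ U) (f : E4 → ℝ) :
    pairing (G y)⁻¹ (divWeyl G y) (weylGrad G f y)
      = ∑ t, (∑ s, invMetric G y t s * divCovector G y ![s]) * pderiv t f y := by
  have h1 : weylGrad G f y = fun I => ∑ p : Fin 4 × Fin 4, (invMetric G y p.1 p.2 * pderiv p.2 f y)
      * weylTensor G y ![p.1, I 0, I 1, I 2] := by
    funext I
    rw [Fintype.sum_prod_type]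
    exact Finset.sum_congr rfl fun t _ => Finset.sum_congr rfl fun s _ => by
      simp only [weylTensor]
      change _ = _ * weyl G y t (I 0) (I 1) (I 2)
      ring
  rw [pairing_symm (G y)⁻¹ _ _ fun i j => hG.inv_symm hy i j, h1]
  refine (pairing_sum_left _ _ _ _ fun (p : Fin 4 × Fin 4) I => _).trans ?_
  rw [Fintype.sum_prod_type, Finset.sum_comm]
  refine Finset.sum_congr rfl fun s _ => ?_
  rw [Finset.sum_mul]
  refine Finset.sum_congr rfl fun t _ => ?_
  rw [hG.inv_symm hy t s, mul_right_comm]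
  rfl

/-- Product rule: the derivative falls either on W, giving a second factor δW, or on δW. -/
theorem coordDiv_divCovector_orthonormal (hG : IsMetricOn G U) (hy : y ∈ U)
    (hc : ∀ k i j, christoffel G y k i j = 0) (h1 : G y = 1) :
    coordDiv G (divCovector G) y
      = normSq G (divWeyl G) y + pairing (G y)⁻¹ (weylTensor G y) (gradDivWeyl G y) := by
  have hi' : ∀ i j, (G y)⁻¹ i j = kron i j := fun i j => by
    rw [h1, inv_one]; simp [Matrix.one_apply, kron]
  have hi : ∀ i j, invMetric G y i j = kron i j := hi'
  have h2 : coordDiv G (divCovector G) y = ∑ t, pderiv t (fun z => divCovector G z ![t]) y := by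
    simp only [coordDiv, hi, sum_kron_mul, covDeriv_one, hc, zero_mul, Finset.sum_const_zero, sub_zero]
  have h3 : ∀ t, pderiv t (fun z => divCovector G z ![t]) y
      = (∑ I : Fin 3 → Fin 4, pderiv t (fun z => weylTensor G z ![t, I 0, I 1, I 2]) y * divWeyl G y I)
        + ∑ I : Fin 3 → Fin 4, weylTensor G y ![t, I 0, I 1, I 2] * pderiv t (fun z => divWeyl G z I) y := by
    intro t
    refine (hG.pderiv_pairing_of_christoffel_eq_zero hy hc
      (T := fun y I => weylTensor G y ![t, I 0, I 1, I 2])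
      (fun I => hG.smooth_weylTensor ![t, I 0, I 1, I 2]) hG.smooth_divWeyl t).trans ?_
    rw [pairing_one hi', pairing_one hi']
  have h4 : ∀ I, divWeyl G y I = ∑ t, pderiv t (fun z => weylTensor G z ![t, I 0, I 1, I 2]) y := by
    intro I
    simp only [divWeyl, hi, sum_kron_mul, covDeriv_eq_pderiv hc]
    refine Finset.sum_congr rfl fun t _ => ?_
    have : (fun a : Fin 4 => (![t, I 0, I 1, I 2, t] : Fin 5 → Fin 4) a.castSucc)
        = ![t, I 0, I 1, I 2] := by
      ext a; fin_cases a <;> rfl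
    rw [this]
    rfl
  rw [h2, normSq_eq_pairing, pairing_one hi', pairing_one hi']
  simp only [h3, Finset.sum_add_distrib]
  congr 1
  · rw [Finset.sum_comm]
    refine Finset.sum_congr rfl fun I _ => ?_
    rw [← Finset.sum_mul, ← h4]
  · rw [sum_fin_cons]
    refine Finset.sum_congr rfl fun t _ => Finset.sum_congr rfl fun I _ => ?_
    have e1 : (Fin.cons t I : Fin 4 → Fin 4) = ![t, I 0, I 1, I 2] := by
      ext x; fin_cases x <;> rfl
    rw [e1, gradDivWeyl, covDeriv_eq_pderiv hc]
    rfl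

theorem coordDiv_divCovector (hG : IsMetricOn G U) (hy : y ∈ U) :
    coordDiv G (divCovector G) y
      = normSq G (divWeyl G) y + pairing (G y)⁻¹ (weylTensor G y) (gradDivWeyl G y) := by
  obtain ⟨ψ, G', V, h, h0, rfl, hJ, hc⟩ := hG.exists_orthonormal hy
  rw [← h.coordDiv_eq h.natural_divCovector hG.smooth_divCovector h0, ← h.normSq_eq h.natural_divWeyl h0,
    ← h.pairing_eq h.natural_weyl h.natural_gradDivWeyl h0]
  exact h.metric'.coordDiv_divCovector_orthonormal h0 hc hJ

end IsMetricOn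

/-! ### A Riemannian metric in charts -/

/-- The domain of the change of charts. -/
def overlap {M : Type*} [TopologicalSpace M] (e e' : OpenPartialHomeomorph M E4) : Set E4 := e.target ∩ e.symm ⁻¹' e'.source

theorem isOpen_overlap {M : Type*} [TopologicalSpace M] (e e' : OpenPartialHomeomorph M E4) : IsOpen (overlap e e') :=
  e.symm.isOpen_inter_preimage e'.open_source

section Charts

variable {M : Type*} [TopologicalSpace M] [ChartedSpace E4 M] 
  {e e' : OpenPartialHomeomorph M E4}

/-- The smooth charts of the manifold. -/
abbrev IsChart (e : OpenPartialHomeomorph M E4) : Prop := e ∈ IsManifold.maximalAtlas (𝓡 4) ∞ M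

theorem isChart_chartAt [IsManifold (𝓡 4) ∞ M] (x : M) : IsChart (chartAt E4 x) := IsManifold.chart_mem_maximalAtlas x

theorem IsChart.mdifferentiableAt_symm (he : IsChart e) {y : E4} (hy : y ∈ e.target) :
    MDifferentiableAt (𝓡 4) (𝓡 4) e.symm y :=
  (contMDiffAt_symm_of_mem_maximalAtlas he hy).mdifferentiableAt (by simp)

theorem IsChart.mdifferentiableAt (he : IsChart e) {x : M} (hx : x ∈ e.source) :
    MDifferentiableAt (𝓡 4) (𝓡 4) e x :=
  (contMDiffAt_of_mem_maximalAtlas he hx).mdifferentiableAt (by simp)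

theorem IsChart.smooth_comp_symm (he : IsChart e) {f : M → ℝ} (hf : ContMDiff (𝓡 4) 𝓘(ℝ, ℝ) ∞ f) :
    ContDiffOn ℝ ∞ (fun y => f (e.symm y)) e.target :=
  (hf.comp_contMDiffOn (contMDiffOn_symm_of_mem_maximalAtlas he)).contDiffOn

theorem IsChart.mfderiv_symm_injective (he : IsChart e) {y : E4} (hy : y ∈ e.target) :
    Function.Injective (mfderiv (𝓡 4) (𝓡 4) e.symm y) := by
  have h1 : mfderiv (𝓡 4) (𝓡 4) (e ∘ e.symm) y
      = (mfderiv (𝓡 4) (𝓡 4) e (e.symm y)).comp (mfderiv (𝓡 4) (𝓡 4) e.symm y) :=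
    mfderiv_comp y (he.mdifferentiableAt (e.map_target hy)) (he.mdifferentiableAt_symm hy)
  have h2 : mfderiv (𝓡 4) (𝓡 4) (e ∘ e.symm) y = ContinuousLinearMap.id ℝ _ := by
    have : e ∘ e.symm =ᶠ[𝓝 y] id := by
      filter_upwards [e.open_target.mem_nhds hy] with z hz using e.right_inv hz
    rw [this.mfderiv_eq, mfderiv_id]
  rw [h2] at h1
  intro v w hvw
  have h3 : ∀ v, mfderiv (𝓡 4) (𝓡 4) e (e.symm y) (mfderiv (𝓡 4) (𝓡 4) e.symm y v) = v := fun v =>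
    (congrArg (fun L => L v) h1).symm
  rw [← h3 v, ← h3 w, hvw]

variable [IsManifold (𝓡 4) ∞ M] (g : Metric4 M)

/-- Coordinate fields are smooth sections along e⁻¹; this turns smoothness of g as a bundle section
into smoothness of the components g_{ij}. -/
theorem IsChart.smooth_mfderiv_symm (he : IsChart e) (v : E4) :
    ContMDiffOn (𝓡 4) ((𝓡 4).prod 𝓘(ℝ, E4)) ∞ (fun y : E4 => Bundle.TotalSpace.mk' E4
      (E := fun x : M => TangentSpace (𝓡 4) x) (e.symm y) (mfderiv (𝓡 4) (𝓡 4) e.symm y v)) e.target := by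
  have h1 := (contMDiffOn_symm_of_mem_maximalAtlas he).contMDiffOn_tangentMapWithin
    (m := ∞) (by simp) e.open_target.uniqueMDiffOn
  have h2 : ContMDiffOn (𝓡 4) ((𝓡 4).prod 𝓘(ℝ, E4)) ∞
      (fun y : E4 => (Bundle.TotalSpace.mk' E4 y v : TangentBundle (𝓡 4) E4)) e.target :=
    contMDiffOn_vectorSpace_iff_contDiffOn.2 contDiffOn_const
  refine (h1.comp h2 fun y hy => hy).congr fun y hy => ?_
  simp only [Function.comp, tangentMapWithin, mfderivWithin_of_isOpen e.open_target hy]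

theorem coordMetric_apply (e : OpenPartialHomeomorph M E4) (y : E4) (i j : Fin 4) :
    coordMetric g e y i j = g.inner (e.symm y)
      (mfderiv (𝓡 4) (𝓡 4) e.symm y (EuclideanSpace.single i (1 : ℝ) : E4))
      (mfderiv (𝓡 4) (𝓡 4) e.symm y (EuclideanSpace.single j (1 : ℝ) : E4)) := rfl

theorem sum_coordMetric (e : OpenPartialHomeomorph M E4) (y v w : E4) :
    ∑ a, ∑ b, v a * coordMetric g e y a b * w b = g.inner (e.symm y)
      (mfderiv (𝓡 4) (𝓡 4) e.symm y v) (mfderiv (𝓡 4) (𝓡 4) e.symm y w) := by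
  have hv : ∀ v : E4, v = ∑ c, v c • (EuclideanSpace.single c (1 : ℝ) : E4) := fun v => by
    ext k
    simp [Pi.single_apply]
  have key : ∀ (B : E4 →L[ℝ] E4 →L[ℝ] ℝ) (L : E4 →L[ℝ] E4), ∑ a, ∑ b, v a *
      B (L (EuclideanSpace.single a 1)) (L (EuclideanSpace.single b 1)) * w b = B (L v) (L w) := by
    intro B L
    conv_rhs => rw [hv v, hv w]
    simp only [map_sum, map_smul, sum_apply, smul_apply, smul_eq_mul]
    simp only [Finset.mul_sum]
    rw [Finset.sum_comm]
    exact Finset.sum_congr rfl fun a _ => Finset.sum_congr rfl fun b _ => by ring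
  exact key (g.inner (e.symm y)) (mfderiv (𝓡 4) (𝓡 4) e.symm y)

theorem IsChart.isMetricOn (he : IsChart e) : IsMetricOn (coordMetric g e) e.target where
  isOpen := e.open_target
  smooth i j := by
    have h1 : ContMDiffOn (𝓡 4) ((𝓡 4).prod 𝓘(ℝ, E4 →L[ℝ] E4 →L[ℝ] ℝ)) ∞
        (fun y : E4 => Bundle.TotalSpace.mk' (E4 →L[ℝ] E4 →L[ℝ] ℝ)
          (E := fun x : M => TangentSpace (𝓡 4) x →L[ℝ] TangentSpace (𝓡 4) x →L[ℝ] ℝ)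
          (e.symm y) (g.inner (e.symm y))) e.target :=
      g.contMDiff.comp_contMDiffOn (contMDiffOn_symm_of_mem_maximalAtlas he)
    have h2 : ContMDiffOn (𝓡 4) ((𝓡 4).prod 𝓘(ℝ, ℝ)) ∞ (fun y : E4 => Bundle.TotalSpace.mk' ℝ
        (E := Bundle.Trivial M ℝ) (e.symm y) (coordMetric g e y i j)) e.target :=
      h1.clm_bundle_apply₂ (he.smooth_mfderiv_symm (EuclideanSpace.single i (1 : ℝ)))
        (he.smooth_mfderiv_symm (EuclideanSpace.single j (1 : ℝ)))
    intro y hy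
    have h3 := (Bundle.contMDiffWithinAt_totalSpace.1 (h2 y hy)).2
    exact h3.contDiffWithinAt
  posDef y hy := by
    refine Matrix.PosDef.of_dotProduct_mulVec_pos ?_ fun v hv => ?_
    · ext i j
      simp only [Matrix.conjTranspose_apply, star_trivial]
      exact g.symm _ _ _
    · have h1 := g.pos (e.symm y) (mfderiv (𝓡 4) (𝓡 4) e.symm y (WithLp.toLp 2 v : E4)) fun h0 => by
        refine hv ?_
        have h2 : (WithLp.toLp 2 v : E4) = 0 :=
          he.mfderiv_symm_injective hy (h0.trans (map_zero _).symm)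
        simpa using h2
      rw [← sum_coordMetric] at h1
      refine h1.trans_eq ?_
      simp only [dotProduct, Matrix.mulVec, Finset.mul_sum, star_trivial, mul_assoc]

theorem IsMetricOn.mono {G : CoordMetric} {U V : Set E4} (hG : IsMetricOn G U) (hV : IsOpen V)
    (h : V ⊆ U) : IsMetricOn G V :=
  ⟨hV, fun i j => (hG.smooth i j).mono h, fun y hy => hG.posDef y (h hy)⟩

/-- The chain rule for e⁻¹ = e'⁻¹ ∘ (e' ∘ e⁻¹) expresses the coordinate fields of `e` through those
of `e'`. Through this lemma the local naturality statements reach the manifold. -/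
theorem IsChart.isCoordChange (he : IsChart e) (he' : IsChart e') :
    IsCoordChange (fun y => e' (e.symm y)) (coordMetric g e) (overlap e e') (coordMetric g e')
      e'.target := by
  have hm : ContMDiffOn (𝓡 4) (𝓡 4) ∞ (fun y => e' (e.symm y)) (overlap e e') :=
    (contMDiffOn_of_mem_maximalAtlas he').comp
      ((contMDiffOn_symm_of_mem_maximalAtlas he).mono inter_subset_left) inter_subset_right
  have hs : ContDiffOn ℝ ∞ (fun y => e' (e.symm y)) (overlap e e') := hm.contDiffOn
  refine ⟨(he.isMetricOn g).mono (isOpen_overlap e e') inter_subset_left, he'.isMetricOn g,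
    fun y hy => e'.map_source hy.2, hs, fun y hy => ?_⟩
  have hd : DifferentiableAt ℝ (fun y => e' (e.symm y)) y :=
    (hs.contDiffAt ((isOpen_overlap e e').mem_nhds hy)).differentiableAt (by simp)
  have hx : e'.symm (e' (e.symm y)) = e.symm y := e'.left_inv hy.2
  have h0 : (mfderiv (𝓡 4) (𝓡 4) (fun y => e' (e.symm y)) y : E4 →L[ℝ] E4)
      = fderiv ℝ (fun y => e' (e.symm y)) y := mfderiv_eq_fderiv
  have h1 : mfderiv (𝓡 4) (𝓡 4) (e'.symm ∘ fun y => e' (e.symm y)) y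
      = (mfderiv (𝓡 4) (𝓡 4) e'.symm (e' (e.symm y))).comp
        (mfderiv (𝓡 4) (𝓡 4) (fun y => e' (e.symm y)) y) :=
    mfderiv_comp y (he'.mdifferentiableAt_symm (e'.map_source hy.2)) hd.mdifferentiableAt
  have h2 : e'.symm ∘ (fun y => e' (e.symm y)) =ᶠ[𝓝 y] e.symm := by
    filter_upwards [(isOpen_overlap e e').mem_nhds hy] with z hz using e'.left_inv hz.2
  have h3 : ∀ i, mfderiv (𝓡 4) (𝓡 4) e.symm y (EuclideanSpace.single i (1 : ℝ) : E4)
      = mfderiv (𝓡 4) (𝓡 4) e'.symm (e' (e.symm y))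
        (fderiv ℝ (fun y => e' (e.symm y)) y (EuclideanSpace.single i (1 : ℝ) : E4)) := by
    intro i
    have := congrArg (fun L : E4 →L[ℝ] E4 => L (EuclideanSpace.single i (1 : ℝ)))
      (h2.mfderiv_eq.symm.trans h1)
    exact this.trans (congrArg (fun L : E4 →L[ℝ] E4 => mfderiv (𝓡 4) (𝓡 4) e'.symm (e' (e.symm y))
      (L (EuclideanSpace.single i (1 : ℝ)))) h0)
  -- The base points are equal but not syntactically so, and the fibre depends on the point; the
  -- equality is therefore transported.
  have h4 : ∀ x x' : M, x = x' → ∀ v w : E4, g.inner x v w = g.inner x' v w := by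
    rintro x _ rfl v w
    rfl
  ext i j
  simp only [Matrix.mul_apply, Matrix.transpose_apply, Finset.sum_mul, jac_eq_fderiv hd]
  rw [Finset.sum_comm, sum_coordMetric, coordMetric_apply, h3, h3]
  exact h4 _ _ hx.symm _ _

theorem coordMetric_conformalMetric (f : M → ℝ) (hf : ContMDiff (𝓡 4) 𝓘(ℝ, ℝ) ∞ f)
    (e : OpenPartialHomeomorph M E4) :
    coordMetric (conformalMetric g f hf) e = conformal (coordMetric g e) fun y => f (e.symm y) := by
  funext y
  ext i j
  rfl

end Charts

/-! ### Integration against the Riemannian volume measure -/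

section Image

variable {M : Type*} [TopologicalSpace M] {e : OpenPartialHomeomorph M E4} {f : M → ℝ}

theorem isCompact_image_tsupport [CompactSpace M] (hs : tsupport f ⊆ e.source) :
    IsCompact (e '' tsupport f) :=
  (isClosed_tsupport f).isCompact.image_of_continuousOn (e.continuousOn.mono hs)

theorem image_tsupport_subset (hs : tsupport f ⊆ e.source) : e '' tsupport f ⊆ e.target := by
  rintro _ ⟨x, hx, rfl⟩
  exact e.map_source (hs hx)

theorem eq_zero_of_notMem_image_tsupport {y : E4} (hy : y ∈ e.target) (h : y ∉ e '' tsupport f) :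
    f (e.symm y) = 0 := by
  by_contra h0
  exact h ⟨e.symm y, subset_tsupport f h0, e.right_inv hy⟩

end Image

section Integration

variable {M : Type*} [TopologicalSpace M] [ChartedSpace E4 M] [IsManifold (𝓡 4) ∞ M]
  (g : Metric4 M) {e e' : OpenPartialHomeomorph M E4} {f : M → ℝ}

/-- The integral over the domain of a chart. -/
def chartIntegral (e : OpenPartialHomeomorph M E4) (f : M → ℝ) : ℝ :=
  ∫ y in e.target, f (e.symm y) * Real.sqrt (coordMetric g e y).det

theorem IsChart.continuousOn_mul_sqrt_det (he : IsChart e) (hf : ContinuousOn f e.source) :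
    ContinuousOn (fun y => f (e.symm y) * Real.sqrt (coordMetric g e y).det) e.target :=
  (hf.comp e.continuousOn_symm e.symm.mapsTo).mul (he.isMetricOn g).smooth_sqrt_det.continuousOn

theorem IsChart.integrableOn [CompactSpace M] (he : IsChart e) (hf : ContinuousOn f e.source)
    (hs : tsupport f ⊆ e.source) :
    IntegrableOn (fun y => f (e.symm y) * Real.sqrt (coordMetric g e y).det) e.target := by
  refine IntegrableOn.of_forall_sdiff_eq_zero (s := e '' tsupport f)
    (((he.continuousOn_mul_sqrt_det g hf).mono (image_tsupport_subset hs)).integrableOn_compact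
      (isCompact_image_tsupport hs)) e.open_target.measurableSet fun y hy => ?_
  rw [eq_zero_of_notMem_image_tsupport hy.1 hy.2, zero_mul]

theorem chartIntegral_sum [CompactSpace M] (he : IsChart e) {ι : Type*} (s : Finset ι) {F : ι → M → ℝ}
    (hF : ∀ i ∈ s, ContinuousOn (F i) e.source) (hs : ∀ i ∈ s, tsupport (F i) ⊆ e.source) :
    chartIntegral g e (fun x => ∑ i ∈ s, F i x) = ∑ i ∈ s, chartIntegral g e (F i) := by
  simp only [chartIntegral, Finset.sum_mul]
  exact integral_finsetSum s fun i hi => he.integrableOn g (hF i hi) (hs i hi)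

theorem det_fderiv_eq_det_jac {ψ : E4 → E4} {y : E4} (hψ : DifferentiableAt ℝ ψ y) :
    (fderiv ℝ ψ y).det = (jac ψ y).det := by
  have h : LinearMap.toMatrix (EuclideanSpace.basisFun (Fin 4) ℝ).toBasis
      (EuclideanSpace.basisFun (Fin 4) ℝ).toBasis (fderiv ℝ ψ y : E4 →ₗ[ℝ] E4) = jac ψ y := by
    ext i j
    rw [jac_eq_fderiv hψ, LinearMap.toMatrix_apply]
    simp
  rw [← h, LinearMap.det_toMatrix]

/-- The change of variables formula. -/
theorem chartIntegral_eq (he : IsChart e) (he' : IsChart e') (h : ∀ x, x ∉ e.source → f x = 0)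
    (h' : ∀ x, x ∉ e'.source → f x = 0) : chartIntegral g e f = chartIntegral g e' f := by
  have hc := he.isCoordChange g he'
  have h1 : ∀ {e e' : OpenPartialHomeomorph M E4}, (∀ x, x ∉ e'.source → f x = 0) →
      chartIntegral g e f = ∫ y in overlap e e', f (e.symm y) * Real.sqrt (coordMetric g e y).det := by
    intro e e' h'
    refine setIntegral_eq_of_subset_of_forall_sdiff_eq_zero e.open_target.measurableSet
      inter_subset_left fun y hy => ?_
    rw [h' _ fun h0 => hy.2 ⟨hy.1, h0⟩, zero_mul]
  rw [h1 h', h1 h]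
  have him : (fun y => e' (e.symm y)) '' overlap e e' = overlap e' e := by
    ext z
    constructor
    · rintro ⟨y, hy, rfl⟩
      refine ⟨e'.map_source hy.2, ?_⟩
      rw [mem_preimage, e'.left_inv hy.2]
      exact e.map_target hy.1
    · rintro ⟨hz, hz'⟩
      refine ⟨e (e'.symm z), ⟨e.map_source hz', ?_⟩, ?_⟩
      · rw [mem_preimage, e.left_inv hz']
        exact e'.map_target hz
      · beta_reduce
        rw [e.left_inv hz', e'.right_inv hz]
  have hinj : InjOn (fun y => e' (e.symm y)) (overlap e e') := fun y hy z hz hyz => by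
    have := e'.injOn hy.2 hz.2 hyz
    exact e.symm.injOn hy.1 hz.1 this
  have hd : ∀ y ∈ overlap e e', DifferentiableAt ℝ (fun y => e' (e.symm y)) y := fun y hy =>
    (hc.smooth.contDiffAt (hc.metric'.isOpen.mem_nhds hy)).differentiableAt (by simp)
  rw [← him, integral_image_eq_integral_abs_det_fderiv_smul volume
    (isOpen_overlap e e').measurableSet
    (fun y hy => (hd y hy).hasFDerivAt.hasFDerivWithinAt) hinj]
  refine setIntegral_congr_fun (isOpen_overlap e e').measurableSet fun y hy => ?_
  -- The square of the Jacobian determinant becomes, under the root, the factor |det| of the change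
  -- of variables.
  have h2 : (coordMetric g e y).det
      = (jac (fun y => e' (e.symm y)) y).det ^ 2 * (coordMetric g e' (e' (e.symm y))).det := by
    rw [hc.eq y hy, Matrix.det_mul, Matrix.det_mul, Matrix.det_transpose]
    ring
  beta_reduce
  rw [det_fderiv_eq_det_jac (hd y hy), e'.left_inv hy.2, h2, Real.sqrt_mul (sq_nonneg _),
    Real.sqrt_sq_eq_abs, smul_eq_mul]
  ring

/-- The density is nonnegative since ρ ≥ 0, so nothing is lost in `ENNReal.ofReal`; the support
condition makes the integrand live on a compact set. -/
theorem integral_chart_piece [CompactSpace M] [MeasurableSpace M] [BorelSpace M] (he : IsChart e) {ρ : M → ℝ} (hρ : Continuous ρ) (h0 : ∀ x, 0 ≤ ρ x)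
    (hs : tsupport ρ ⊆ e.source) (hf : Continuous f) :
    Integrable f (Measure.map e.symm ((volume.restrict e.target).withDensity fun y =>
        ENNReal.ofReal (ρ (e.symm y) * Real.sqrt (coordMetric g e y).det))) ∧
    ∫ x, f x ∂(Measure.map e.symm ((volume.restrict e.target).withDensity fun y =>
        ENNReal.ofReal (ρ (e.symm y) * Real.sqrt (coordMetric g e y).det)))
      = chartIntegral g e fun x => ρ x * f x := by
  have hm := e.open_target.measurableSet
  have h1 : AEMeasurable e.symm ((volume.restrict e.target).withDensity fun y =>
      ENNReal.ofReal (ρ (e.symm y) * Real.sqrt (coordMetric g e y).det)) :=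
    (e.continuousOn_symm.aemeasurable hm).mono_ac (withDensity_absolutelyContinuous _ _)
  have h2 : AEMeasurable (fun y => ENNReal.ofReal (ρ (e.symm y) * Real.sqrt (coordMetric g e y).det))
      (volume.restrict e.target) :=
    ((he.continuousOn_mul_sqrt_det g hρ.continuousOn).aemeasurable hm).ennreal_ofReal
  have h3 : ∀ᵐ y ∂(volume.restrict e.target),
      ENNReal.ofReal (ρ (e.symm y) * Real.sqrt (coordMetric g e y).det) < ⊤ :=
    .of_forall fun y => ENNReal.ofReal_lt_top
  have h4 : ∀ y, (ENNReal.ofReal (ρ (e.symm y) * Real.sqrt (coordMetric g e y).det)).toReal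
      • f (e.symm y) = ρ (e.symm y) * f (e.symm y) * Real.sqrt (coordMetric g e y).det := fun y => by
    rw [ENNReal.toReal_ofReal (mul_nonneg (h0 _) (Real.sqrt_nonneg _)), smul_eq_mul]
    ring
  have hρf : tsupport (fun x => ρ x * f x) ⊆ e.source := (tsupport_mul_subset_left (f := ρ)).trans hs
  constructor
  · rw [integrable_map_measure hf.aestronglyMeasurable h1,
      integrable_withDensity_iff_integrable_smul₀' h2 h3]
    simp only [Function.comp, h4]
    exact he.integrableOn g (hρ.mul hf).continuousOn hρf
  · rw [integral_map h1 hf.aestronglyMeasurable, integral_withDensity_eq_integral_toReal_smul₀ h2 h3]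
    simp only [h4]
    rfl

variable [T2Space M] [CompactSpace M]

variable (M) in
/-- The finitely many nonzero members of the partition of unity. -/
def chartIndex : Finset M :=
  ((atlasPartition M).locallyFinite.finite_nonempty_of_compact).toFinset

theorem mem_chartIndex {j : M} :
    j ∈ chartIndex M ↔ (Function.support (atlasPartition M j)).Nonempty := by
  simp [chartIndex]

theorem sum_atlasPartition (x : M) : ∑ j ∈ chartIndex M, atlasPartition M j x = 1 := by
  refine (atlasPartition M).sum_finsupport' x (mem_univ x) fun j hj => ?_
  exact mem_chartIndex.2 ⟨x, (atlasPartition M).mem_finsupport x |>.1 hj⟩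

theorem tsupport_atlasPartition (j : M) : tsupport (atlasPartition M j) ⊆ (chartAt E4 j).source :=
  Classical.choose_spec (SmoothPartitionOfUnity.exists_isSubordinate_chartAt_source (𝓡 4) M) j

theorem tsupport_atlasPartition_mul (j : M) (f : M → ℝ) :
    tsupport (fun x => atlasPartition M j x * f x) ⊆ (chartAt E4 j).source :=
  (tsupport_mul_subset_left (f := atlasPartition M j)).trans (tsupport_atlasPartition j)

variable [MeasurableSpace M]

/-- The sum over all points of `M` is finite: the partition of unity is locally finite and `M` is
compact. -/
theorem volumeMeasure_eq_sum : volumeMeasure g = ∑ j ∈ chartIndex M,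
    Measure.map (chartAt E4 j).symm ((volume.restrict (chartAt E4 j).target).withDensity fun y =>
      ENNReal.ofReal (atlasPartition M j ((chartAt E4 j).symm y) *
        Real.sqrt (coordMetric g (chartAt E4 j) y).det)) := by
  ext s hs
  rw [volumeMeasure, Measure.sum_apply _ hs, Measure.finsetSum_apply]
  refine tsum_eq_sum fun j hj => ?_
  have h0 : ∀ x, atlasPartition M j x = 0 := fun x => by
    by_contra h
    exact hj (mem_chartIndex.2 ⟨x, h⟩)
  simp [h0]

theorem vol_eq_integral : vol g = ∫ _, (1 : ℝ) ∂(volumeMeasure g) := by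
  rw [vol, integral_const, smul_eq_mul, mul_one]

variable [BorelSpace M]

theorem integrable_volumeMeasure (hf : Continuous f) : Integrable f (volumeMeasure g) := by
  rw [volumeMeasure_eq_sum, integrable_finsetSum_measure]
  exact fun j _ => (integral_chart_piece g (isChart_chartAt j) (atlasPartition M j).contMDiff.continuous
    (fun x => (atlasPartition M).nonneg j x) (tsupport_atlasPartition j) hf).1

theorem integral_volumeMeasure (hf : Continuous f) : ∫ x, f x ∂(volumeMeasure g)
    = ∑ j ∈ chartIndex M, chartIntegral g (chartAt E4 j) fun x => atlasPartition M j x * f x := by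
  have h := fun j : M => integral_chart_piece g (isChart_chartAt j)
    (atlasPartition M j).contMDiff.continuous
    (fun x => (atlasPartition M).nonneg j x) (tsupport_atlasPartition j) hf
  rw [volumeMeasure_eq_sum, integral_finsetSum_measure fun j _ => (h j).1]
  exact Finset.sum_congr rfl fun j _ => (h j).2

/-- For a function supported in one chart the partition of unity disappears: each piece is moved to
that chart by the change of variables, and the pieces add up. -/
theorem integral_eq_chartIntegral (he : IsChart e) (hf : Continuous f) (hs : tsupport f ⊆ e.source) :
    ∫ x, f x ∂(volumeMeasure g) = chartIntegral g e f := by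
  have hx : ∀ x, x ∉ e.source → f x = 0 := fun x hx => image_eq_zero_of_notMem_tsupport fun h => hx (hs h)
  have h1 : chartIntegral g e f
      = chartIntegral g e fun x => ∑ j ∈ chartIndex M, atlasPartition M j x * f x := by
    simp only [← Finset.sum_mul, sum_atlasPartition, one_mul]
  rw [integral_volumeMeasure g hf, h1, chartIntegral_sum g he]
  · refine Finset.sum_congr rfl fun j _ => chartIntegral_eq g (isChart_chartAt j) he (fun x h => ?_)
      fun x h => by rw [hx x h, mul_zero]
    rw [image_eq_zero_of_notMem_tsupport fun h0 => h (tsupport_atlasPartition j h0), zero_mul]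
  · exact fun j _ => ((atlasPartition M j).contMDiff.continuous.mul hf).continuousOn
  · exact fun j _ => (tsupport_mul_subset_right (f := atlasPartition M j)).trans hs

/-- A nonnegative continuous function with vanishing integral vanishes. -/
theorem eq_zero_of_integral_eq_zero (hf : Continuous f) (h0 : ∀ x, 0 ≤ f x)
    (hi : ∫ x, f x ∂(volumeMeasure g) = 0) (x : M) : f x = 0 := by
  rw [integral_volumeMeasure g hf] at hi
  have hn : ∀ (j : M) (y : E4), 0 ≤ atlasPartition M j ((chartAt E4 j).symm y)
      * f ((chartAt E4 j).symm y) * Real.sqrt (coordMetric g (chartAt E4 j) y).det := fun j y =>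
    mul_nonneg (mul_nonneg ((atlasPartition M).nonneg j _) (h0 _)) (Real.sqrt_nonneg _)
  obtain ⟨j, hj⟩ := (atlasPartition M).exists_pos_of_mem (mem_univ x)
  have hj' : j ∈ chartIndex M := mem_chartIndex.2 ⟨x, hj.ne'⟩
  have h1 := (Finset.sum_eq_zero_iff_of_nonneg fun j _ => integral_nonneg (hn j)).1 hi j hj'
  have hc : Continuous fun x => atlasPartition M j x * f x :=
    (atlasPartition M j).contMDiff.continuous.mul hf
  have hx : x ∈ (chartAt E4 j).source := tsupport_atlasPartition j (subset_tsupport _ hj.ne')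
  have h2 := (setIntegral_eq_zero_iff_of_nonneg_ae (.of_forall (hn j))
    ((isChart_chartAt j).integrableOn g hc.continuousOn (tsupport_atlasPartition_mul j f))).1 h1
  -- Vanishing almost everywhere on an open set implies vanishing there for a continuous function.
  have h3 := Measure.eqOn_open_of_ae_eq h2 (chartAt E4 j).open_target
    ((isChart_chartAt j).continuousOn_mul_sqrt_det g hc.continuousOn) continuousOn_const
    ((chartAt E4 j).map_source hx)
  have hd := Real.sqrt_pos.2 (((isChart_chartAt j).isMetricOn g).det_pos ((chartAt E4 j).map_source hx))
  simp only [(chartAt E4 j).left_inv hx, Pi.zero_apply, mul_eq_zero, hd.ne', or_false, hj.ne',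
    false_or] at h3
  exact h3

theorem vol_pos [Nonempty M] : 0 < vol g := by
  refine lt_of_le_of_ne measureReal_nonneg fun h => ?_
  obtain ⟨x⟩ := ‹Nonempty M›
  exact one_ne_zero (eq_zero_of_integral_eq_zero g (f := fun _ => (1 : ℝ)) continuous_const
    (fun _ => zero_le_one) ((vol_eq_integral g).symm.trans h.symm) x)

end Integration

/-! ### Scalar invariants on the manifold and the divergence theorem -/

/-- The integral of a partial derivative of a compactly supported function vanishes. -/
theorem integral_pderiv_eq_zero {F : E4 → ℝ} {U K : Set E4} (hU : IsOpen U) (hK : IsCompact K)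
    (hKU : K ⊆ U) (hF : ContDiffOn ℝ ∞ F U) (h0 : ∀ y, y ∉ K → F y = 0) (i : Fin 4) :
    Integrable (pderiv i F) ∧ ∫ y, pderiv i F y = 0 := by
  have hsm : ContDiff ℝ ∞ F := by
    rw [contDiff_iff_contDiffAt]
    intro y
    by_cases hy : y ∈ K
    · exact hF.contDiffAt (hU.mem_nhds (hKU hy))
    · have : F =ᶠ[𝓝 y] fun _ => 0 := by
        filter_upwards [hK.isClosed.isOpen_compl.mem_nhds hy] with z hz using h0 z hz
      exact contDiffAt_const.congr_of_eventuallyEq this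
  have hcs : HasCompactSupport F := HasCompactSupport.intro hK fun y hy => h0 y hy
  have hd : Continuous (pderiv i F) := (contDiffOn_univ.1
    (contDiffOn_pderiv isOpen_univ (contDiffOn_univ.2 hsm))).continuous
  have hI : Integrable (pderiv i F) := hd.integrable_of_hasCompactSupport
    ((hcs.fderiv ℝ).comp_left (g := fun L : E4 →L[ℝ] ℝ => L (EuclideanSpace.single i 1)) rfl)
  have hIF : Integrable F := hsm.continuous.integrable_of_hasCompactSupport hcs
  refine ⟨hI, ?_⟩
  -- Integration by parts against the constant function 1.
  have h := integral_mul_fderiv_eq_neg_fderiv_mul_of_integrable (μ := volume) (f := F)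
    (g := fun _ : E4 => (1 : ℝ)) (v := EuclideanSpace.single i 1)
    (by simp only [mul_one]; exact hI) (by simp) (by simpa using hIF)
    (fun y _ => (hsm.differentiable (by simp)) y) fun y _ => differentiableAt_const _
  simp only [fderiv_fun_const, Pi.zero_apply, zero_apply, mul_zero, integral_zero, mul_one] at h
  exact neg_eq_zero.1 h.symm

theorem weylGrad_congr {G : CoordMetric} {f₁ f₂ : E4 → ℝ} {y : E4} (h : f₁ =ᶠ[𝓝 y] f₂) :
    weylGrad G f₁ y = weylGrad G f₂ y := by
  funext I
  simp only [weylGrad, pderiv_congr h]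

theorem IsMetricOn.smooth_weylGrad {G : CoordMetric} {U : Set E4} (hG : IsMetricOn G U) {f : E4 → ℝ}
    (hf : ContDiffOn ℝ ∞ f U) : SmoothTensor (weylGrad G f) U := fun _ =>
  ContDiffOn.sum fun _ _ => ContDiffOn.sum fun _ _ => (hG.smooth_inv _ _).mul
    ((hG.smooth_weyl _ _ _ _).mul (contDiffOn_pderiv hG.isOpen hf))

theorem mem_overlap_chartAt {M : Type*} [TopologicalSpace M] [ChartedSpace E4 M]
    {e : OpenPartialHomeomorph M E4} {y : E4} (hy : y ∈ e.target) : y ∈ overlap e (chartAt E4 (e.symm y)) :=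
  ⟨hy, mem_chart_source E4 (e.symm y)⟩

section Scalars

variable {M : Type*} [TopologicalSpace M] [ChartedSpace E4 M] [IsManifold (𝓡 4) ∞ M]
  (g : Metric4 M) {e : OpenPartialHomeomorph M E4} {φ : M → ℝ}

/-- A scalar invariant can be computed in any chart. -/
theorem atPoint_eq {s : CoordMetric → E4 → ℝ}
    (hs : ∀ {ψ : E4 → E4} {G' : CoordMetric} {V : Set E4} {G : CoordMetric} {U : Set E4} {y : E4},
      IsCoordChange ψ G' V G U → y ∈ V → s G' y = s G (ψ y))
    (he : IsChart e) {y : E4} (hy : y ∈ e.target) :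
    atPoint s g (e.symm y) = s (coordMetric g e) y :=
  (hs (he.isCoordChange g (isChart_chartAt (e.symm y))) (mem_overlap_chartAt hy)).symm

theorem weylNormSq_eq (he : IsChart e) {y : E4} (hy : y ∈ e.target) :
    weylNormSq g (e.symm y) = normSq (coordMetric g e) (weylTensor (coordMetric g e)) y :=
  atPoint_eq g (s := fun G => normSq G (weylTensor G)) (fun h hy => h.normSq_eq h.natural_weyl hy) he hy

theorem divWeylNormSq_eq (he : IsChart e) {y : E4} (hy : y ∈ e.target) :
    divWeylNormSq g (e.symm y) = normSq (coordMetric g e) (divWeyl (coordMetric g e)) y :=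
  atPoint_eq g (s := fun G => normSq G (divWeyl G)) (fun h hy => h.normSq_eq h.natural_divWeyl hy) he hy

/-- The divergence of the covector field `W_{sijk} (δW)^{ijk}`. -/
def divEnergy : M → ℝ := atPoint (fun G => coordDiv G (divCovector G)) g

theorem divEnergy_eq (he : IsChart e) {y : E4} (hy : y ∈ e.target) :
    divEnergy g (e.symm y) = coordDiv (coordMetric g e) (divCovector (coordMetric g e)) y :=
  atPoint_eq g (s := fun G => coordDiv G (divCovector G))
    (fun h hy => h.coordDiv_eq h.natural_divCovector h.metric.smooth_divCovector hy) he hy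

/-- The function `⟨δW, W(∇φ)⟩`. -/
def divPairing (φ : M → ℝ) (x : M) : ℝ :=
  pairing (coordMetric g (chartAt E4 x) (chartAt E4 x x))⁻¹
    (divWeyl (coordMetric g (chartAt E4 x)) (chartAt E4 x x))
    (weylGrad (coordMetric g (chartAt E4 x)) (fun y => φ ((chartAt E4 x).symm y)) (chartAt E4 x x))

/-- The invariant involves φ besides the metric, so `atPoint_eq` does not cover it. The two
coordinate expressions of φ need to agree only near the point, since only first derivatives enter.
-/
theorem divPairing_eq (he : IsChart e) (hφ : ContMDiff (𝓡 4) 𝓘(ℝ, ℝ) ∞ φ) {y : E4} (hy : y ∈ e.target) :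
    divPairing g φ (e.symm y) = pairing (coordMetric g e y)⁻¹ (divWeyl (coordMetric g e) y)
      (weylGrad (coordMetric g e) (fun y => φ (e.symm y)) y) := by
  have he' := isChart_chartAt (e.symm y)
  have h := he.isCoordChange g he'
  have hy' := mem_overlap_chartAt hy
  have h1 := h.pairing_eq h.natural_divWeyl (h.natural_weylGrad (he'.smooth_comp_symm hφ)) hy'
  have h2 : (fun z => φ ((chartAt E4 (e.symm y)).symm (chartAt E4 (e.symm y) (e.symm z))))
      =ᶠ[𝓝 y] fun z => φ (e.symm z) := by
    filter_upwards [h.metric'.isOpen.mem_nhds hy'] with z hz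
    rw [(chartAt E4 (e.symm y)).left_inv hz.2]
  rw [weylGrad_congr h2] at h1
  exact h1.symm

theorem contMDiff_of_comp_symm {f : M → ℝ}
    (h : ∀ x : M, ContDiffOn ℝ ∞ (fun y => f ((chartAt E4 x).symm y)) (chartAt E4 x).target) :
    ContMDiff (𝓡 4) 𝓘(ℝ, ℝ) ∞ f := by
  intro x
  have hx := mem_chart_source E4 x
  have h1 : ContMDiffOn (𝓡 4) 𝓘(ℝ, ℝ) ∞ (fun z => f ((chartAt E4 x).symm (chartAt E4 x z)))
      (chartAt E4 x).source :=
    (h x).contMDiffOn.comp (contMDiffOn_of_mem_maximalAtlas (isChart_chartAt x))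
      (chartAt E4 x).mapsTo
  exact (h1.congr fun z hz => by rw [(chartAt E4 x).left_inv hz]).contMDiffAt
    ((chartAt E4 x).open_source.mem_nhds hx)

theorem contMDiff_divWeylNormSq : ContMDiff (𝓡 4) 𝓘(ℝ, ℝ) ∞ (divWeylNormSq g) :=
  contMDiff_of_comp_symm fun x => (((isChart_chartAt x).isMetricOn g).smooth_normSq
    ((isChart_chartAt x).isMetricOn g).smooth_divWeyl).congr fun _ hy =>
      divWeylNormSq_eq g (isChart_chartAt x) hy

theorem IsMetricOn.smooth_coordDiv {G : CoordMetric} {U : Set E4} (hG : IsMetricOn G U)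
    {T : CoordTensor 1} (hT : SmoothTensor T U) : ContDiffOn ℝ ∞ (coordDiv G T) U :=
  ContDiffOn.sum fun _ _ => ContDiffOn.sum fun _ _ =>
    (hG.smooth_inv _ _).mul (hG.smooth_covDeriv hT _)

theorem contMDiff_divEnergy : ContMDiff (𝓡 4) 𝓘(ℝ, ℝ) ∞ (divEnergy g) :=
  contMDiff_of_comp_symm fun x => (((isChart_chartAt x).isMetricOn g).smooth_coordDiv
    ((isChart_chartAt x).isMetricOn g).smooth_divCovector).congr fun _ hy =>
      divEnergy_eq g (isChart_chartAt x) hy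

theorem contMDiff_divPairing (hφ : ContMDiff (𝓡 4) 𝓘(ℝ, ℝ) ∞ φ) :
    ContMDiff (𝓡 4) 𝓘(ℝ, ℝ) ∞ (divPairing g φ) :=
  contMDiff_of_comp_symm fun x => (((isChart_chartAt x).isMetricOn g).smooth_pairing
    ((isChart_chartAt x).isMetricOn g).smooth_divWeyl (((isChart_chartAt x).isMetricOn g).smooth_weylGrad
      ((isChart_chartAt x).smooth_comp_symm hφ))).congr fun _ hy =>
      divPairing_eq g (isChart_chartAt x) hφ hy

theorem divPairing_sum {ι : Type*} (s : Finset ι) {F : ι → M → ℝ}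
    (hF : ∀ i ∈ s, ContMDiff (𝓡 4) 𝓘(ℝ, ℝ) ∞ (F i)) (x : M) :
    divPairing g (fun x => ∑ i ∈ s, F i x) x = ∑ i ∈ s, divPairing g (F i) x := by
  have he := isChart_chartAt x
  have hG := he.isMetricOn g
  have hx := mem_chart_target E4 x
  simp only [divPairing, hG.pairing_weylGrad hx]
  rw [Finset.sum_comm]
  refine Finset.sum_congr rfl fun t _ => ?_
  rw [pderiv_sum fun i hi => (he.smooth_comp_symm (hF i hi)).diffAt hG.isOpen hx, Finset.mul_sum]

theorem divPairing_eq_zero {x : M} (h : φ =ᶠ[𝓝 x] 0) : divPairing g φ x = 0 := by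
  have hx := mem_chart_target E4 x
  have h1 : (fun y => φ ((chartAt E4 x).symm y)) =ᶠ[𝓝 (chartAt E4 x x)] fun _ => 0 := by
    have h2 := (chartAt E4 x).continuousAt_symm hx
    rw [ContinuousAt, (chartAt E4 x).left_inv (mem_chart_source E4 x)] at h2
    exact h2.eventually h
  rw [divPairing, weylGrad_congr h1, ((isChart_chartAt x).isMetricOn g).pairing_weylGrad hx]
  simp

/-- Multiplied by √det g, the integrand is Σ_t ∂_t(φ √det g X^t): the divergence theorem for φX in a
single chart. -/
theorem chartIntegral_divPairing_add [CompactSpace M] (he : IsChart e)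
    (hφ : ContMDiff (𝓡 4) 𝓘(ℝ, ℝ) ∞ φ) (hs : tsupport φ ⊆ e.source) :
    chartIntegral g e (fun x => divPairing g φ x + φ x * divEnergy g x) = 0 := by
  have hG := he.isMetricOn g
  have hU := hG.isOpen
  have hφ' := he.smooth_comp_symm hφ
  set h : Fin 4 → E4 → ℝ := fun t z => Real.sqrt (coordMetric g e z).det *
    ∑ s, invMetric (coordMetric g e) z t s * divCovector (coordMetric g e) z ![s] with hh
  have hsm : ∀ t, ContDiffOn ℝ ∞ (h t) e.target := fun t =>
    hG.smooth_sqrt_det.mul (ContDiffOn.sum fun s _ => (hG.smooth_inv _ _).mul (hG.smooth_divCovector _))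
  -- Extension by zero gives functions on the whole coordinate space, supported in the compact image
  -- of the support of φ.
  set F : Fin 4 → E4 → ℝ := fun t => e.target.indicator fun z => φ (e.symm z) * h t z with hF
  have hFe : ∀ t, ∀ z ∈ e.target, F t z = φ (e.symm z) * h t z := fun t z hz =>
    Set.indicator_of_mem hz _
  have hF0 : ∀ t y, y ∉ e '' tsupport φ → F t y = 0 := fun t y hy => by
    by_cases hy' : y ∈ e.target
    · rw [hFe t y hy', eq_zero_of_notMem_image_tsupport hy' hy, zero_mul]
    · exact Set.indicator_of_notMem hy' _
  have hK := isCompact_image_tsupport hs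
  have hKU := image_tsupport_subset hs
  have key := fun t => integral_pderiv_eq_zero hU hK hKU
    ((hφ'.mul (hsm t)).congr (hFe t)) (hF0 t) t
  have h1 : chartIntegral g e (fun x => divPairing g φ x + φ x * divEnergy g x)
      = ∫ y in e.target, ∑ t, pderiv t (F t) y := by
    refine setIntegral_congr_fun hU.measurableSet fun y hy => ?_
    have h2 : ∀ t, pderiv t (F t) y
        = pderiv t (fun z => φ (e.symm z)) y * h t y + φ (e.symm y) * pderiv t (h t) y := fun t => by
      rw [pderiv_congr_on hU hy (hFe t), pderiv_mul (hφ'.diffAt hU hy) ((hsm t).diffAt hU hy)]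
    simp only [h2, Finset.sum_add_distrib, ← Finset.mul_sum]
    rw [hG.sum_pderiv_eq_coordDiv hy hG.smooth_divCovector, divPairing_eq g he hφ hy,
      divEnergy_eq g he hy, hG.pairing_weylGrad hy, add_mul, Finset.sum_mul]
    congr 1
    · refine Finset.sum_congr rfl fun t _ => ?_
      simp only [hh]
      ring
    · ring
  have h2 : ∫ y in e.target, ∑ t, pderiv t (F t) y = ∫ y, ∑ t, pderiv t (F t) y := by
    refine setIntegral_eq_integral_of_forall_compl_eq_zero fun y hy => Finset.sum_eq_zero fun t _ => ?_
    have hy' : y ∉ e '' tsupport φ := fun h => hy (hKU h)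
    rw [pderiv_congr_on hK.isClosed.isOpen_compl hy' (hF0 t), pderiv_const]
  rw [h1, h2, integral_finsetSum _ fun t _ => (key t).1]
  exact Finset.sum_eq_zero fun t _ => (key t).2

variable [T2Space M] [CompactSpace M] [MeasurableSpace M] [BorelSpace M]

/-- Integration by parts: `∫ ⟨δW, W(∇φ)⟩ = - ∫ φ div (⟨W, δW⟩)`. -/
theorem integral_divPairing (hφ : ContMDiff (𝓡 4) 𝓘(ℝ, ℝ) ∞ φ) :
    ∫ x, divPairing g φ x ∂(volumeMeasure g) = - ∫ x, φ x * divEnergy g x ∂(volumeMeasure g) := by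
  have hk : ∀ k : M, ContMDiff (𝓡 4) 𝓘(ℝ, ℝ) ∞ fun x => atlasPartition M k x * φ x := fun k =>
    (atlasPartition M k).contMDiff.mul hφ
  have hc : ∀ k : M, Continuous fun x => divPairing g (fun x => atlasPartition M k x * φ x) x
      + atlasPartition M k x * φ x * divEnergy g x := fun k =>
    (contMDiff_divPairing g (hk k)).continuous.add
      ((hk k).continuous.mul (contMDiff_divEnergy g).continuous)
  -- Both terms are linear in φ, so φ may be cut into pieces supported in single charts.
  have h1 : ∀ x, divPairing g φ x + φ x * divEnergy g x = ∑ k ∈ chartIndex M,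
      (divPairing g (fun x => atlasPartition M k x * φ x) x
        + atlasPartition M k x * φ x * divEnergy g x) := by
    intro x
    have h2 : φ = fun x => ∑ k ∈ chartIndex M, atlasPartition M k x * φ x := by
      funext x
      rw [← Finset.sum_mul, sum_atlasPartition, one_mul]
    rw [Finset.sum_add_distrib, ← divPairing_sum g _ fun k _ => hk k, ← h2, ← Finset.sum_mul,
      ← Finset.sum_mul, sum_atlasPartition, one_mul]
  have h3 : ∫ x, (divPairing g φ x + φ x * divEnergy g x) ∂(volumeMeasure g) = 0 := by
    simp only [h1]
    rw [integral_finsetSum _ fun k _ => integrable_volumeMeasure g (hc k)]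
    refine Finset.sum_eq_zero fun k _ => ?_
    have hs := tsupport_atlasPartition_mul k φ
    rw [integral_eq_chartIntegral g (isChart_chartAt k) (hc k)]
    · exact chartIntegral_divPairing_add g (isChart_chartAt k) (hk k) hs
    · refine (closure_minimal (fun x hx => ?_) (isClosed_tsupport _)).trans hs
      by_contra h0
      refine hx ?_
      beta_reduce
      rw [divPairing_eq_zero g (notMem_tsupport_iff_eventuallyEq.1 h0),
        image_eq_zero_of_notMem_tsupport (f := fun x => atlasPartition M k x * φ x) h0]
      ring
  have hE : Continuous fun x => φ x * divEnergy g x :=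
    hφ.continuous.mul (contMDiff_divEnergy g).continuous
  rw [integral_add (integrable_volumeMeasure g (contMDiff_divPairing g hφ).continuous)
    (integrable_volumeMeasure g hE)] at h3
  linarith

end Scalars

/-! ### Functions depending on a parameter -/

section Parameter

variable {F : E4 × ℝ → ℝ} {U : Set E4} {y : E4}

theorem contDiffAt_of_prod_univ (hU : IsOpen U) (hF : ContDiffOn ℝ ∞ F (U ×ˢ univ)) (hy : y ∈ U)
    (t : ℝ) : ContDiffAt ℝ ∞ F (y, t) :=
  hF.contDiffAt ((hU.prod isOpen_univ).mem_nhds ⟨hy, mem_univ t⟩)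

theorem pderiv_param (hU : IsOpen U) (hF : ContDiffOn ℝ ∞ F (U ×ˢ univ)) (hy : y ∈ U) (t : ℝ)
    (i : Fin 4) : pderiv i (fun z => F (z, t)) y = fderiv ℝ F (y, t) (EuclideanSpace.single i 1, 0) := by
  have h1 : HasFDerivAt F (fderiv ℝ F (y, t)) (y, t) :=
    ((contDiffAt_of_prod_univ hU hF hy t).differentiableAt (by simp)).hasFDerivAt
  have h2 : HasFDerivAt (fun z : E4 => (z, t)) ((ContinuousLinearMap.id ℝ E4).prod 0) y :=
    (hasFDerivAt_id y).prodMk (hasFDerivAt_const t y)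
  have h3 : HasFDerivAt (fun z => F (z, t)) _ y := h1.comp y h2
  rw [pderiv, h3.fderiv]
  simp

theorem hasDerivAt_param (hU : IsOpen U) (hF : ContDiffOn ℝ ∞ F (U ×ˢ univ)) (hy : y ∈ U) (t : ℝ) :
    HasDerivAt (fun s => F (y, s)) (fderiv ℝ F (y, t) (0, 1)) t := by
  have h1 : HasFDerivAt F (fderiv ℝ F (y, t)) (y, t) :=
    ((contDiffAt_of_prod_univ hU hF hy t).differentiableAt (by simp)).hasFDerivAt
  exact h1.comp_hasDerivAt t ((hasDerivAt_const t y).prodMk (hasDerivAt_id t))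

theorem contDiffOn_fderiv_apply (hU : IsOpen U) (hF : ContDiffOn ℝ ∞ F (U ×ˢ univ)) (v : E4 × ℝ) :
    ContDiffOn ℝ ∞ (fun p => fderiv ℝ F p v) (U ×ˢ univ) :=
  (hF.fderiv_of_isOpen (hU.prod isOpen_univ) (m := ∞) (by simp)).clm_apply contDiffOn_const

theorem contDiffOn_pderiv_param (hU : IsOpen U) (hF : ContDiffOn ℝ ∞ F (U ×ˢ univ)) (i : Fin 4) :
    ContDiffOn ℝ ∞ (fun p : E4 × ℝ => pderiv i (fun z => F (z, p.2)) p.1) (U ×ˢ univ) :=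
  (contDiffOn_fderiv_apply hU hF _).congr fun p hp => pderiv_param hU hF hp.1 p.2 i

theorem contDiffOn_deriv_param (hU : IsOpen U) (hF : ContDiffOn ℝ ∞ F (U ×ˢ univ)) (t : ℝ) :
    ContDiffOn ℝ ∞ (fun z => deriv (fun s => F (z, s)) t) U :=
  ((contDiffOn_fderiv_apply hU hF (0, 1)).comp (contDiff_id.prodMk contDiff_const).contDiffOn
    fun _ hz => ⟨hz, mem_univ t⟩).congr fun _ hz => (hasDerivAt_param hU hF hz t).deriv

/-- Symmetry of the second derivative on the product space: the space derivative commutes with the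
derivative in the parameter. -/
theorem hasDerivAt_pderiv_param (hU : IsOpen U) (hF : ContDiffOn ℝ ∞ F (U ×ˢ univ)) (hy : y ∈ U)
    (t : ℝ) (i : Fin 4) : HasDerivAt (fun s => pderiv i (fun z => F (z, s)) y)
      (pderiv i (fun z => deriv (fun s => F (z, s)) t) y) t := by
  have hs : IsSymmSndFDerivAt ℝ F (y, t) := (contDiffAt_of_prod_univ hU hF hy t).isSymmSndFDerivAt
    (by simpa using (WithTop.coe_le_coe.2 le_top : ((2 : ℕ∞) : WithTop ℕ∞) ≤ ((⊤ : ℕ∞) : WithTop ℕ∞)))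
  have hd : DifferentiableAt ℝ (fderiv ℝ F) (y, t) :=
    ((hF.fderiv_of_isOpen (hU.prod isOpen_univ) (m := ∞) (by simp)).contDiffAt
      ((hU.prod isOpen_univ).mem_nhds ⟨hy, mem_univ t⟩)).differentiableAt (by simp)
  have hv : ∀ v w : E4 × ℝ, fderiv ℝ (fun p => fderiv ℝ F p v) (y, t) w
      = fderiv ℝ (fderiv ℝ F) (y, t) w v := fun v w => by
    rw [fderiv_clm_apply hd (differentiableAt_const v)]
    simp
  have h1 := hasDerivAt_param hU (contDiffOn_fderiv_apply hU hF (EuclideanSpace.single i 1, 0)) hy t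
  have h2 := pderiv_param hU (contDiffOn_fderiv_apply hU hF (0, 1)) hy t i
  rw [hv] at h1 h2
  rw [hs.eq] at h1
  rw [pderiv_congr_on hU hy fun z hz => (hasDerivAt_param hU hF hz t).deriv, h2]
  simp only [pderiv_param hU hF hy]
  exact h1

/-- Differentiation under the integral sign over a compact set. -/
theorem hasDerivAt_integral_param {K : Set E4} (hU : IsOpen U) (hK : IsCompact K) (hKU : K ⊆ U)
    {w : E4 → ℝ} (hw : ContinuousOn w K) (hF : ContDiffOn ℝ ∞ F (U ×ˢ univ)) :
    HasDerivAt (fun t => ∫ y in K, w y * F (y, t))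
      (∫ y in K, w y * deriv (fun s => F (y, s)) 0) 0 := by
  have hc : ∀ {H : E4 × ℝ → ℝ}, ContDiffOn ℝ ∞ H (U ×ˢ univ) →
      ContinuousOn (fun p : E4 × ℝ => w p.1 * H p) (K ×ˢ univ) := fun hH =>
    (hw.comp continuousOn_fst fun p hp => hp.1).mul (hH.continuousOn.mono (prod_mono hKU le_rfl))
  have hs : ∀ {H : E4 × ℝ → ℝ}, ContDiffOn ℝ ∞ H (U ×ˢ univ) → ∀ t,
      ContinuousOn (fun y => w y * H (y, t)) K := fun hH t =>
    (hc hH).comp (Continuous.prodMk_left t).continuousOn fun y hy => ⟨hy, mem_univ t⟩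
  have hF' := contDiffOn_fderiv_apply hU hF (0, 1)
  -- The parameter derivative is continuous on the compact set K × [-1, 1], so a constant serves as
  -- dominating function.
  obtain ⟨C, hC⟩ := (hK.prod (isCompact_Icc (a := (-1 : ℝ)) (b := 1))).exists_bound_of_continuousOn
    ((hc hF').mono (prod_mono le_rfl (subset_univ _)))
  have key := (hasDerivAt_integral_of_dominated_loc_of_deriv_le (μ := volume.restrict K)
    (F := fun t y => w y * F (y, t)) (F' := fun t y => w y * fderiv ℝ F (y, t) (0, 1))
    (bound := fun _ => C) (x₀ := (0 : ℝ)) (s := Icc (-1) 1) (Icc_mem_nhds (by norm_num) (by norm_num))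
    (.of_forall fun t => (hs hF t).aestronglyMeasurable hK.measurableSet)
    ((hs hF 0).integrableOn_compact hK)
    ((hs hF' 0).aestronglyMeasurable hK.measurableSet)
    ?_ (integrableOn_const hK.measure_ne_top) ?_).2
  · have h1 : ∫ y in K, w y * deriv (fun s => F (y, s)) 0
        = ∫ y in K, w y * fderiv ℝ F (y, 0) (0, 1) :=
      setIntegral_congr_fun hK.measurableSet fun y hy => by
        beta_reduce
        rw [(hasDerivAt_param hU hF (hKU hy) 0).deriv]
    rw [h1]
    exact key
  · exact (ae_restrict_iff' hK.measurableSet).2 (.of_forall fun y hy t ht => hC (y, t) ⟨hy, ht⟩)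
  · exact (ae_restrict_iff' hK.measurableSet).2 (.of_forall fun y hy t _ =>
      (hasDerivAt_param hU hF (hKU hy) t).const_mul _)

end Parameter

section Manifold

variable {M : Type*} [TopologicalSpace M] [ChartedSpace E4 M] [IsManifold (𝓡 4) ∞ M]
  (g : Metric4 M) {e : OpenPartialHomeomorph M E4} {Φ : M → ℝ → ℝ}

/-- The function `Φ(x, t)` is smooth in all charts of the atlas. -/
def SmoothParam (Φ : M → ℝ → ℝ) : Prop :=
  ∀ j : M, ContDiffOn ℝ ∞ (fun p : E4 × ℝ => Φ ((chartAt E4 j).symm p.1) p.2)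
    ((chartAt E4 j).target ×ˢ univ)

theorem SmoothParam.contMDiff (h : SmoothParam Φ) (t : ℝ) :
    ContMDiff (𝓡 4) 𝓘(ℝ, ℝ) ∞ fun x => Φ x t :=
  contMDiff_of_comp_symm fun j => (h j).comp (contDiff_id.prodMk contDiff_const).contDiffOn
    fun _ hz => ⟨hz, mem_univ t⟩

theorem SmoothParam.contMDiff_deriv (h : SmoothParam Φ) (t : ℝ) :
    ContMDiff (𝓡 4) 𝓘(ℝ, ℝ) ∞ fun x => deriv (Φ x) t :=
  contMDiff_of_comp_symm fun j => contDiffOn_deriv_param (chartAt E4 j).open_target (h j) t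

theorem SmoothParam.of_contMDiff
    (h : ContMDiff ((𝓡 4).prod 𝓘(ℝ, ℝ)) 𝓘(ℝ, ℝ) ∞ (fun q : M × ℝ => Φ q.1 q.2)) :
    SmoothParam Φ := fun j => by
  have h1 : ContMDiffOn 𝓘(ℝ, E4 × ℝ) (𝓡 4) ∞ (fun p : E4 × ℝ => (chartAt E4 j).symm p.1)
      ((chartAt E4 j).target ×ˢ univ) :=
    (contMDiffOn_symm_of_mem_maximalAtlas (isChart_chartAt j)).comp
      contDiff_fst.contMDiff.contMDiffOn fun p hp => hp.1
  have h2 : ContMDiffOn 𝓘(ℝ, E4 × ℝ) 𝓘(ℝ, ℝ) ∞ (fun p : E4 × ℝ => p.2)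
      ((chartAt E4 j).target ×ˢ univ) := contDiff_snd.contMDiff.contMDiffOn
  exact (h.comp_contMDiffOn (h1.prodMk h2)).contDiffOn

/-- The domain becomes a compact set that depends only on ρ, which is where differentiation under
the integral sign applies. -/
theorem chartIntegral_eq_integral_image {ρ : M → ℝ} (hs : tsupport ρ ⊆ e.source) (f : M → ℝ) :
    chartIntegral g e (fun x => ρ x * f x) = ∫ y in e '' tsupport ρ,
      (ρ (e.symm y) * Real.sqrt (coordMetric g e y).det) * f (e.symm y) := by
  rw [chartIntegral, setIntegral_eq_of_subset_of_forall_sdiff_eq_zero e.open_target.measurableSet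
    (image_tsupport_subset hs)]
  · exact integral_congr_ae (.of_forall fun y => by ring)
  · intro y hy
    rw [eq_zero_of_notMem_image_tsupport hy.1 hy.2, zero_mul, zero_mul]

variable [CompactSpace M] [T2Space M] [MeasurableSpace M] [BorelSpace M]

theorem SmoothParam.hasDerivAt_integral (h : SmoothParam Φ) :
    HasDerivAt (fun t => ∫ x, Φ x t ∂(volumeMeasure g))
      (∫ x, deriv (Φ x) 0 ∂(volumeMeasure g)) 0 := by
  simp only [integral_volumeMeasure g (h.contMDiff _).continuous,
    integral_volumeMeasure g (h.contMDiff_deriv 0).continuous]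
  refine HasDerivAt.fun_sum fun j _ => ?_
  have hs := tsupport_atlasPartition j
  simp only [chartIntegral_eq_integral_image g hs]
  exact hasDerivAt_integral_param (chartAt E4 j).open_target (isCompact_image_tsupport hs)
    (image_tsupport_subset hs) (((isChart_chartAt j).continuousOn_mul_sqrt_det g
      (atlasPartition M j).contMDiff.continuous.continuousOn).mono (image_tsupport_subset hs)) (h j)

/-- In dimension four √det(e^{2f}g) = e^{4f}√det g. This moves every integral in the variation to
the fixed measure of g. -/
theorem integral_conformalMetric {f h : M → ℝ} (hf : ContMDiff (𝓡 4) 𝓘(ℝ, ℝ) ∞ f)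
    (hh : Continuous h) : ∫ x, h x ∂(volumeMeasure (conformalMetric g f hf))
      = ∫ x, Real.exp (4 * f x) * h x ∂(volumeMeasure g) := by
  have he : Continuous fun x => Real.exp (4 * f x) * h x :=
    (Real.continuous_exp.comp (continuous_const.mul hf.continuous)).mul hh
  rw [integral_volumeMeasure _ hh, integral_volumeMeasure _ he]
  refine Finset.sum_congr rfl fun j _ => ?_
  simp only [chartIntegral, coordMetric_conformalMetric]
  refine integral_congr_ae (.of_forall fun y => ?_)
  have h1 : Real.sqrt (conformal (coordMetric g (chartAt E4 j)) (fun y => f ((chartAt E4 j).symm y)) y).det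
      = Real.exp (4 * f ((chartAt E4 j).symm y)) * Real.sqrt (coordMetric g (chartAt E4 j) y).det := by
    have h2 : Real.exp (2 * f ((chartAt E4 j).symm y)) ^ 4
        = Real.exp (4 * f ((chartAt E4 j).symm y)) ^ 2 := by
      rw [← Real.exp_nat_mul, ← Real.exp_nat_mul]
      congr 1
      push_cast
      ring
    rw [conformal, Matrix.det_smul, Fintype.card_fin, h2, Real.sqrt_mul (sq_nonneg _),
      Real.sqrt_sq (Real.exp_pos _).le]
  beta_reduce
  rw [h1]
  ring

end Manifold

/-! ### The first variation in a conformal class -/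

theorem hasDerivAt_pairing (h : Matrix (Fin 4) (Fin 4) ℝ) {k : ℕ} {T S : ℝ → (Fin k → Fin 4) → ℝ}
    {T' S' : (Fin k → Fin 4) → ℝ} {t : ℝ} (hT : ∀ I, HasDerivAt (fun s => T s I) (T' I) t)
    (hS : ∀ I, HasDerivAt (fun s => S s I) (S' I) t) :
    HasDerivAt (fun s => pairing h (T s) (S s)) (pairing h T' (S t) + pairing h (T t) S') t := by
  simp only [pairing, ← Finset.sum_add_distrib]
  exact HasDerivAt.fun_sum fun I _ => (hT I).mul (HasDerivAt.fun_sum fun J _ => (hS J).const_mul _)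

/-- The integrand of `𝔇(e^{2u} g)`, in coordinates. -/
def conformalEnergy (G : CoordMetric) (u : E4 → ℝ) (y : E4) : ℝ :=
  Real.exp (4 * u y) * (Real.exp (-6 * u y) *
    (normSq G (divWeyl G) y + 2 * pairing (G y)⁻¹ (divWeyl G y) (weylGrad G u y)
      + normSq G (weylGrad G u) y))

section Coordinates

variable {G : CoordMetric} {U : Set E4} {F : E4 × ℝ → ℝ} {y : E4}

theorem IsMetricOn.contDiffOn_weylGrad_param (hG : IsMetricOn G U)
    (hF : ContDiffOn ℝ ∞ F (U ×ˢ univ)) (I : Fin 3 → Fin 4) :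
    ContDiffOn ℝ ∞ (fun p : E4 × ℝ => weylGrad G (fun z => F (z, p.2)) p.1 I) (U ×ˢ univ) :=
  ContDiffOn.sum fun _ _ => ContDiffOn.sum fun _ _ =>
    ((hG.smooth_inv _ _).comp contDiffOn_fst fun _ hp => hp.1).mul
      (((hG.smooth_weyl _ _ _ _).comp contDiffOn_fst fun _ hp => hp.1).mul
        (contDiffOn_pderiv_param hG.isOpen hF _))

theorem IsMetricOn.contDiffOn_conformalEnergy (hG : IsMetricOn G U)
    (hF : ContDiffOn ℝ ∞ F (U ×ˢ univ)) :
    ContDiffOn ℝ ∞ (fun p : E4 × ℝ => conformalEnergy G (fun z => F (z, p.2)) p.1) (U ×ˢ univ) := by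
  have hw := hG.contDiffOn_weylGrad_param hF
  have hp : ∀ {T S : E4 × ℝ → (Fin 3 → Fin 4) → ℝ}, (∀ I, ContDiffOn ℝ ∞ (fun p => T p I) (U ×ˢ univ)) →
      (∀ I, ContDiffOn ℝ ∞ (fun p => S p I) (U ×ˢ univ)) →
      ContDiffOn ℝ ∞ (fun p => pairing (G p.1)⁻¹ (T p) (S p)) (U ×ˢ univ) := fun hT hS =>
    ContDiffOn.sum fun I _ => (hT I).mul (ContDiffOn.sum fun J _ =>
      (contDiffOn_prod fun a _ => (hG.smooth_inv (I a) (J a)).comp contDiffOn_fst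
        fun _ hp => hp.1).mul (hS J))
  have hd : ∀ I, ContDiffOn ℝ ∞ (fun p : E4 × ℝ => divWeyl G p.1 I) (U ×ˢ univ) := fun I =>
    (hG.smooth_divWeyl I).comp contDiffOn_fst fun _ hp => hp.1
  exact (contDiffOn_const.mul hF).exp.mul ((contDiffOn_const.mul hF).exp.mul
    (((hp hd hd).add (contDiffOn_const.mul (hp hd hw))).add (hp hw hw)))

/-- W(∇u) vanishes at t = 0, so its square does not contribute to first order; the exponents 4 and
-6 combine to -2. -/
theorem IsMetricOn.hasDerivAt_conformalEnergy (hG : IsMetricOn G U)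
    (hF : ContDiffOn ℝ ∞ F (U ×ˢ univ)) (h0 : ∀ z ∈ U, F (z, 0) = 0) (hy : y ∈ U) :
    HasDerivAt (fun t => conformalEnergy G (fun z => F (z, t)) y)
      (-2 * deriv (fun t => F (y, t)) 0 * normSq G (divWeyl G) y
        + 2 * pairing (G y)⁻¹ (divWeyl G y) (weylGrad G (fun z => deriv (fun t => F (z, t)) 0) y)) 0 := by
  have hU := hG.isOpen
  have hFy := (hasDerivAt_param hU hF hy 0).differentiableAt.hasDerivAt
  have hw : ∀ I, HasDerivAt (fun t => weylGrad G (fun z => F (z, t)) y I)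
      (weylGrad G (fun z => deriv (fun t => F (z, t)) 0) y I) 0 := fun I =>
    HasDerivAt.fun_sum fun _ _ => HasDerivAt.fun_sum fun _ _ =>
      ((hasDerivAt_pderiv_param hU hF hy 0 _).const_mul _).const_mul _
  have hw0 : weylGrad G (fun z => F (z, 0)) y = fun _ => 0 := by
    funext I
    simp only [weylGrad, pderiv_congr_on hU hy h0, pderiv_const, mul_zero, Finset.sum_const_zero]
  have hp := hasDerivAt_pairing (G y)⁻¹ (T := fun _ => divWeyl G y)
    (fun I => hasDerivAt_const (0 : ℝ) (divWeyl G y I)) hw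
  have hn := hasDerivAt_pairing (G y)⁻¹ hw hw
  have key := ((hFy.const_mul 4).exp).fun_mul (((hFy.const_mul (-6)).exp).fun_mul
    (((hp.const_mul 2).const_add (normSq G (divWeyl G) y)).fun_add hn))
  have hz : ∀ T : (Fin 3 → Fin 4) → ℝ, pairing (G y)⁻¹ (fun _ => 0) T = 0 := fun T => by simp [pairing]
  have hz' : ∀ T : (Fin 3 → Fin 4) → ℝ, pairing (G y)⁻¹ T (fun _ => 0) = 0 := fun T => by simp [pairing]
  refine key.congr_deriv ?_
  simp only [hw0, h0 y hy, hz, hz', mul_zero, Real.exp_zero]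
  ring

end Coordinates

section Variation

variable {M : Type*} [TopologicalSpace M] [ChartedSpace E4 M] [IsManifold (𝓡 4) ∞ M]
  (g : Metric4 M) {u : M → ℝ → ℝ}

theorem exp_mul_divWeylNormSq_conformalMetric {e : OpenPartialHomeomorph M E4} (he : IsChart e)
    {f : M → ℝ} (hf : ContMDiff (𝓡 4) 𝓘(ℝ, ℝ) ∞ f) {y : E4} (hy : y ∈ e.target) :
    Real.exp (4 * f (e.symm y)) * divWeylNormSq (conformalMetric g f hf) (e.symm y)
      = conformalEnergy (coordMetric g e) (fun z => f (e.symm z)) y := by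
  rw [divWeylNormSq_eq _ he hy, coordMetric_conformalMetric,
    (he.isMetricOn g).normSq_divWeyl_conformal (he.smooth_comp_symm hf) hy]
  rfl

/-- The Weitzenboeck formula on the manifold. -/
theorem half_laplacian_weylNormSq (x : M) : (1 / 2) * laplacian g (weylNormSq g) x =
    gradWeylNormSq g x + (1 / 2) * scalarCurvature g x * weylNormSq g x
      - 3 * weylCube g x + 4 * (divEnergy g x - divWeylNormSq g x) := by
  have he := isChart_chartAt (M := M) x
  have hG := he.isMetricOn g
  have hx := mem_chart_target E4 x
  have h1 : laplacian g (weylNormSq g) x = coordLaplacian (coordMetric g (chartAt E4 x))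
      (normSq (coordMetric g (chartAt E4 x)) (weylTensor (coordMetric g (chartAt E4 x))))
      (chartAt E4 x x) :=
    coordLaplacian_congr hG.isOpen hx fun z hz => weylNormSq_eq g he hz
  have h2 : divEnergy g x - divWeylNormSq g x = pairing (coordMetric g (chartAt E4 x) (chartAt E4 x x))⁻¹
      (weylTensor (coordMetric g (chartAt E4 x)) (chartAt E4 x x))
      (gradDivWeyl (coordMetric g (chartAt E4 x)) (chartAt E4 x x)) := by
    rw [divEnergy, divWeylNormSq, atPoint, atPoint, hG.coordDiv_divCovector hx]
    ring
  rw [h1, h2, hG.weitzenboeck hx]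
  rfl

variable [T2Space M] [CompactSpace M] [MeasurableSpace M]

/-- The variation formula needs positive volume, so the empty manifold is treated apart. -/
theorem isConformallyCritical_of_isEmpty [IsEmpty M] : IsConformallyCritical g := by
  intro u hu h0
  have : ∀ g' : Metric4 M, functionalD g' = 0 := fun g' => by
    rw [functionalD, Measure.eq_zero_of_isEmpty (volumeMeasure g'), integral_zero_measure, mul_zero]
  simp only [this]
  exact hasDerivAt_const _ _

variable [BorelSpace M]

/-- The first variation of `𝔇` in the conformal class of `g`. -/
theorem hasDerivAt_functionalD [Nonempty M]
    (hu : ContMDiff ((𝓡 4).prod 𝓘(ℝ, ℝ)) 𝓘(ℝ, ℝ) ∞ (fun q : M × ℝ => u q.1 q.2))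
    (h0 : ∀ x, u x 0 = 0) :
    HasDerivAt (fun t : ℝ => functionalD (conformalMetric g (fun x => u x t)
        (hu.comp (contMDiff_id.prodMk contMDiff_const))))
      (-2 * vol g ^ (1 / 2 : ℝ) * ∫ x, deriv (u x) 0 * (divWeylNormSq g x + divEnergy g x
        - (∫ y, divWeylNormSq g y ∂(volumeMeasure g)) / vol g) ∂(volumeMeasure g)) 0 := by
  have hu' := SmoothParam.of_contMDiff hu
  have hut : ∀ t, ContMDiff (𝓡 4) 𝓘(ℝ, ℝ) ∞ fun x => u x t := fun t =>
    hu.comp (contMDiff_id.prodMk contMDiff_const)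
  set φ : M → ℝ := fun x => deriv (u x) 0 with hφdef
  have hφ : ContMDiff (𝓡 4) 𝓘(ℝ, ℝ) ∞ φ := hu'.contMDiff_deriv 0
  set N := divWeylNormSq g
  have hN : Continuous N := (contMDiff_divWeylNormSq g).continuous
  have hE : Continuous (divEnergy g) := (contMDiff_divEnergy g).continuous
  set A : ℝ := ∫ y, N y ∂(volumeMeasure g)
  have hV : SmoothParam fun x t => Real.exp (4 * u x t) := fun j => (contDiffOn_const.mul (hu' j)).exp
  have hchart : ∀ j : M, ∀ p ∈ (chartAt E4 j).target ×ˢ (univ : Set ℝ),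
      Real.exp (4 * u ((chartAt E4 j).symm p.1) p.2)
        * divWeylNormSq (conformalMetric g (fun x => u x p.2) (hut p.2)) ((chartAt E4 j).symm p.1)
      = conformalEnergy (coordMetric g (chartAt E4 j)) (fun z => u ((chartAt E4 j).symm z) p.2) p.1 :=
    fun j p hp => exp_mul_divWeylNormSq_conformalMetric g (isChart_chartAt j) (hut p.2) hp.1
  have hD : SmoothParam fun x t => Real.exp (4 * u x t)
      * divWeylNormSq (conformalMetric g (fun x => u x t) (hut t)) x := fun j =>
    (((isChart_chartAt j).isMetricOn g).contDiffOn_conformalEnergy (hu' j)).congr (hchart j)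
  have hV' : ∀ x, deriv (fun t => Real.exp (4 * u x t)) 0 = 4 * φ x := by
    intro x
    have hx := mem_chart_target E4 x
    have h1 := (hasDerivAt_param (chartAt E4 x).open_target (hu' x) hx 0).differentiableAt.hasDerivAt
    simp only [(chartAt E4 x).left_inv (mem_chart_source E4 x)] at h1
    rw [((h1.const_mul 4).exp).deriv, h0]
    simp [hφdef]
  have hD' : ∀ x, deriv (fun t => Real.exp (4 * u x t)
      * divWeylNormSq (conformalMetric g (fun x => u x t) (hut t)) x) 0
      = -2 * φ x * N x + 2 * divPairing g φ x := by
    intro x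
    have hx := mem_chart_target E4 x
    have hxx := (chartAt E4 x).left_inv (mem_chart_source E4 x)
    have h1 := ((isChart_chartAt x).isMetricOn g).hasDerivAt_conformalEnergy (hu' x)
      (fun z _ => h0 _) hx
    have h2 : (fun t => Real.exp (4 * u x t)
        * divWeylNormSq (conformalMetric g (fun x => u x t) (hut t)) x)
        = fun t => conformalEnergy (coordMetric g (chartAt E4 x))
          (fun z => u ((chartAt E4 x).symm z) t) (chartAt E4 x x) := by
      funext t
      have h3 := hchart x (chartAt E4 x x, t) ⟨hx, mem_univ t⟩
      simp only [hxx] at h3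
      exact h3
    rw [h2, h1.deriv]
    simp only [hxx]
    rfl
  have hI : ∀ {f : M → ℝ}, Continuous f → Integrable f (volumeMeasure g) :=
    fun hf => integrable_volumeMeasure g hf
  have hVd := hV.hasDerivAt_integral g
  have hDd := hD.hasDerivAt_integral g
  simp only [hV'] at hVd
  simp only [hD'] at hDd
  have hvol := vol_pos g
  have hV0 : ∫ x, Real.exp (4 * u x 0) ∂(volumeMeasure g) = vol g := by
    simp only [h0, mul_zero, Real.exp_zero, vol_eq_integral]
  have hN0 : ∀ x, Real.exp (4 * u x 0)
      * divWeylNormSq (conformalMetric g (fun x => u x 0) (hut 0)) x = N x := by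
    intro x
    have hx := mem_chart_target E4 x
    have hxx := (chartAt E4 x).left_inv (mem_chart_source E4 x)
    have h3 := hchart x (chartAt E4 x x, 0) ⟨hx, mem_univ _⟩
    simp only [hxx, h0] at h3
    simp only [h0]
    rw [h3, conformalEnergy]
    have hw0 : weylGrad (coordMetric g (chartAt E4 x)) (fun _ => (0 : ℝ)) (chartAt E4 x x)
        = fun _ => 0 := by
      funext I
      simp only [weylGrad, pderiv_const, mul_zero, Finset.sum_const_zero]
    simp only [normSq_eq_pairing, hw0]
    simp [pairing]
    rfl
  -- Both factors of 𝔇 become integrals against the measure of the initial metric, with all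
  -- dependence on `t` in the integrands.
  have hfun : (fun t : ℝ => functionalD (conformalMetric g (fun x => u x t)
      (hu.comp (contMDiff_id.prodMk contMDiff_const))))
      = fun t => (∫ x, Real.exp (4 * u x t) ∂(volumeMeasure g)) ^ (1 / 2 : ℝ)
        * ∫ x, Real.exp (4 * u x t)
          * divWeylNormSq (conformalMetric g (fun x => u x t) (hut t)) x ∂(volumeMeasure g) := by
    funext t
    rw [functionalD, vol_eq_integral, integral_conformalMetric g (hut t) continuous_const,
      integral_conformalMetric g (hut t) (contMDiff_divWeylNormSq _).continuous]
    simp only [mul_one]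
  have key := (hVd.rpow_const (p := (1 / 2 : ℝ)) (Or.inl (by rw [hV0]; exact hvol.ne'))).mul hDd
  rw [hfun]
  refine key.congr_deriv ?_
  have e1 : ∫ x, 4 * φ x ∂(volumeMeasure g) = 4 * ∫ x, φ x ∂(volumeMeasure g) := integral_const_mul _ _
  have e2 : ∫ x, (-2 * φ x * N x + 2 * divPairing g φ x) ∂(volumeMeasure g)
      = -2 * ∫ x, φ x * N x ∂(volumeMeasure g) - 2 * ∫ x, φ x * divEnergy g x ∂(volumeMeasure g) := by
    have hc1 : Continuous fun x => -2 * φ x * N x := (continuous_const.mul hφ.continuous).mul hN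
    have hc2 : Continuous fun x => 2 * divPairing g φ x :=
      continuous_const.mul (contMDiff_divPairing g hφ).continuous
    rw [integral_add (hI hc1) (hI hc2), integral_const_mul, integral_divPairing g hφ]
    simp only [mul_assoc]
    rw [integral_const_mul]
    ring
  have e3 : ∫ x, φ x * (N x + divEnergy g x - A / vol g) ∂(volumeMeasure g)
      = ∫ x, φ x * N x ∂(volumeMeasure g) + ∫ x, φ x * divEnergy g x ∂(volumeMeasure g)
        - (A / vol g) * ∫ x, φ x ∂(volumeMeasure g) := by
    have hc1 : Continuous fun x => φ x * N x := hφ.continuous.mul hN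
    have hc2 : Continuous fun x => φ x * divEnergy g x := hφ.continuous.mul hE
    have hc3 : Continuous fun x => (A / vol g) * φ x := continuous_const.mul hφ.continuous
    have hc4 : Continuous fun x => φ x * N x + φ x * divEnergy g x := hc1.add hc2
    rw [← integral_const_mul, ← integral_add (hI hc1) (hI hc2), ← integral_sub (hI hc4) (hI hc3)]
    exact integral_congr_ae (.of_forall fun x => by ring)
  rw [e1, e2, e3, hV0]
  simp only [hN0]
  -- The volume factor contributes ½ V^{-1/2} · 4A ∫ φ, rewritten as 2 V^{1/2} (A/V) ∫ φ; this is
  -- the origin of the mean value A/V.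
  rw [Real.rpow_sub_one hvol.ne']
  change _ * A + _ = _
  field_simp
  ring

theorem isConformallyCritical_iff [Nonempty M] : IsConformallyCritical g ↔
    ∀ x, divWeylNormSq g x + divEnergy g x
      - (∫ y, divWeylNormSq g y ∂(volumeMeasure g)) / vol g = 0 := by
  constructor
  · intro h
    set Z : M → ℝ := fun x => divWeylNormSq g x + divEnergy g x
      - (∫ y, divWeylNormSq g y ∂(volumeMeasure g)) / vol g with hZ
    have hZs : ContMDiff (𝓡 4) 𝓘(ℝ, ℝ) ∞ Z :=
      ((contMDiff_divWeylNormSq g).add (contMDiff_divEnergy g)).sub contMDiff_const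
    -- The family tZ has velocity Z, so its first variation is a nonzero multiple of ∫ Z².
    have hu : ContMDiff ((𝓡 4).prod 𝓘(ℝ, ℝ)) 𝓘(ℝ, ℝ) ∞ (fun q : M × ℝ => q.2 * Z q.1) :=
      contMDiff_snd.mul (hZs.comp contMDiff_fst)
    have h0 : ∀ x, (fun (x : M) (t : ℝ) => t * Z x) x 0 = 0 := fun x => zero_mul _
    have h1 := (hasDerivAt_functionalD g (u := fun x t => t * Z x) hu h0).unique
      (h (fun x t => t * Z x) hu h0)
    have h2 : ∀ x, deriv (fun t : ℝ => t * Z x) 0 = Z x := fun x => by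
      simp
    simp only [h2] at h1
    have hv : vol g ^ (1 / 2 : ℝ) ≠ 0 := (Real.rpow_pos_of_pos (vol_pos g) _).ne'
    have h3 : ∫ x, Z x * Z x ∂(volumeMeasure g) = 0 := by
      rcases mul_eq_zero.1 h1 with h4 | h4
      · exact absurd h4 (mul_ne_zero (by norm_num) hv)
      · exact h4
    intro x
    exact mul_self_eq_zero.1 (eq_zero_of_integral_eq_zero g (hZs.continuous.mul hZs.continuous)
      (fun x => mul_self_nonneg _) h3 x)
  · intro h u hu h0
    have := hasDerivAt_functionalD g hu h0
    simpa only [h, mul_zero, integral_zero] using this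

end Variation

end WeakHarmonicWeyl

end

theorem mainTheorem4 {M : Type*} [TopologicalSpace M] [T2Space M] [CompactSpace M]
    [ChartedSpace E4 M] [IsManifold (𝓡 4) ∞ M] [MeasurableSpace M] [BorelSpace M]
    (g : Metric4 M) :
    IsConformallyCritical g ↔
      ∀ x : M, (1 / 2) * laplacian g (weylNormSq g) x =
        gradWeylNormSq g x + (1 / 2) * scalarCurvature g x * weylNormSq g x
          - 3 * weylCube g x - 8 * divWeylNormSq g x
          + 4 / vol g * ∫ y, divWeylNormSq g y ∂(volumeMeasure g) := by
  cases isEmpty_or_nonempty M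
  · exact iff_of_true (isConformallyCritical_of_isEmpty g) fun x => isEmptyElim x
  · rw [isConformallyCritical_iff]
    refine forall_congr' fun x => ?_
    rw [half_laplacian_weylNormSq]
    constructor <;> intro h
    -- After the Weitzenböck formula the two sides of the equation differ by exactly 4 times the
    -- Euler-Lagrange expression.
    · linear_combination 4 * h
    · linear_combination (1 / 4) * h
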